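/- **Model.** Algorithms are deterministic programs of a word RAM with word length $w$: a fixed finite program with finitely many registers and word-indexed arrays, unit-cost arithmetic (modulo $2^w$), bitwise and comparison operations on $w$-bit words, array reads and writes, branching and loops. Memory outside the input may initially hold arbitrary words. A program for graphs with $n$ vertices and a parameter $k$ is required to work for every $w$ with $2^w\ge (n+k+2)^c$, where $c$ is a constant of the program. Graphs are finite, simple, undirected and unweighted, with vertex set $\{0,\dots,n-1\}$, and are given by $n$, $m$ and a list of their $m$ edges in arbitrary order and orientation. **Definitions.** Two vertices $s,t$ of $G$ are *$k$-edge-connected* if they remain connected after deleting any fewer than $k$ edges of $G$; a graph is $k$-edge-connected if all pairs of its vertices are. The *maximal $k$-edge-connected subgraphs* of $G$ are the inclusion-maximal nonempty vertex sets $S$ such that the induced graph $G[S]$ is $k$-edge-connected; they partition the vertex set. To compute them is to output a label for each vertex such that the classes of equally labelled vertices are exactly these sets. Let $K$ be a set of positive integers, the admissible values of the input parameter $k$, and let $t_p(k,n)$, $t_q(k,n)$ be real-valued functions that are non-decreasing in $n$ for each $k\in K$. A *decremental algorithm supporting pairwise $k$-edge-connectivity* for $k\in K$ with bounds $t_p,t_q$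 consists of three programs sharing a memory (preprocess, delete an edge, query a pair) such that for every $k\in K$, every initial graph $G_0$ with $n\ge 2$ vertices and $m$ edges, and every finite sequence of deletions of edges of the current graph and queries for pairs $(s,t)$: - each query correctly reports whether $s$ and $t$ are $k$-edge-connected in the current graph, in at most $t_q(k,n)$ steps; - preprocessing and all deletions together take at most $t_p(k,n)\cdot(n+m)$ steps. **Lemma.** There is an absolute constant $C$ such that the following holds. Suppose there is a deterministic decremental algorithm supporting pairwise $k$-edge-connectivity for $k\in K$ with bounds $t_p,t_q$ as above. Then there is a deterministic algorithm that, given $k\in K$ and a graph $G$ with $n\ge 2$ vertices and $m$ edges, computes the maximal $k$-edge-connected subgraphs of $G$ in at most $$C\cdot\bigl(m+(t_p(k,n)+t_q(k,n))\cdot k\,n\log^2 n\bigr)$$ steps. -/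

import Mathlib

/-!
A word RAM with word length `w`, presented as a small imperative language with a step count, and,
over it, decremental algorithms for pairwise `k`-edge-connectivity and the output condition for the
maximal `k`-edge-connected subgraphs.
-/

namespace WordRAM

/-- The memory: registers `var x` and arrays `arr a`, addressed by words. -/
structure State where
  var : ℕ → ℕ
  arr : ℕ → ℕ → ℕ

/-- All memory cells hold `w`-bit words. -/
def State.IsWord (w : ℕ) (s : State) : Prop :=
  (∀ x, s.var x < 2 ^ w) ∧ ∀ a i, s.arr a i < 2 ^ w

def State.setVar (s : State) (x v : ℕ) : State :=
  { s with var := Function.update s.var x v }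

def State.setArr (s : State) (a i v : ℕ) : State :=
  { s with arr := Function.update s.arr a (Function.update (s.arr a) i v) }

/-- The unit-cost operations on words. -/
inductive Op where
  | add | sub | mul | div | mod | and | or | xor | shl | shr | lt | eq

/-- Arithmetic is modulo `2 ^ w`; a comparison returns `1` for true and `0` for false. -/
def Op.eval (w : ℕ) : Op → ℕ → ℕ → ℕ
  | .add, a, b => (a + b) % 2 ^ w
  | .sub, a, b => (a + 2 ^ w - b) % 2 ^ w
  | .mul, a, b => (a * b) % 2 ^ w
  | .div, a, b => a / b
  | .mod, a, b => a % b
  | .and, a, b => a &&& b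
  | .or, a, b => a ||| b
  | .xor, a, b => a ^^^ b
  | .shl, a, b => (a <<< b) % 2 ^ w
  | .shr, a, b => a >>> b
  | .lt, a, b => if a < b then 1 % 2 ^ w else 0
  | .eq, a, b => if a = b then 1 % 2 ^ w else 0

/-- Expressions: literals, registers, array cells and applied operations. -/
inductive Expr where
  | lit (v : ℕ)
  | var (x : ℕ)
  | load (a : ℕ) (i : Expr)
  | op (o : Op) (e₁ e₂ : Expr)

def Expr.eval (w : ℕ) (s : State) : Expr → ℕ
  | .lit v => v % 2 ^ w
  | .var x => s.var x
  | .load a i => s.arr a (i.eval w s)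
  | .op o e₁ e₂ => o.eval w (e₁.eval w s) (e₂.eval w s)

/-- The number of steps to evaluate an expression: one for each node. -/
def Expr.cost : Expr → ℕ
  | .lit _ => 1
  | .var _ => 1
  | .load _ i => i.cost + 1
  | .op _ e₁ e₂ => e₁.cost + e₂.cost + 1

/-- Programs. A program names only finitely many registers and arrays, whatever the input is. -/
inductive Cmd where
  | skip
  | assign (x : ℕ) (e : Expr)
  | store (a : ℕ) (i e : Expr)
  | seq (c₁ c₂ : Cmd)
  | cond (e : Expr) (c₁ c₂ : Cmd)
  | loop (e : Expr) (c : Cmd)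

/-- `Exec w c s t s'`: with word length `w`, the program `c` started in `s` halts in `s'` after
exactly `t` steps. -/
inductive Exec (w : ℕ) : Cmd → State → ℕ → State → Prop where
  | skip (s : State) : Exec w .skip s 1 s
  | assign (x : ℕ) (e : Expr) (s : State) :
      Exec w (.assign x e) s (e.cost + 1) (s.setVar x (e.eval w s))
  | store (a : ℕ) (i e : Expr) (s : State) :
      Exec w (.store a i e) s (i.cost + e.cost + 1) (s.setArr a (i.eval w s) (e.eval w s))
  | seq {c₁ c₂ : Cmd} {s₀ s₁ s₂ : State} {t₁ t₂ : ℕ}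
      (h₁ : Exec w c₁ s₀ t₁ s₁) (h₂ : Exec w c₂ s₁ t₂ s₂) :
      Exec w (.seq c₁ c₂) s₀ (t₁ + t₂) s₂
  | condTrue {e : Expr} {c₁ c₂ : Cmd} {s s' : State} {t : ℕ}
      (he : e.eval w s ≠ 0) (h : Exec w c₁ s t s') :
      Exec w (.cond e c₁ c₂) s (e.cost + 1 + t) s'
  | condFalse {e : Expr} {c₁ c₂ : Cmd} {s s' : State} {t : ℕ}
      (he : e.eval w s = 0) (h : Exec w c₂ s t s') :
      Exec w (.cond e c₁ c₂) s (e.cost + 1 + t) s'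
  | loopStop {e : Expr} {c : Cmd} {s : State} (he : e.eval w s = 0) :
      Exec w (.loop e c) s (e.cost + 1) s
  | loopStep {e : Expr} {c : Cmd} {s₀ s₁ s₂ : State} {t₁ t₂ : ℕ}
      (he : e.eval w s₀ ≠ 0) (h₁ : Exec w c s₀ t₁ s₁) (h₂ : Exec w (.loop e c) s₁ t₂ s₂) :
      Exec w (.loop e c) s₀ (e.cost + 1 + t₁ + t₂) s₂

end WordRAM

namespace EdgeConn

open WordRAM

/-- `es` lists every edge of `G` exactly once, in any order and with any orientation. In
particular `es.length` is the number of edges. -/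
def IsEdgeList {n : ℕ} (G : SimpleGraph (Fin n)) (es : List (Fin n × Fin n)) : Prop :=
  (es.map fun p => s(p.1, p.2)).Nodup ∧ ∀ e, e ∈ es.map (fun p => s(p.1, p.2)) ↔ e ∈ G.edgeSet

/-- The input is in memory: `n`, `m`, `k` in registers `0`, `1`, `2`, and the endpoints of the
`i`-th edge in cell `i` of the arrays `0` and `1`. The other cells are not restricted. -/
def HoldsInput (k : ℕ) {n : ℕ} (es : List (Fin n × Fin n)) (s : State) : Prop :=
  s.var 0 = n ∧ s.var 1 = es.length ∧ s.var 2 = k ∧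
    ∀ (i : ℕ) (h : i < es.length), s.arr 0 i = (es[i].1 : ℕ) ∧ s.arr 1 i = (es[i].2 : ℕ)

/-- The requests to a decremental pairwise connectivity algorithm. -/
inductive Request (n : ℕ) where
  | delete (u v : Fin n)
  | query (u v : Fin n)

/-- A decremental algorithm: a preprocessing, an edge deletion and a query procedure, which share
one memory. -/
structure Decremental where
  init : Cmd
  delete : Cmd
  query : Cmd

/-- The arguments of a request are passed in registers `0` and `1`. -/
def passArgs {n : ℕ} (s : State) (u v : Fin n) : State :=
  (s.setVar 0 u).setVar 1 v

/-- From the memory `s`, with current graph `G`, the algorithm serves the given requests: a query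
is answered correctly (in register `0`, nonzero for yes) in at most `tq` steps, an existing edge
may be deleted, and all the deletions together take at most `B` steps. -/
def Decremental.Serves (D : Decremental) (w k : ℕ) (tq : ℝ) {n : ℕ} :
    SimpleGraph (Fin n) → ℝ → State → List (Request n) → Prop
  | _, _, _, [] => True
  | G, B, s, .query u v :: rs =>
      ∃ t s', Exec w D.query (passArgs s u v) t s' ∧ (t : ℝ) ≤ tq ∧
        (s'.var 0 ≠ 0 ↔ G.IsEdgeReachable k u v) ∧ D.Serves w k tq G B s' rs
  | G, B, s, .delete u v :: rs =>
      G.Adj u v → ∃ t s', Exec w D.delete (passArgs s u v) t s' ∧ (t : ℝ) ≤ B ∧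
        D.Serves w k tq (G.deleteEdges {s(u, v)}) (B - t) s' rs

/-- `D` is a decremental algorithm for pairwise `k`-edge-connectivity, for all `k ∈ K`: on an
initial graph with `n` vertices and `m` edges, preprocessing and all deletions together take at
most `tp k n * (n + m)` steps, and each query takes at most `tq k n` steps. Words of
`c * log₂ (n + k + 2)` bits suffice. -/
def Decremental.Supports (D : Decremental) (K : Set ℕ) (tp tq : ℕ → ℕ → ℝ) (c : ℕ) : Prop :=
  ∀ k ∈ K, ∀ n : ℕ, 2 ≤ n → ∀ (G : SimpleGraph (Fin n)) (es : List (Fin n × Fin n)),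
    IsEdgeList G es → ∀ w : ℕ, (n + k + 2) ^ c ≤ 2 ^ w →
    ∀ s : State, s.IsWord w → HoldsInput k es s →
      ∃ t s', Exec w D.init s t s' ∧ (t : ℝ) ≤ tp k n * (n + es.length) ∧
        ∀ rs : List (Request n),
          D.Serves w k (tq k n) G (tp k n * (n + es.length) - t) s' rs

/-- `S` is a maximal `k`-edge-connected subgraph of `G`: it is inclusion-maximal among the
nonempty vertex sets that induce a `k`-edge-connected graph. -/
def IsMaxKECSubgraph {V : Type*} (G : SimpleGraph V) (k : ℕ) (S : Set V) : Prop :=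
  Maximal (fun T : Set V => T.Nonempty ∧ (G.induce T).IsEdgeConnected k) S

/-- Array `0` labels the vertices so that the classes of vertices with equal labels are exactly
the maximal `k`-edge-connected subgraphs of `G`. -/
def HoldsOutput {n : ℕ} (G : SimpleGraph (Fin n)) (k : ℕ) (s : State) : Prop :=
  ∀ S : Set (Fin n),
    IsMaxKECSubgraph G k S ↔ ∃ v : Fin n, S = {u : Fin n | s.arr 0 u = s.arr 0 v}

/-- The program `P` computes the maximal `k`-edge-connected subgraphs, for all `k ∈ K`, in at most
`T k n m` steps on graphs with `n` vertices and `m` edges. Words of `c * log₂ (n + k + 2)` bits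
suffice. -/
def ComputesMaxKEC (P : Cmd) (K : Set ℕ) (T : ℕ → ℕ → ℕ → ℝ) (c : ℕ) : Prop :=
  ∀ k ∈ K, ∀ n : ℕ, 2 ≤ n → ∀ (G : SimpleGraph (Fin n)) (es : List (Fin n × Fin n)),
    IsEdgeList G es → ∀ w : ℕ, (n + k + 2) ^ c ≤ 2 ^ w →
    ∀ s : State, s.IsWord w → HoldsInput k es s →
      ∃ t s', Exec w P s t s' ∧ (t : ℝ) ≤ T k n es.length ∧ HoldsOutput G k s'

end EdgeConn

/-! The edges are added in O(log n) batches to a growing edge set `N.edges`, and after each batch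
the partition into maximal k-edge-connected subgraphs is recomputed with the decremental algorithm.
Two facts make this sound and cheap. Edges inside classes of the current partition can be dropped
for good, because classes only merge when edges are added and an edge inside a class changes nothing
(`IsKPart.extend`). And at most k n edges run between the classes, because the classes can be
separated by successive cuts with fewer than k edges (`IsKPart.card_cross_le`).

Recomputation (`solve`). The old classes are still k-edge-connected and are treated as nodes.
Clusters of classes are refined, starting from a single cluster; each cluster has an anchor class,
and a stack holds classes still to be compared with their anchor by a query in the graph of edges
within clusters. The invariant `Refines` says that every union of classes that a small cut separates
from the rest of its cluster contains the anchor or a class on the stack. Once the stack is empty,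
both sides of a small cut would contain the anchor, so no small cut is left (`Refines.isKPart`). If
a class t fails its query, two searches, from the anchor and from t, alternate step by step, each
visiting only classes k-edge-connected to its source. The one that finishes first has found at most
half of the weight of the cluster. It is split off, the edges leaving it are deleted, and their ends
are pushed. No k-edge-connected subgraph is torn, since no edge between k-edge-connected vertices
leaves the found part (`Refines.split`). As the lighter part pays, the potential `Phi` bounds the
number of queries by O(W log W), where W counts the classes and the edges between different classes
only (`Net.Phi_split`, `Source.does_solve` via `does_refineLoop`).

Batches. Call a class active if some incident edge has not been considered. In a batch each class is
charged up to q new edges, and exactly q if it still has slots left; afterwards q grows by a factor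
of about 3/2. A class active after the batch either contains two classes that were active before, or
contains just one, whose q charged edges still run between different classes; by the bound k n on
such edges, 2 q A' ≤ q A + k n for the numbers A, A' of active classes (`Source.two_mul_active_le`).
Hence q A ≤ 3 k n is preserved, every batch adds at most 3 k n edges, and W = O(k n). Since q starts
at 2 k and stays at most 5 k n, there are O(log n) batches (`Source.Batched.lt`). Each batch hands
O(k n log n) edges to the decremental algorithm and makes O(k n log n) queries; together with O(m)
for scanning the edge lists once this gives the bound. -/

namespace WordRAM

/-! ### Reasoning about executions -/

/-- The program `c`, started in `s`, halts after `t` steps in `s'` with `Q t s'`. -/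
def Does (w : ℕ) (c : Cmd) (s : State) (Q : ℕ → State → Prop) : Prop :=
  ∃ t s', Exec w c s t s' ∧ Q t s'

theorem Does.mono {w : ℕ} {c : Cmd} {s : State} {Q R : ℕ → State → Prop} (h : Does w c s Q)
    (hQR : ∀ t s', Q t s' → R t s') : Does w c s R := by
  obtain ⟨t, s', h1, h2⟩ := h
  exact ⟨t, s', h1, hQR _ _ h2⟩

/-- The registers that `c` never writes. -/
def Cmd.KeepsVar : Cmd → ℕ → Prop
  | .skip, _ => True
  | .assign y _, x => x ≠ y
  | .store _ _ _, _ => True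
  | .seq c₁ c₂, x => c₁.KeepsVar x ∧ c₂.KeepsVar x
  | .cond _ c₁ c₂, x => c₁.KeepsVar x ∧ c₂.KeepsVar x
  | .loop _ c, x => c.KeepsVar x

/-- The arrays that `c` never writes. -/
def Cmd.KeepsArr : Cmd → ℕ → Prop
  | .skip, _ => True
  | .assign _ _, _ => True
  | .store b _ _, a => a ≠ b
  | .seq c₁ c₂, a => c₁.KeepsArr a ∧ c₂.KeepsArr a
  | .cond _ c₁ c₂, a => c₁.KeepsArr a ∧ c₂.KeepsArr a
  | .loop _ c, a => c.KeepsArr a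

/-- `s` and `s'` agree outside of what `c` writes. -/
def Agree (c : Cmd) (s s' : State) : Prop :=
  (∀ x, c.KeepsVar x → s'.var x = s.var x) ∧ ∀ a, c.KeepsArr a → s'.arr a = s.arr a

theorem Agree.refl (c : Cmd) (s : State) : Agree c s s := ⟨fun _ _ => rfl, fun _ _ => rfl⟩

theorem Agree.trans {c : Cmd} {s₁ s₂ s₃ : State} (h : Agree c s₁ s₂) (h' : Agree c s₂ s₃) :
    Agree c s₁ s₃ :=
  ⟨fun x hx => (h'.1 x hx).trans (h.1 x hx), fun a ha => (h'.2 a ha).trans (h.2 a ha)⟩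

@[simp] theorem var_setVar (s : State) (x v y : ℕ) :
    (s.setVar x v).var y = if y = x then v else s.var y := by
  simp [State.setVar, Function.update_apply]

@[simp] theorem arr_setVar (s : State) (x v : ℕ) : (s.setVar x v).arr = s.arr := rfl

@[simp] theorem var_setArr (s : State) (a i v : ℕ) : (s.setArr a i v).var = s.var := rfl

@[simp] theorem arr_setArr (s : State) (a i v b : ℕ) :
    (s.setArr a i v).arr b = if b = a then Function.update (s.arr a) i v else s.arr b := by
  by_cases h : b = a
  · subst h; simp [State.setArr]
  · simp [State.setArr, h]

/-- The frame rule: whatever a program does not write syntactically survives its execution. It lets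
loop invariants mention only what changes. -/
theorem Exec.agree {w : ℕ} {c : Cmd} {s s' : State} {t : ℕ} (h : Exec w c s t s') :
    Agree c s s' := by
  induction h with
  | skip s => exact Agree.refl _ _
  | assign x e s =>
    refine ⟨fun y hy => ?_, fun a _ => rfl⟩
    simp only [Cmd.KeepsVar] at hy
    simp [hy]
  | store a i e s =>
    refine ⟨fun y hy => rfl, fun b hb => ?_⟩
    simp only [Cmd.KeepsArr] at hb
    simp [hb]
  | seq _ _ ih₁ ih₂ =>
    exact ⟨fun x hx => (ih₂.1 x hx.2).trans (ih₁.1 x hx.1),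
      fun a ha => (ih₂.2 a ha.2).trans (ih₁.2 a ha.1)⟩
  | condTrue _ _ ih => exact ⟨fun x hx => ih.1 x hx.1, fun a ha => ih.2 a ha.1⟩
  | condFalse _ _ ih => exact ⟨fun x hx => ih.1 x hx.2, fun a ha => ih.2 a ha.2⟩
  | loopStop _ => exact Agree.refl _ _
  | loopStep _ _ _ ih₁ ih₂ =>
    exact ⟨fun x hx => (ih₂.1 x hx).trans (ih₁.1 x hx),
      fun a ha => (ih₂.2 a ha).trans (ih₁.2 a ha)⟩

theorem Op.eval_lt {w : ℕ} (o : Op) {a b : ℕ} (ha : a < 2 ^ w) (hb : b < 2 ^ w) :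
    o.eval w a b < 2 ^ w := by
  have h0 : 0 < 2 ^ w := by positivity
  cases o <;> simp only [Op.eval]
  · exact Nat.mod_lt _ h0
  · exact Nat.mod_lt _ h0
  · exact Nat.mod_lt _ h0
  · exact (Nat.div_le_self _ _).trans_lt ha
  · exact (Nat.mod_le _ _).trans_lt ha
  · exact Nat.and_lt_two_pow _ hb
  · exact Nat.or_lt_two_pow ha hb
  · exact Nat.xor_lt_two_pow ha hb
  · exact Nat.mod_lt _ h0
  · exact (Nat.shiftRight_le _ _).trans_lt ha
  · split
    · exact Nat.mod_lt _ h0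
    · exact h0
  · split
    · exact Nat.mod_lt _ h0
    · exact h0

theorem Expr.eval_lt {w : ℕ} {s : State} (hs : s.IsWord w) (e : Expr) : e.eval w s < 2 ^ w := by
  induction e with
  | lit v => exact Nat.mod_lt _ (by positivity)
  | var x => exact hs.1 x
  | load a i _ => exact hs.2 a _
  | op o e₁ e₂ ih₁ ih₂ => exact o.eval_lt ih₁ ih₂

theorem State.IsWord.setVar {w : ℕ} {s : State} (hs : s.IsWord w) (x : ℕ) {v : ℕ}
    (hv : v < 2 ^ w) : (s.setVar x v).IsWord w := by
  refine ⟨fun y => ?_, hs.2⟩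
  rw [var_setVar]
  split
  · exact hv
  · exact hs.1 y

theorem State.IsWord.setArr {w : ℕ} {s : State} (hs : s.IsWord w) (a i : ℕ) {v : ℕ}
    (hv : v < 2 ^ w) : (s.setArr a i v).IsWord w := by
  refine ⟨hs.1, fun b j => ?_⟩
  rw [arr_setArr]
  split
  · rw [Function.update_apply]
    split
    · exact hv
    · exact hs.2 _ _
  · exact hs.2 b j

theorem Exec.isWord {w : ℕ} {c : Cmd} {s s' : State} {t : ℕ} (h : Exec w c s t s')
    (hs : s.IsWord w) : s'.IsWord w := by
  induction h with
  | skip s => exact hs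
  | assign x e s => exact hs.setVar x (e.eval_lt hs)
  | store a i e s => exact hs.setArr a _ (e.eval_lt hs)
  | seq _ _ ih₁ ih₂ => exact ih₂ (ih₁ hs)
  | condTrue _ _ ih => exact ih hs
  | condFalse _ _ ih => exact ih hs
  | loopStop _ => exact hs
  | loopStep _ _ _ ih₁ ih₂ => exact ih₂ (ih₁ hs)

/-- Needed because `Decremental.Serves` speaks about request lists fixed in advance, while the
requests made here depend on earlier answers: by determinism, lists with a common beginning share
the execution of that beginning. -/
theorem Exec.det {w : ℕ} {c : Cmd} {s s₁ : State} {t₁ : ℕ} (h : Exec w c s t₁ s₁) :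
    ∀ {t₂ s₂}, Exec w c s t₂ s₂ → t₁ = t₂ ∧ s₁ = s₂ := by
  induction h with
  | skip s => intro _ _ h2; cases h2; exact ⟨rfl, rfl⟩
  | assign x e s => intro _ _ h2; cases h2; exact ⟨rfl, rfl⟩
  | store a i e s => intro _ _ h2; cases h2; exact ⟨rfl, rfl⟩
  | seq _ _ ih₁ ih₂ =>
    intro _ _ h2
    cases h2 with
    | seq a b =>
      obtain ⟨rfl, rfl⟩ := ih₁ a
      obtain ⟨rfl, rfl⟩ := ih₂ b
      exact ⟨rfl, rfl⟩
  | condTrue he _ ih =>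
    intro _ _ h2
    cases h2 with
    | condTrue _ a => obtain ⟨rfl, rfl⟩ := ih a; exact ⟨rfl, rfl⟩
    | condFalse he' _ => exact absurd he' he
  | condFalse he _ ih =>
    intro _ _ h2
    cases h2 with
    | condTrue he' _ => exact absurd he he'
    | condFalse _ a => obtain ⟨rfl, rfl⟩ := ih a; exact ⟨rfl, rfl⟩
  | loopStop he =>
    intro _ _ h2
    cases h2 with
    | loopStop _ => exact ⟨rfl, rfl⟩
    | loopStep he' _ _ => exact absurd he he'
  | loopStep he _ _ ih₁ ih₂ =>
    intro _ _ h2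
    cases h2 with
    | loopStop he' => exact absurd he' he
    | loopStep _ a b =>
      obtain ⟨rfl, rfl⟩ := ih₁ a
      obtain ⟨rfl, rfl⟩ := ih₂ b
      exact ⟨rfl, rfl⟩

theorem Does.agree {w : ℕ} {c : Cmd} {s : State} {Q : ℕ → State → Prop} (h : Does w c s Q) :
    Does w c s fun t s' => Q t s' ∧ Agree c s s' := by
  obtain ⟨t, s', h1, h2⟩ := h
  exact ⟨t, s', h1, h2, h1.agree⟩

theorem Does.isWord {w : ℕ} {c : Cmd} {s : State} {Q : ℕ → State → Prop} (h : Does w c s Q)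
    (hs : s.IsWord w) : Does w c s fun t s' => Q t s' ∧ s'.IsWord w := by
  obtain ⟨t, s', h1, h2⟩ := h
  exact ⟨t, s', h1, h2, h1.isWord hs⟩

theorem does_skip {w : ℕ} {s : State} {Q : ℕ → State → Prop} : Does w .skip s Q ↔ Q 1 s := by
  constructor
  · rintro ⟨t, s', h, hQ⟩
    cases h; exact hQ
  · exact fun h => ⟨_, _, .skip s, h⟩

theorem does_assign {w x : ℕ} {e : Expr} {s : State} {Q : ℕ → State → Prop} :
    Does w (.assign x e) s Q ↔ Q (e.cost + 1) (s.setVar x (e.eval w s)) := by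
  constructor
  · rintro ⟨t, s', h, hQ⟩
    cases h; exact hQ
  · exact fun h => ⟨_, _, .assign x e s, h⟩

theorem does_store {w a : ℕ} {i e : Expr} {s : State} {Q : ℕ → State → Prop} :
    Does w (.store a i e) s Q ↔
      Q (i.cost + e.cost + 1) (s.setArr a (i.eval w s) (e.eval w s)) := by
  constructor
  · rintro ⟨t, s', h, hQ⟩
    cases h; exact hQ
  · exact fun h => ⟨_, _, .store a i e s, h⟩

theorem does_seq {w : ℕ} {c₁ c₂ : Cmd} {s : State} {Q : ℕ → State → Prop} :
    Does w (.seq c₁ c₂) s Q ↔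
      Does w c₁ s fun t₁ s₁ => Does w c₂ s₁ fun t₂ s₂ => Q (t₁ + t₂) s₂ := by
  constructor
  · rintro ⟨t, s', h, hQ⟩
    cases h with
    | seq h1 h2 => exact ⟨_, _, h1, _, _, h2, hQ⟩
  · rintro ⟨t₁, s₁, h1, t₂, s₂, h2, hQ⟩
    exact ⟨_, _, .seq h1 h2, hQ⟩

theorem does_cond {w : ℕ} {e : Expr} {c₁ c₂ : Cmd} {s : State} {Q : ℕ → State → Prop} :
    Does w (.cond e c₁ c₂) s Q ↔
      if e.eval w s = 0 then Does w c₂ s (fun t s' => Q (e.cost + 1 + t) s')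
      else Does w c₁ s (fun t s' => Q (e.cost + 1 + t) s') := by
  constructor
  · rintro ⟨t, s', h, hQ⟩
    cases h with
    | condTrue he h => rw [if_neg he]; exact ⟨_, _, h, hQ⟩
    | condFalse he h => rw [if_pos he]; exact ⟨_, _, h, hQ⟩
  · intro h
    split at h
    · next he =>
      obtain ⟨t, s', h, hQ⟩ := h
      exact ⟨_, _, .condFalse he h, hQ⟩
    · next he =>
      obtain ⟨t, s', h, hQ⟩ := h
      exact ⟨_, _, .condTrue he h, hQ⟩

/-- The rule for loops: an invariant on the elapsed time and the state that bounds the time. -/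
theorem does_loop {w : ℕ} {e : Expr} {c : Cmd} {s₀ : State} (Inv : ℕ → State → Prop) (T : ℕ)
    (h0 : Inv 0 s₀) (hT : ∀ τ s, Inv τ s → τ ≤ T)
    (step : ∀ τ s, Inv τ s → Agree c s₀ s → e.eval w s ≠ 0 →
      Does w c s fun t s' => Inv (τ + (e.cost + 1 + t)) s') :
    Does w (.loop e c) s₀ fun t s' => ∃ τ, t = τ + (e.cost + 1) ∧ Inv τ s' ∧ e.eval w s' = 0 ∧
      Agree c s₀ s' := by
  -- Induction on the time `d` that is left: every round takes at least one step, and the invariant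
  -- forbids more than `T`.
  have key : ∀ d τ s, T + 1 ≤ τ + d → Inv τ s → Agree c s₀ s →
      Does w (.loop e c) s fun t s' => ∃ τ', τ + t = τ' + (e.cost + 1) ∧ Inv τ' s' ∧
        e.eval w s' = 0 ∧ Agree c s₀ s' := by
    intro d
    induction d with
    | zero => intro τ s hd hI; have := hT _ _ hI; omega
    | succ d ih =>
      intro τ s hd hI hA
      by_cases he : e.eval w s = 0
      · exact ⟨_, _, .loopStop he, τ, rfl, hI, he, hA⟩
      · obtain ⟨t, s', h1, h2⟩ := step τ s hI hA he
        obtain ⟨t', s'', h3, τ', h4, h5⟩ := ih _ s' (by omega) h2 (hA.trans h1.agree)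
        exact ⟨_, _, .loopStep he h1 h3, τ', by omega, h5⟩
  have := key (T + 1) 0 s₀ (by omega) h0 (Agree.refl _ _)
  simpa using this

/-- Programs that run `c` for the values `0, 1, …` of register `x` below that of register `y`. -/
def Cmd.for (x y : ℕ) (c : Cmd) : Cmd :=
  .seq (.assign x (.lit 0))
    (.loop (.op .lt (.var x) (.var y)) (.seq c (.assign x (.op .add (.var x) (.lit 1)))))

/-- The rule for `Cmd.for`: the invariant refers to the number of completed rounds, the time
spent in the rounds and the state. -/
theorem does_for {w x y N : ℕ} {c : Cmd} {s₀ : State} (Inv : ℕ → ℕ → State → Prop) (T : ℕ)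
    (hxy : y ≠ x) (hx : c.KeepsVar x) (hy : c.KeepsVar y) (hN : s₀.var y = N) (hw : N < 2 ^ w)
    (h0 : Inv 0 0 (s₀.setVar x 0)) (hT : ∀ i τ s, i ≤ N → Inv i τ s → τ ≤ T)
    (step : ∀ i τ s, i < N → Inv i τ s → s.var x = i → s.var y = N →
      (∀ z, z ≠ x → c.KeepsVar z → s.var z = s₀.var z) →
      (∀ a, c.KeepsArr a → s.arr a = s₀.arr a) →
      Does w c s fun t s' => Inv (i + 1) (τ + t + 8) (s'.setVar x (i + 1))) :
    Does w (Cmd.for x y c) s₀ fun t s' => ∃ τ, t = τ + 6 ∧ Inv N τ s' ∧ s'.var x = N ∧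
      (∀ z, z ≠ x → c.KeepsVar z → s'.var z = s₀.var z) ∧
      (∀ a, c.KeepsArr a → s'.arr a = s₀.arr a) := by
  unfold Cmd.for
  rw [does_seq, does_assign]
  have hlit : Expr.eval w s₀ (.lit 0) = 0 := by simp [Expr.eval]
  rw [hlit]
  have := does_loop (w := w) (e := .op .lt (.var x) (.var y))
    (c := .seq c (.assign x (.op .add (.var x) (.lit 1)))) (s₀ := s₀.setVar x 0)
    (fun τ s => s.var x ≤ N ∧ Inv (s.var x) τ s) T
    (by simpa using h0) (fun τ s h => hT _ _ _ h.1 h.2) ?_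
  · refine this.mono ?_
    rintro t s' ⟨τ, rfl, ⟨hle, hI⟩, he, hA⟩
    have hyv : s'.var y = N := by
      rw [hA.1 y ⟨hy, hxy⟩]; simp [hxy, hN]
    have hxN : s'.var x = N := by
      simp only [Expr.eval, Op.eval, hyv] at he
      split at he
      · have h1w : 1 < 2 ^ w := by omega
        rw [Nat.mod_eq_of_lt h1w] at he
        omega
      · omega
    -- The constant `6` is the initial assignment (2) and the last, failing test (4); a round adds 4
    -- for its test and 4 for the increment.
    refine ⟨τ, by simp [Expr.cost]; omega, hxN ▸ hI, hxN, fun z hz hc => ?_, fun a ha => ?_⟩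
    · rw [hA.1 z ⟨hc, hz⟩]; simp [hz]
    · rw [hA.2 a ⟨ha, trivial⟩]; rfl
  · rintro τ s ⟨hle, hI⟩ hA he
    have hyv : s.var y = N := by
      rw [hA.1 y ⟨hy, hxy⟩]; simp [hxy, hN]
    have hlt : s.var x < N := by
      by_contra hc
      simp [Expr.eval, Op.eval, hyv, hc] at he
    rw [does_seq]
    have h2 := step _ _ _ hlt hI rfl hyv (fun z hz hc => by rw [hA.1 z ⟨hc, hz⟩]; simp [hz])
      (fun a ha => by rw [hA.2 a ⟨ha, trivial⟩]; rfl)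
    refine h2.agree.mono ?_
    rintro t s' ⟨hI', hA'⟩
    rw [does_assign]
    have hxs : s'.var x = s.var x := hA'.1 x hx
    have hev : Expr.eval w s' (.op .add (.var x) (.lit 1)) = s.var x + 1 := by
      simp only [Expr.eval, Op.eval, hxs]
      rw [Nat.mod_eq_of_lt (show 1 < 2 ^ w by omega), Nat.mod_eq_of_lt (by omega)]
    rw [hev]
    refine ⟨by simp; omega, ?_⟩
    simp only [var_setVar, if_true, Expr.cost]
    convert hI' using 1
    omega

/-! ### Relocation of a program to other registers and arrays -/

/-- `e` with registers and arrays moved up by `100`. -/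
def Expr.shift : Expr → Expr
  | .lit v => .lit v
  | .var x => .var (x + 100)
  | .load a i => .load (a + 100) i.shift
  | .op o e₁ e₂ => .op o e₁.shift e₂.shift

/-- `c` with registers and arrays moved up by `100`. -/
def Cmd.shift : Cmd → Cmd
  | .skip => .skip
  | .assign x e => .assign (x + 100) e.shift
  | .store a i e => .store (a + 100) i.shift e.shift
  | .seq c₁ c₂ => .seq c₁.shift c₂.shift
  | .cond e c₁ c₂ => .cond e.shift c₁.shift c₂.shift
  | .loop e c => .loop e.shift c.shift

/-- The part of the memory that shifted programs see. -/
def State.high (s : State) : State :=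
  ⟨fun x => s.var (x + 100), fun a => s.arr (a + 100)⟩

/-- The memory with the part that shifted programs see replaced by `p`. -/
def State.withHigh (s p : State) : State :=
  ⟨fun x => if x < 100 then s.var x else p.var (x - 100),
    fun a => if a < 100 then s.arr a else p.arr (a - 100)⟩

theorem State.high_withHigh (s p : State) : (s.withHigh p).high = p := by
  simp [State.high, State.withHigh]

theorem State.withHigh_high (s : State) : s.withHigh s.high = s := by
  obtain ⟨v, a⟩ := s
  simp only [State.high, State.withHigh, State.mk.injEq]
  constructor <;>
  · funext x
    split
    · rfl
    · rw [Nat.sub_add_cancel (by omega)]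

theorem State.withHigh_withHigh (s p q : State) : (s.withHigh p).withHigh q = s.withHigh q := by
  simp only [State.withHigh, State.mk.injEq]
  constructor <;>
  · funext x
    split <;> rfl

theorem State.withHigh_setVar (s : State) (x v : ℕ) :
    s.withHigh (s.high.setVar x v) = s.setVar (x + 100) v := by
  have := State.withHigh_high s
  obtain ⟨f, a⟩ := s
  simp only [State.high, State.withHigh, State.mk.injEq, State.setVar] at this ⊢
  refine ⟨?_, this.2⟩
  funext y
  have h1 := congrFun this.1 y
  simp only [Function.update_apply]
  split
  · rw [if_neg (by omega)]
  · split
    · rw [if_pos (by omega)]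
    · rw [if_neg (by omega), Nat.sub_add_cancel (by omega)]

theorem State.withHigh_setArr (s : State) (b i v : ℕ) :
    s.withHigh (s.high.setArr b i v) = s.setArr (b + 100) i v := by
  have := State.withHigh_high s
  obtain ⟨f, a⟩ := s
  simp only [State.high, State.withHigh, State.mk.injEq, State.setArr] at this ⊢
  refine ⟨this.1, ?_⟩
  funext y
  simp only [Function.update_apply]
  split
  · rw [if_neg (by omega)]
  · split
    · rw [if_pos (by omega)]
    · rw [if_neg (by omega), Nat.sub_add_cancel (by omega)]

theorem Expr.eval_shift (w : ℕ) (s : State) (e : Expr) : e.shift.eval w s = e.eval w s.high := by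
  induction e with
  | lit v => rfl
  | var x => rfl
  | load a i ih => simp only [Expr.shift, Expr.eval, ih]; rfl
  | op o e₁ e₂ ih₁ ih₂ => simp only [Expr.shift, Expr.eval, ih₁, ih₂]

theorem Expr.cost_shift (e : Expr) : e.shift.cost = e.cost := by
  induction e with
  | lit v => rfl
  | var x => rfl
  | load a i ih => simp only [Expr.shift, Expr.cost, ih]
  | op o e₁ e₂ ih₁ ih₂ => simp only [Expr.shift, Expr.cost, ih₁, ih₂]

/-- The given programs may use any registers and arrays. After relocation they run in the same time
on the cells from `100` on, and the cells below remain free for the new algorithm. -/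
theorem Exec.shift {w : ℕ} {c : Cmd} {p p' : State} {t : ℕ} (h : Exec w c p t p') :
    ∀ s : State, s.high = p → Exec w c.shift s t (s.withHigh p') := by
  induction h with
  | skip p => rintro s rfl; rw [State.withHigh_high]; exact .skip s
  | assign x e p =>
    rintro s rfl
    rw [State.withHigh_setVar, ← Expr.eval_shift, ← Expr.cost_shift]
    exact .assign _ _ _
  | store a i e p =>
    rintro s rfl
    rw [State.withHigh_setArr, ← Expr.eval_shift, ← Expr.eval_shift, ← Expr.cost_shift,
      ← Expr.cost_shift e]
    exact .store _ _ _ _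
  | seq _ _ ih₁ ih₂ =>
    rintro s rfl
    have h1 := ih₁ s rfl
    have h2 := ih₂ _ (State.high_withHigh s _)
    rw [State.withHigh_withHigh] at h2
    exact .seq h1 h2
  | condTrue he _ ih =>
    rintro s rfl
    rw [← Expr.eval_shift] at he
    rw [← Expr.cost_shift]
    exact .condTrue he (ih s rfl)
  | condFalse he _ ih =>
    rintro s rfl
    rw [← Expr.eval_shift] at he
    rw [← Expr.cost_shift]
    exact .condFalse he (ih s rfl)
  | loopStop he =>
    rintro s rfl
    rw [← Expr.eval_shift] at he
    rw [← Expr.cost_shift, State.withHigh_high]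
    exact .loopStop he
  | loopStep he _ _ ih₁ ih₂ =>
    rintro s rfl
    rw [← Expr.eval_shift] at he
    have h1 := ih₁ s rfl
    have h2 := ih₂ _ (State.high_withHigh s _)
    rw [State.withHigh_withHigh] at h2
    rw [← Expr.cost_shift]
    exact .loopStep he h1 h2

theorem Cmd.keepsVar_shift {x : ℕ} (c : Cmd) (hx : x < 100) : c.shift.KeepsVar x := by
  induction c with
  | skip => trivial
  | assign y e => simp only [Cmd.shift, Cmd.KeepsVar]; omega
  | store a i e => trivial
  | seq c₁ c₂ ih₁ ih₂ => exact ⟨ih₁, ih₂⟩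
  | cond e c₁ c₂ ih₁ ih₂ => exact ⟨ih₁, ih₂⟩
  | loop e c ih => exact ih

theorem Cmd.keepsArr_shift {a : ℕ} (c : Cmd) (ha : a < 100) : c.shift.KeepsArr a := by
  induction c with
  | skip => trivial
  | assign y e => trivial
  | store b i e => simp only [Cmd.shift, Cmd.KeepsArr]; omega
  | seq c₁ c₂ ih₁ ih₂ => exact ⟨ih₁, ih₂⟩
  | cond e c₁ c₂ ih₁ ih₂ => exact ⟨ih₁, ih₂⟩
  | loop e c ih => exact ih

theorem does_shift {w : ℕ} {c : Cmd} {s : State} {Q : ℕ → State → Prop}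
    (h : Does w c s.high fun t p => Q t (s.withHigh p)) : Does w c.shift s Q := by
  obtain ⟨t, p, h1, h2⟩ := h
  exact ⟨t, _, h1.shift s rfl, h2⟩

theorem State.IsWord.high {w : ℕ} {s : State} (h : s.IsWord w) : s.high.IsWord w :=
  ⟨fun _ => h.1 _, fun _ _ => h.2 _ _⟩

theorem State.var_withHigh {s p : State} {x : ℕ} (hx : x < 100) :
    (s.withHigh p).var x = s.var x := by
  simp [State.withHigh, hx]

theorem State.arr_withHigh {s p : State} {a : ℕ} (ha : a < 100) :
    (s.withHigh p).arr a = s.arr a := by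
  simp [State.withHigh, ha]

theorem State.high_setVar_low {s : State} {x v : ℕ} (hx : x < 100) :
    (s.setVar x v).high = s.high := by
  have : ∀ y, y + 100 ≠ x := by omega
  simp [State.high, this]

theorem State.high_setArr_low {s : State} {a i v : ℕ} (ha : a < 100) :
    (s.setArr a i v).high = s.high := by
  have : ∀ y, y + 100 ≠ a := by omega
  simp [State.high, this]

/-- Programs that do not touch what shifted programs see. -/
theorem Agree.high {c : Cmd} {s s' : State} (h : Agree c s s')
    (hv : ∀ x, 100 ≤ x → c.KeepsVar x) (ha : ∀ a, 100 ≤ a → c.KeepsArr a) :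
    s'.high = s.high := by
  simp only [State.high, State.mk.injEq]
  exact ⟨funext fun x => h.1 _ (hv _ (by omega)), funext fun a => h.2 _ (ha _ (by omega))⟩

end WordRAM

namespace EdgeConn

/-! ### Edge connectivity in terms of cuts -/

section Cuts

variable {V : Type*}

/-- Deleting the edges of a small cut disconnects `u` from `v`. Conversely, if deleting `s`
disconnects them, the set reachable from `u` has its whole boundary in `s`. -/
theorem isEdgeReachable_iff_cut (G : SimpleGraph V) (k : ℕ) (u v : V) :
    G.IsEdgeReachable k u v ↔ ∀ Z : Set V, u ∈ Z → v ∉ Z →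
      (k : ℕ∞) ≤ {e | e ∈ G.edgeSet ∧ ∃ a b, e = s(a, b) ∧ a ∈ Z ∧ b ∉ Z}.encard := by
  constructor
  · intro h Z hu hv
    by_contra hlt
    obtain ⟨p⟩ := h (not_le.mp hlt)
    obtain ⟨d, hd, h1, h2⟩ := p.exists_boundary_dart Z hu hv
    have := d.adj
    rw [SimpleGraph.deleteEdges_adj] at this
    exact this.2 ⟨this.1, _, _, rfl, h1, h2⟩
  · intro h s hs
    by_contra hr
    have := h {x | (G.deleteEdges s).Reachable u x} (SimpleGraph.Reachable.refl _) hr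
    refine absurd hs (not_lt.mpr (this.trans (Set.encard_le_encard ?_)))
    rintro e ⟨he, a, b, rfl, ha, hb⟩
    by_contra hes
    refine hb (SimpleGraph.Reachable.trans ha (SimpleGraph.Adj.reachable ?_))
    rw [SimpleGraph.deleteEdges_adj]
    exact ⟨he, hes⟩

open scoped Classical in
/-- The edges of `I` with exactly one endpoint in `Z`. -/
noncomputable def cutset (I : Finset (V × V)) (Z : Set V) : Finset (V × V) :=
  I.filter fun p => ¬(p.1 ∈ Z ↔ p.2 ∈ Z)

open scoped Classical in
/-- The edges of `I` with both endpoints in `T`. -/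
noncomputable def inside (I : Finset (V × V)) (T : Set V) : Finset (V × V) :=
  I.filter fun p => p.1 ∈ T ∧ p.2 ∈ T

/-- No cut with fewer than `k` edges separates `u` from `v`. -/
def Reach (k : ℕ) (I : Finset (V × V)) (u v : V) : Prop :=
  ∀ Z : Set V, u ∈ Z → v ∉ Z → k ≤ (cutset I Z).card

/-- The edges of `I` inside `T` make `T` a `k`-edge-connected graph. -/
def KEC (k : ℕ) (I : Finset (V × V)) (T : Set V) : Prop :=
  ∀ Z : Set V, (∃ u ∈ T, u ∈ Z) → (∃ v ∈ T, v ∉ Z) → k ≤ (cutset (inside I T) Z).card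

/-- The classes of `f` are the maximal `k`-edge-connected subgraphs. -/
structure IsKPart (k : ℕ) (I : Finset (V × V)) (f : V → ℕ) : Prop where
  kec : ∀ u, KEC k I {v | f v = f u}
  const : ∀ T, KEC k I T → ∀ u ∈ T, ∀ v ∈ T, f u = f v

/-- `I` describes the edges of a simple graph without repetition. -/
structure Simple (I : Finset (V × V)) : Prop where
  ne : ∀ p ∈ I, p.1 ≠ p.2
  inj : Set.InjOn (fun p : V × V => s(p.1, p.2)) I

/-- The graph with the edges in `I`. -/
def graphOf (I : Finset (V × V)) : SimpleGraph V :=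
  SimpleGraph.fromEdgeSet ((fun p : V × V => s(p.1, p.2)) '' I)

theorem mem_cutset {I : Finset (V × V)} {Z : Set V} {p : V × V} :
    p ∈ cutset I Z ↔ p ∈ I ∧ ¬(p.1 ∈ Z ↔ p.2 ∈ Z) := by
  classical
  simp [cutset]

theorem mem_inside {I : Finset (V × V)} {T : Set V} {p : V × V} :
    p ∈ inside I T ↔ p ∈ I ∧ p.1 ∈ T ∧ p.2 ∈ T := by
  classical
  simp [inside]

theorem Simple.mono {I J : Finset (V × V)} (h : Simple J) (hIJ : I ⊆ J) : Simple I :=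
  ⟨fun p hp => h.ne p (hIJ hp), h.inj.mono (by exact_mod_cast hIJ)⟩

theorem cutset_mono {I J : Finset (V × V)} (h : I ⊆ J) (Z : Set V) : cutset I Z ⊆ cutset J Z :=
  fun p hp => by
    rw [mem_cutset] at hp ⊢
    exact ⟨h hp.1, hp.2⟩

theorem inside_mono {I J : Finset (V × V)} (h : I ⊆ J) (T : Set V) : inside I T ⊆ inside J T :=
  fun p hp => by
    rw [mem_inside] at hp ⊢
    exact ⟨h hp.1, hp.2⟩

theorem inside_subset (I : Finset (V × V)) (T : Set V) : inside I T ⊆ I :=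
  fun _ hp => (mem_inside.1 hp).1

theorem cutset_compl (I : Finset (V × V)) (Z : Set V) : cutset I Zᶜ = cutset I Z := by
  ext p
  simp only [mem_cutset, Set.mem_compl_iff]
  tauto

theorem mem_edgeSet_graphOf {I : Finset (V × V)} (h : Simple I) {e : Sym2 V} :
    e ∈ (graphOf I).edgeSet ↔ ∃ p ∈ I, s(p.1, p.2) = e := by
  rw [graphOf, SimpleGraph.edgeSet_fromEdgeSet]
  constructor
  · rintro ⟨⟨p, hp, rfl⟩, -⟩
    exact ⟨p, hp, rfl⟩
  · rintro ⟨p, hp, rfl⟩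
    refine ⟨⟨p, hp, rfl⟩, ?_⟩
    simpa using h.ne p hp

theorem adj_graphOf {I : Finset (V × V)} (h : Simple I) {u v : V} :
    (graphOf I).Adj u v ↔ ∃ p ∈ I, s(p.1, p.2) = s(u, v) := by
  rw [← SimpleGraph.mem_edgeSet, mem_edgeSet_graphOf h]

/-- For a simple edge list the map from pairs to unordered pairs is injective, so cuts have the same
size in both descriptions. -/
theorem isEdgeReachable_graphOf {I : Finset (V × V)} (h : Simple I) {k : ℕ} {u v : V} :
    (graphOf I).IsEdgeReachable k u v ↔ Reach k I u v := by
  rw [isEdgeReachable_iff_cut]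
  refine forall_congr' fun Z => forall_congr' fun _ => forall_congr' fun _ => ?_
  have : {e | e ∈ (graphOf I).edgeSet ∧ ∃ a b, e = s(a, b) ∧ a ∈ Z ∧ b ∉ Z} =
      (fun p : V × V => s(p.1, p.2)) '' (cutset I Z : Finset (V × V)) := by
    ext e
    simp only [Set.mem_ofPred_eq, mem_edgeSet_graphOf h, Set.mem_image, Finset.mem_coe, mem_cutset]
    constructor
    · rintro ⟨⟨p, hp, rfl⟩, a, b, he, ha, hb⟩
      refine ⟨p, ⟨hp, ?_⟩, rfl⟩
      rw [Sym2.eq_iff] at he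
      rcases he with ⟨h1, h2⟩ | ⟨h1, h2⟩ <;> rw [h1, h2] <;> tauto
    · rintro ⟨p, ⟨hp, hc⟩, rfl⟩
      refine ⟨⟨p, hp, rfl⟩, ?_⟩
      by_cases h1 : p.1 ∈ Z
      · exact ⟨p.1, p.2, rfl, h1, by tauto⟩
      · exact ⟨p.2, p.1, Sym2.eq_swap, by tauto, h1⟩
  rw [this, Set.InjOn.encard_image (h.inj.mono fun _ hp => (mem_cutset.1 hp).1),
    Set.encard_coe_eq_coe_finsetCard, Nat.cast_le]

/-- The cuts of the induced graph are counted in `V` along the injections of the subtype and of the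
pairs into unordered pairs. -/
theorem isEdgeConnected_induce_graphOf {I : Finset (V × V)} (h : Simple I) {k : ℕ} {T : Set V} :
    ((graphOf I).induce T).IsEdgeConnected k ↔ KEC k I T := by
  have key : ∀ Z : Set V,
      {e | e ∈ ((graphOf I).induce T).edgeSet ∧ ∃ a b, e = s(a, b) ∧
        a ∈ Subtype.val ⁻¹' Z ∧ b ∉ Subtype.val ⁻¹' Z}.encard =
      ((cutset (inside I T) Z).card : ℕ∞) := by
    intro Z
    rw [← Set.encard_coe_eq_coe_finsetCard,
      ← Set.InjOn.encard_image (f := fun p : V × V => s(p.1, p.2)) (s := cutset (inside I T) Z)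
        (h.inj.mono fun p hp => inside_subset _ _ (mem_cutset.1 hp).1),
      ← (Sym2.map.injective (Subtype.val_injective (p := (· ∈ T)))).encard_image]
    congr 1
    ext e
    simp only [Set.mem_ofPred_eq, Set.mem_image, Finset.mem_coe, mem_cutset, mem_inside]
    constructor
    · rintro ⟨_, ⟨he, a, b, rfl, ha, hb⟩, rfl⟩
      obtain ⟨p, hp, hpe⟩ := (adj_graphOf h).1 (SimpleGraph.comap_adj.1 he)
      refine ⟨p, ⟨⟨hp, ?_⟩, ?_⟩, hpe⟩
      · have := Sym2.eq_iff.1 hpe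
        rcases this with ⟨h1, h2⟩ | ⟨h1, h2⟩ <;> rw [h1, h2]
        · exact ⟨a.2, b.2⟩
        · exact ⟨b.2, a.2⟩
      · have := Sym2.eq_iff.1 hpe
        simp only [Set.mem_preimage] at ha hb
        rcases this with ⟨h1, h2⟩ | ⟨h1, h2⟩ <;> rw [h1, h2] <;> simp [ha, hb]
    · rintro ⟨p, ⟨⟨hp, h1, h2⟩, hc⟩, rfl⟩
      refine ⟨s(⟨p.1, h1⟩, ⟨p.2, h2⟩), ⟨?_, ?_⟩, rfl⟩
      · exact SimpleGraph.comap_adj.2 ((adj_graphOf h).2 ⟨p, hp, rfl⟩)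
      · by_cases h3 : p.1 ∈ Z
        · exact ⟨_, _, rfl, h3, show p.2 ∉ Z by tauto⟩
        · exact ⟨_, _, Sym2.eq_swap, show p.2 ∈ Z by tauto, h3⟩
  constructor
  · rintro hc Z ⟨u, huT, huZ⟩ ⟨v, hvT, hvZ⟩
    have := (isEdgeReachable_iff_cut _ _ _ _).1 (hc ⟨u, huT⟩ ⟨v, hvT⟩) (Subtype.val ⁻¹' Z) huZ hvZ
    rw [key] at this
    exact_mod_cast this
  · intro hK u v
    rw [isEdgeReachable_iff_cut]
    intro Z hu hv
    have hZ : Subtype.val ⁻¹' (Subtype.val '' Z) = Z :=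
      Set.preimage_image_eq _ Subtype.val_injective
    rw [← hZ, key]
    exact_mod_cast hK (Subtype.val '' Z) ⟨u.1, u.2, u, hu, rfl⟩ ⟨v.1, v.2, fun ⟨x, hx, hxv⟩ =>
      hv (Subtype.val_injective hxv ▸ hx)⟩

theorem graphOf_erase [DecidableEq V] {I : Finset (V × V)} (h : Simple I) {p : V × V}
    (hp : p ∈ I) : graphOf (I.erase p) = (graphOf I).deleteEdges {s(p.1, p.2)} := by
  have h' : Simple (I.erase p) := h.mono (Finset.erase_subset _ _)
  ext u v
  rw [adj_graphOf h', SimpleGraph.deleteEdges_adj, adj_graphOf h]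
  constructor
  · rintro ⟨q, hq, he⟩
    rw [Finset.mem_erase] at hq
    refine ⟨⟨q, hq.2, he⟩, fun hc => hq.1 (h.inj hq.2 hp ?_)⟩
    simpa [← he] using hc
  · rintro ⟨⟨q, hq, he⟩, hne⟩
    refine ⟨q, Finset.mem_erase.2 ⟨?_, hq⟩, he⟩
    rintro rfl
    exact hne he.symm

theorem Reach.refl (k : ℕ) (I : Finset (V × V)) (u : V) : Reach k I u u :=
  fun _ h1 h2 => absurd h1 h2

theorem Reach.symm {k : ℕ} {I : Finset (V × V)} {u v : V} (h : Reach k I u v) : Reach k I v u := by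
  intro Z hv hu
  rw [← cutset_compl]
  exact h _ hu (by simpa using hv)

/-- With `Reach.refl` and `Reach.symm` this makes `Reach` an equivalence relation, which keeps
searches from unrelated sources apart. -/
theorem Reach.trans {k : ℕ} {I : Finset (V × V)} {u v x : V} (h : Reach k I u v)
    (h' : Reach k I v x) : Reach k I u x := by
  intro Z hu hx
  by_cases hv : v ∈ Z
  · exact h' Z hv hx
  · exact h Z hu hv

theorem KEC.mono {k : ℕ} {I J : Finset (V × V)} {T : Set V} (h : KEC k I T) (hIJ : I ⊆ J) :
    KEC k J T :=
  fun Z h1 h2 => (h Z h1 h2).trans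
    (Finset.card_le_card (cutset_mono (inside_mono hIJ T) Z))

theorem KEC.reach {k : ℕ} {I J : Finset (V × V)} {T : Set V} (h : KEC k I T)
    (hJ : inside I T ⊆ J) {u v : V} (hu : u ∈ T) (hv : v ∈ T) : Reach k J u v :=
  fun Z h1 h2 => (h Z ⟨u, hu, h1⟩ ⟨v, hv, h2⟩).trans (Finset.card_le_card (cutset_mono hJ Z))

/-- A `k`-edge-connected set on one side of a cut with fewer than `k` edges in a larger set. -/
theorem KEC.not_split {k : ℕ} {I : Finset (V × V)} {S T Z : Set V} (hS : KEC k I S) (hST : S ⊆ T)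
    (hc : (cutset (inside I T) Z).card < k) {u v : V} (hu : u ∈ S) (hv : v ∈ S) (huZ : u ∈ Z) :
    v ∈ Z := by
  by_contra hvZ
  refine absurd hc (not_lt.mpr ((hS Z ⟨u, hu, huZ⟩ ⟨v, hv, hvZ⟩).trans
    (Finset.card_le_card (cutset_mono (fun p hp => ?_) Z))))
  rw [mem_inside] at hp ⊢
  exact ⟨hp.1, hST hp.2.1, hST hp.2.2⟩

/-- The classes are k-edge-connected, and every k-edge-connected set lies in one of them; so they
are exactly the maximal ones. -/
theorem IsKPart.isMaxKECSubgraph_iff {k : ℕ} {I : Finset (V × V)} {f : V → ℕ} (h : IsKPart k I f)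
    (hI : Simple I) (S : Set V) :
    IsMaxKECSubgraph (graphOf I) k S ↔ ∃ v, S = {u | f u = f v} := by
  unfold IsMaxKECSubgraph
  simp only [isEdgeConnected_induce_graphOf hI]
  constructor
  · rintro ⟨⟨⟨v, hv⟩, hS⟩, hmax⟩
    refine ⟨v, Set.Subset.antisymm (fun u hu => h.const S hS u hu v hv) ?_⟩
    exact hmax ⟨⟨v, rfl⟩, h.kec v⟩ fun u hu => h.const S hS u hu v hv
  · rintro ⟨v, rfl⟩
    refine ⟨⟨⟨v, rfl⟩, h.kec v⟩, ?_⟩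
    rintro T ⟨-, hT⟩ hsub u hu
    exact h.const T hT u hu v (hsub rfl)

/-- For `T` k-edge-connected in `J`, the union of the classes that meet `T` is k-edge-connected
already in `I`: a small cut of it in `I` splits no class, so it splits `T`, and the edges of `J`
outside `I`, which lie inside classes, do not cross it. This justifies dropping edges inside
classes. -/
theorem IsKPart.extend {k : ℕ} {I J : Finset (V × V)} {f : V → ℕ} (h : IsKPart k I f)
    (hIJ : I ⊆ J) (hJ : ∀ p ∈ J, p ∉ I → f p.1 = f p.2) : IsKPart k J f := by
  refine ⟨fun u => (h.kec u).mono hIJ, fun T hT u hu v hv => ?_⟩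
  refine h.const {x | ∃ y ∈ T, f y = f x} (fun Z hZ hZ' => ?_) u ⟨u, hu, rfl⟩ v ⟨v, hv, rfl⟩
  by_contra hlt
  rw [not_le] at hlt
  -- A cut with fewer than `k` edges cannot split a class.
  have hsat : ∀ x y, x ∈ {x | ∃ y ∈ T, f y = f x} → f y = f x → x ∈ Z → y ∈ Z := by
    rintro x y ⟨z, hz, hzx⟩ hyx hxZ
    refine (h.kec x).not_split ?_ hlt (u := x) (v := y) rfl hyx hxZ
    intro x' hx'
    exact ⟨z, hz, hzx.trans (Eq.symm hx')⟩
  obtain ⟨a, ⟨a', ha', haa⟩, haZ⟩ := hZ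
  obtain ⟨b, ⟨b', hb', hbb⟩, hbZ⟩ := hZ'
  have h1 : a' ∈ Z := hsat a a' ⟨a', ha', haa⟩ haa haZ
  have h2 : b' ∉ Z := fun hc => hbZ (hsat b' b ⟨b', hb', rfl⟩ hbb.symm hc)
  refine absurd hlt (not_lt.mpr ((hT Z ⟨a', ha', h1⟩ ⟨b', hb', h2⟩).trans
    (Finset.card_le_card fun p hp => ?_)))
  rw [mem_cutset, mem_inside] at hp ⊢
  obtain ⟨⟨hpJ, hp1, hp2⟩, hpc⟩ := hp
  refine ⟨⟨?_, ⟨p.1, hp1, rfl⟩, ⟨p.2, hp2, rfl⟩⟩, hpc⟩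
  by_contra hpI
  have he := hJ p hpJ hpI
  exact hpc ⟨fun hc => hsat p.1 p.2 ⟨p.1, hp1, rfl⟩ he.symm hc,
    fun hc => hsat p.2 p.1 ⟨p.2, hp2, rfl⟩ he hc⟩

theorem isKPart_empty {k : ℕ} (hk : 1 ≤ k) {f : V → ℕ} (hf : Function.Injective f) :
    IsKPart k ∅ f := by
  constructor
  · rintro u Z ⟨a, ha, haZ⟩ ⟨b, hb, hbZ⟩
    have : a = b := hf (Eq.trans ha (Eq.symm hb))
    exact absurd (this ▸ haZ) hbZ
  · intro T hT u hu v hv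
    by_contra hne
    have := hT {u} ⟨u, hu, rfl⟩ ⟨v, hv, fun hc => hne (by rw [Set.mem_singleton_iff.1 hc])⟩
    have h0 : cutset (inside ∅ T) {u} = ∅ := by
      ext p; simp [mem_cutset, mem_inside]
    rw [h0] at this
    simp at this
    omega

open scoped Classical in
/-- A graph has few edges between its maximal `k`-edge-connected subgraphs. -/
theorem IsKPart.card_cross_le [Fintype V] {k : ℕ} {I : Finset (V × V)} {f : V → ℕ}
    (h : IsKPart k I f) :
    (I.filter fun p => f p.1 ≠ f p.2).card ≤ k * Fintype.card V := by
  -- For a union `T` of `c` classes the bound is `k * (c - 1)`, written without subtraction. Either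
  -- `T` is k-edge-connected and a single class, or a cut with fewer than `k` edges divides it into
  -- two smaller unions of classes.
  have key : ∀ c (T : Finset V), (T.image f).card = c → T.Nonempty →
      (∀ u v, f u = f v → u ∈ T → v ∈ T) →
      (I.filter fun p => f p.1 ≠ f p.2 ∧ p.1 ∈ T ∧ p.2 ∈ T).card + k ≤ k * c := by
    intro c
    induction c using Nat.strong_induction_on with
    | _ c ih =>
      intro T hc hne hsat
      by_cases hT : KEC k I T
      · obtain ⟨u, hu⟩ := hne
        have h1 : (T.image f).card = 1 := by
          rw [Finset.card_eq_one]
          refine ⟨f u, ?_⟩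
          ext x
          simp only [Finset.mem_image, Finset.mem_singleton]
          constructor
          · rintro ⟨v, hv, rfl⟩
            exact h.const T hT v hv u hu
          · rintro rfl; exact ⟨u, hu, rfl⟩
        have h2 : (I.filter fun p => f p.1 ≠ f p.2 ∧ p.1 ∈ T ∧ p.2 ∈ T) = ∅ := by
          rw [Finset.filter_eq_empty_iff]
          rintro p - ⟨hp, hp1, hp2⟩
          exact hp (h.const T hT _ hp1 _ hp2)
        rw [h2, ← hc, h1]
        simp
      · unfold KEC at hT
        push Not at hT
        obtain ⟨Z, ⟨a, haT, haZ⟩, ⟨b, hbT, hbZ⟩, hlt⟩ := hT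
        have hsZ : ∀ u v, f u = f v → u ∈ T → u ∈ Z → v ∈ Z := by
          intro u v huv hu huZ
          refine (h.kec u).not_split (T := (T : Set V)) ?_ hlt (u := u) (v := v) rfl huv.symm huZ
          intro x hx
          exact hsat u x (Eq.symm hx) hu
        have hsZ' : ∀ u v, f u = f v → u ∈ T → u ∉ Z → v ∉ Z :=
          fun u v huv hu huZ hv => huZ (hsZ v u huv.symm (hsat u v huv hu) hv)
        have h1 := ih (((T.filter (· ∈ Z)).image f).card) ?_ (T.filter (· ∈ Z)) rfl
          ⟨a, by simp [haZ]; exact haT⟩ ?_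
        have h2 := ih (((T.filter (· ∉ Z)).image f).card) ?_ (T.filter (· ∉ Z)) rfl
          ⟨b, by simp [hbZ]; exact hbT⟩ ?_
        have hsum : ((T.filter (· ∈ Z)).image f).card + ((T.filter (· ∉ Z)).image f).card = c := by
          rw [← hc, ← Finset.card_union_of_disjoint, ← Finset.image_union,
            Finset.filter_union_filter_not_eq]
          rw [Finset.disjoint_left]
          intro x hx hx'
          simp only [Finset.mem_image, Finset.mem_filter] at hx hx'
          obtain ⟨u, ⟨hu, huZ⟩, rfl⟩ := hx
          obtain ⟨v, ⟨hv, hvZ⟩, hvu⟩ := hx'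
          exact hvZ (hsZ u v hvu.symm hu huZ)
        -- An edge between classes of `T` lies on one side of `Z` or crosses the small cut.
        have hcard : (I.filter fun p => f p.1 ≠ f p.2 ∧ p.1 ∈ T ∧ p.2 ∈ T).card ≤
            (I.filter fun p => f p.1 ≠ f p.2 ∧ p.1 ∈ T.filter (· ∈ Z) ∧
              p.2 ∈ T.filter (· ∈ Z)).card +
            (I.filter fun p => f p.1 ≠ f p.2 ∧ p.1 ∈ T.filter (· ∉ Z) ∧
              p.2 ∈ T.filter (· ∉ Z)).card + (cutset (inside I T) Z).card := by
          refine le_trans (Finset.card_le_card ?_) ((Finset.card_union_le _ _).trans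
            (Nat.add_le_add_right (Finset.card_union_le _ _) _))
          intro p hp
          simp only [Finset.mem_filter, Finset.mem_union, mem_cutset, mem_inside,
            Finset.mem_coe] at hp ⊢
          tauto
        rw [← hsum, Nat.mul_add]
        omega
        · rw [← hc]
          refine Finset.card_lt_card ⟨Finset.image_subset_image (Finset.filter_subset _ _), ?_⟩
          intro hsub
          have := hsub (Finset.mem_image_of_mem f haT)
          simp only [Finset.mem_image, Finset.mem_filter] at this
          obtain ⟨u, ⟨hu, huZ⟩, hua⟩ := this
          exact hsZ' u a hua hu huZ haZ
        · intro u v huv hu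
          simp only [Finset.mem_filter] at hu ⊢
          exact ⟨hsat u v huv hu.1, hsZ' u v huv hu.1 hu.2⟩
        · rw [← hc]
          refine Finset.card_lt_card ⟨Finset.image_subset_image (Finset.filter_subset _ _), ?_⟩
          intro hsub
          have := hsub (Finset.mem_image_of_mem f hbT)
          simp only [Finset.mem_image, Finset.mem_filter] at this
          obtain ⟨u, ⟨hu, huZ⟩, hub⟩ := this
          exact hbZ (hsZ u b hub hu huZ)
        · intro u v huv hu
          simp only [Finset.mem_filter] at hu ⊢
          exact ⟨hsat u v huv hu.1, hsZ u v huv hu.1 hu.2⟩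
  rcases isEmpty_or_nonempty V with hV | hV
  · have : I = ∅ := Finset.eq_empty_of_forall_notMem fun p => (hV.false p.1).elim
    simp [this]
  · have := key _ Finset.univ rfl Finset.univ_nonempty (by simp)
    simp only [Finset.mem_univ, and_true, ne_eq] at this ⊢
    refine (Nat.le_of_add_right_le this).trans (Nat.mul_le_mul_left _ ?_)
    exact Finset.card_image_le

end Cuts

end EdgeConn

namespace EdgeConn

/-! ### The invariant of the partition refinement -/

section Refinement

variable {V : Type*}

/-- The edges of `I` within the classes of `g`. -/
def live (I : Finset (V × V)) (g : V → ℕ) : Finset (V × V) :=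
  I.filter fun p => g p.1 = g p.2

theorem mem_live {I : Finset (V × V)} {g : V → ℕ} {p : V × V} :
    p ∈ live I g ↔ p ∈ I ∧ g p.1 = g p.2 := by
  simp [live]

theorem live_subset (I : Finset (V × V)) (g : V → ℕ) : live I g ⊆ I := Finset.filter_subset _ _

/-- A partition into clusters of the classes of `lab` that is on the way to the partition into
maximal `k`-edge-connected subgraphs: a union of classes that is separated from the rest of its
cluster by a small cut contains the anchor of the cluster or a class in `W`. -/
structure Refines (k : ℕ) (I : Finset (V × V)) (lab : V → ℕ) (comp anchor : ℕ → ℕ)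
    (W : List ℕ) : Prop where
  cut : ∀ (Z : Set V) (id : ℕ), Z.Nonempty → (∀ u ∈ Z, comp (lab u) = id) →
    (∀ u v, lab u = lab v → u ∈ Z → v ∈ Z) → (∀ u ∈ Z, lab u ≠ anchor id) →
    (cutset (live I fun u => comp (lab u)) Z).card < k → ∃ u ∈ Z, lab u ∈ W
  const : ∀ T, KEC k I T → ∀ u ∈ T, ∀ v ∈ T, comp (lab u) = comp (lab v)

variable {k : ℕ} {I : Finset (V × V)} {lab : V → ℕ} {comp anchor : ℕ → ℕ} {W : List ℕ}

theorem Refines.init (hcomp : ∀ u, comp (lab u) = 0) (hW : ∀ u, lab u ∈ W) :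
    Refines k I lab comp anchor W :=
  ⟨fun _ _ ⟨u, hu⟩ _ _ _ _ => ⟨u, hu, hW u⟩, fun _ _ u _ v _ => by rw [hcomp, hcomp]⟩

/-- If `t` is k-edge-connected to its anchor, no small cut separates the two, so `t` cannot be the
witness for a set that avoids the anchor. -/
theorem Refines.pop {u v : V} {t : ℕ} (h : Refines k I lab comp anchor (t :: W))
    (hv : lab v = t) (hu : lab u = anchor (comp t))
    (hr : Reach k (live I fun u => comp (lab u)) u v) : Refines k I lab comp anchor W := by
  refine ⟨fun Z id hne hid hsat hanc hlt => ?_, h.const⟩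
  obtain ⟨x, hx, hxW⟩ := h.cut Z id hne hid hsat hanc hlt
  rcases List.mem_cons.1 hxW with hxt | hxW
  · exfalso
    have hvZ : v ∈ Z := hsat x v (hxt.trans hv.symm) hx
    have hidt : comp t = id := by rw [← hv]; exact hid v hvZ
    have huZ : u ∉ Z := fun hc => hanc u hc (by rw [hu, hidt])
    exact absurd hlt (not_lt.mpr (hr.symm Z hvZ huZ))
  · exact ⟨x, hx, hxW⟩

-- The part `C` of cluster `c` receives the number `new`. The old anchor and `t` end up in different
-- parts and become their anchors, so `t` may leave the stack. A small cut after the split either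
-- touches a removed edge, whose ends are pushed, or was a small cut before. A k-edge-connected set
-- stays in one part because by `hclosed` no edge crossing the border of `C` joins vertices that are
-- k-edge-connected.
open scoped Classical in
theorem Refines.split {t c new x y : ℕ} {C : Set ℕ} {W' : List ℕ} {comp' anchor' : ℕ → ℕ}
    (hk : 1 ≤ k) (h : Refines k I lab comp anchor (t :: W))
    (htc : comp t = c) (hxy : x = anchor c ∧ y = t ∨ x = t ∧ y = anchor c)
    (hxC : x ∈ C) (hyC : y ∉ C) (hC : ∀ a ∈ C, comp a = c)
    (hnew : ∀ u, comp (lab u) ≠ new)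
    (hcomp' : ∀ u, comp' (lab u) = if lab u ∈ C then new else comp (lab u))
    (han : ∀ id, anchor' id = if id = new then x else if id = c then y else anchor id)
    (hclosed : ∀ p ∈ live I (fun u => comp (lab u)), ¬(lab p.1 ∈ C ↔ lab p.2 ∈ C) →
      ¬Reach k (live I fun u => comp (lab u)) p.1 p.2)
    (hW : ∀ a ∈ W, a ∈ W')
    (hpush : ∀ p ∈ live I (fun u => comp (lab u)), ¬(lab p.1 ∈ C ↔ lab p.2 ∈ C) →
      lab p.1 ∈ W' ∧ lab p.2 ∈ W') :
    Refines k I lab comp' anchor' W' := by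
  have hlive : ∀ p, p ∈ live I (fun u => comp' (lab u)) ↔
      p ∈ live I (fun u => comp (lab u)) ∧ (lab p.1 ∈ C ↔ lab p.2 ∈ C) := by
    intro p
    rw [mem_live, mem_live, hcomp', hcomp']
    have h1 := hnew p.1
    have h2 := hnew p.2
    by_cases hp1 : lab p.1 ∈ C <;> by_cases hp2 : lab p.2 ∈ C
    · simp [hp1, hp2, hC _ hp1, hC _ hp2]
    · simp [hp1, hp2, Ne.symm h2]
    · simp [hp1, hp2, h1]
    · simp [hp1, hp2]
  refine ⟨fun Z id hne hid hsat hanc hlt => ?_, fun T hT u hu v hv => ?_⟩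
  · by_cases hb : ∃ p ∈ live I (fun u => comp (lab u)), ¬(lab p.1 ∈ C ↔ lab p.2 ∈ C) ∧
        (p.1 ∈ Z ∨ p.2 ∈ Z)
    · obtain ⟨p, hp, hpC, hpZ | hpZ⟩ := hb
      · exact ⟨_, hpZ, (hpush p hp hpC).1⟩
      · exact ⟨_, hpZ, (hpush p hp hpC).2⟩
    -- No removed edge touches `Z`, so its cut is not larger in the old graph and the old invariant
    -- applies.
    · push Not at hb
      have hcut : cutset (live I fun u => comp (lab u)) Z ⊆
          cutset (live I fun u => comp' (lab u)) Z := by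
        intro p hp
        rw [mem_cutset] at hp ⊢
        refine ⟨(hlive p).2 ⟨hp.1, ?_⟩, hp.2⟩
        by_contra hpC
        have := hb p hp.1 (by tauto)
        tauto
      have hlt' := (Finset.card_le_card hcut).trans_lt hlt
      have hin : ∀ u ∈ Z, (lab u ∈ C ↔ id = new) := by
        intro u hu
        have h1 := hid u hu
        rw [hcomp'] at h1
        have h2 := hnew u
        by_cases hu : lab u ∈ C
        · simp only [hu, if_true] at h1; simp [hu, h1]
        · simp only [hu, if_false] at h1; simp only [hu, false_iff]; rwa [← h1]
      obtain ⟨u, hu, huW⟩ : ∃ u ∈ Z, lab u ∈ t :: W := by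
        by_cases hidn : id = new
        · refine h.cut Z c hne (fun u hu => hC _ ((hin u hu).2 hidn)) hsat (fun u hu hc => ?_) hlt'
          have h1 := hanc u hu
          rw [han, if_pos hidn] at h1
          have h2 := (hin u hu).2 hidn
          rcases hxy with ⟨h3, h4⟩ | ⟨h3, h4⟩
          · exact h1 (hc.trans h3.symm)
          · rw [hc, ← h4] at h2; exact hyC h2
        · have hnC : ∀ u ∈ Z, lab u ∉ C := fun u hu hc => hidn ((hin u hu).1 hc)
          refine h.cut Z id hne (fun u hu => ?_) hsat (fun u hu hc => ?_) hlt'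
          · rw [← hid u hu, hcomp', if_neg (hnC u hu)]
          · have h1 := hanc u hu
            rw [han, if_neg hidn] at h1
            split at h1
            · next hidc =>
              rcases hxy with ⟨h3, h4⟩ | ⟨h3, h4⟩
              · rw [hidc, ← h3] at hc; exact hnC u hu (hc ▸ hxC)
              · rw [hidc, ← h4] at hc; exact h1 hc
            · exact h1 hc
      -- The witness `t` is excluded: it is the new anchor of its part, and `Z` avoids the anchor.
      rcases List.mem_cons.1 huW with hut | huW
      · exfalso
        have h1 := hanc u hu
        have h2 := hin u hu
        have h3 := hid u hu
        rw [hcomp'] at h3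
        rw [han] at h1
        rw [hut] at h1 h2 h3
        by_cases hidn : id = new
        · rw [if_pos hidn] at h1
          rcases hxy with ⟨h5, h6⟩ | ⟨h5, h6⟩
          · rw [h6] at hyC; exact hyC (h2.2 hidn)
          · exact h1 h5.symm
        · have htC : t ∉ C := fun hc => hidn (h2.1 hc)
          rw [if_neg htC, htc] at h3
          rw [if_neg hidn, if_pos h3.symm] at h1
          rcases hxy with ⟨h5, h6⟩ | ⟨h5, h6⟩
          · exact h1 h6.symm
          · exact htC (h5 ▸ hxC)
      · exact ⟨u, hu, hW _ huW⟩
  · have hsub : inside I T ⊆ live I fun u => comp (lab u) := by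
      intro p hp
      rw [mem_inside] at hp
      exact mem_live.2 ⟨hp.1, h.const T hT _ hp.2.1 _ hp.2.2⟩
    -- If `C` split `T`, then, as `1 ≤ k`, an edge inside `T` would cross the border of `C`, and its
    -- ends would be k-edge-connected within `T`.
    have hsame : ∀ u ∈ T, ∀ v ∈ T, lab u ∈ C → lab v ∈ C := by
      intro u hu v hv huC
      by_contra hvC
      have hcard := hT {z | lab z ∈ C} ⟨u, hu, huC⟩ ⟨v, hv, hvC⟩
      obtain ⟨p, hp⟩ := Finset.card_pos.1 (lt_of_lt_of_le hk hcard)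
      rw [mem_cutset] at hp
      have hp' := mem_inside.1 hp.1
      exact hclosed p (hsub hp.1) hp.2 (hT.reach hsub hp'.2.1 hp'.2.2)
    rw [hcomp', hcomp', h.const T hT u hu v hv]
    have h1 := hsame u hu v hv
    have h2 := hsame v hv u hu
    simp only [show lab u ∈ C ↔ lab v ∈ C from ⟨h1, h2⟩]

/-- With an empty stack, each of the two sides of a small cut of a cluster must contain a vertex of
the anchor class; but such a cut cannot split a class. -/
theorem Refines.isKPart (h : Refines k I lab comp anchor [])
    (hcls : ∀ u, KEC k I {v | lab v = lab u}) : IsKPart k I fun u => comp (lab u) := by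
  refine ⟨fun w Z hZ hZ' => ?_, h.const⟩
  by_contra hlt
  rw [not_le] at hlt
  obtain ⟨a, ha, haZ⟩ := hZ
  obtain ⟨b, hb, hbZ⟩ := hZ'
  set S : Set V := {v | comp (lab v) = comp (lab w)} with hS
  have hsat : ∀ u v, lab u = lab v → u ∈ S → u ∈ Z → v ∈ Z := by
    intro u v huv hu huZ
    refine (hcls u).not_split (T := S) ?_ hlt (u := u) (v := v) rfl huv.symm huZ
    intro x hx
    have hx : lab x = lab u := hx
    have hu : comp (lab u) = comp (lab w) := hu
    change comp (lab x) = comp (lab w)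
    rw [hx, hu]
  have hS' : ∀ u v, lab u = lab v → u ∈ S → v ∈ S := by
    intro u v huv hu
    have hu : comp (lab u) = comp (lab w) := hu
    change comp (lab v) = comp (lab w)
    rw [← huv, hu]
  have key : ∀ Y : Set V, (∃ a ∈ S, a ∈ Y) → (∀ u v, lab u = lab v → u ∈ S → u ∈ Y → v ∈ Y) →
      (cutset (inside I S) Y).card < k → ∃ u ∈ S, u ∈ Y ∧ lab u = anchor (comp (lab w)) := by
    rintro Y ⟨a, ha, haY⟩ hY hlt
    by_contra hno
    push Not at hno
    have hsub : cutset (live I fun u => comp (lab u)) (Y ∩ S) ⊆ cutset (inside I S) Y := by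
      intro p hp
      rw [mem_cutset, mem_live] at hp
      rw [mem_cutset, mem_inside]
      obtain ⟨⟨hpI, hpc⟩, hpn⟩ := hp
      have : p.1 ∈ S ↔ p.2 ∈ S := by
        change comp (lab p.1) = comp (lab w) ↔ comp (lab p.2) = comp (lab w)
        rw [hpc]
      simp only [Set.mem_inter_iff] at hpn
      tauto
    obtain ⟨u, -, hu⟩ := h.cut (Y ∩ S) (comp (lab w)) ⟨a, haY, ha⟩ (fun u hu => hu.2)
      (fun u v huv hu => ⟨hY u v huv hu.2 hu.1, hS' u v huv hu.2⟩)
      (fun u hu => hno u hu.2 hu.1) (lt_of_le_of_lt (Finset.card_le_card hsub) hlt)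
    simp at hu
  obtain ⟨u, huS, huZ, hu⟩ := key Z ⟨a, ha, haZ⟩ hsat hlt
  -- The complement has the same cut, so the anchor class also has a vertex outside `Z`.
  obtain ⟨v, hvS, hvZ, hv⟩ := key Zᶜ ⟨b, hb, hbZ⟩
    (fun u v huv hu huZ hvZ => huZ (hsat v u huv.symm (hS' u v huv hu) hvZ))
    (by rwa [cutset_compl])
  exact hvZ (hsat u v (hu.trans hv.symm) huS huZ)

end Refinement

end EdgeConn

namespace EdgeConn

open WordRAM

/-! ### Stepwise and adaptive use of the decremental algorithm -/

section Interface

/-- From the memory `p`, with current graph `G`, the algorithm serves every sequence of requests,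
and all the deletions together take at most `B` steps. -/
def Decremental.Ready (D : Decremental) (w k : ℕ) (tq : ℝ) {n : ℕ} (G : SimpleGraph (Fin n))
    (B : ℕ) (p : State) : Prop :=
  -- Step counts are natural numbers, so a real budget below `B + 1` allows at most `B` steps.
  ∃ b : ℝ, b < B + 1 ∧ ∀ rs : List (Request n), D.Serves w k tq G b p rs

variable {D : Decremental} {w k : ℕ} {tq : ℝ} {n : ℕ} {G : SimpleGraph (Fin n)} {B : ℕ} {p : State}

/-- The list with this single query provides an execution. Every longer list that begins with this
query provides the same one by `Exec.det`, so all continuations are served from the same memory. -/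
theorem Decremental.Ready.query (h : D.Ready w k tq G B p) (u v : Fin n) :
    Does w D.query (passArgs p u v) fun t p' =>
      t ≤ ⌊tq⌋₊ ∧ (p'.var 0 ≠ 0 ↔ G.IsEdgeReachable k u v) ∧ D.Ready w k tq G B p' := by
  obtain ⟨b, hb, hs⟩ := h
  obtain ⟨t, p', h1, h2, h3, -⟩ := hs [.query u v]
  refine ⟨t, p', h1, Nat.le_floor h2, h3, b, hb, fun rs => ?_⟩
  obtain ⟨t', p'', h1', -, -, h4⟩ := hs (.query u v :: rs)
  obtain ⟨-, rfl⟩ := h1.det h1'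
  exact h4

/-- As for queries, with the time of the deletion taken from the common budget. -/
theorem Decremental.Ready.delete (h : D.Ready w k tq G B p) {u v : Fin n} (huv : G.Adj u v) :
    Does w D.delete (passArgs p u v) fun t p' =>
      t ≤ B ∧ D.Ready w k tq (G.deleteEdges {s(u, v)}) (B - t) p' := by
  obtain ⟨b, hb, hs⟩ := h
  obtain ⟨t, p', h1, h2, -⟩ := hs [.delete u v] huv
  have htB : t ≤ B := by
    have : (t : ℝ) < B + 1 := h2.trans_lt hb
    exact Nat.lt_succ_iff.1 (by exact_mod_cast this)
  refine ⟨t, p', h1, htB, b - t, ?_, fun rs => ?_⟩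
  · push_cast [htB]; linarith
  obtain ⟨t', p'', h1', -, h4⟩ := hs (.delete u v :: rs) huv
  obtain ⟨rfl, rfl⟩ := h1.det h1'
  exact h4

theorem Decremental.Supports.init {K : Set ℕ} {tp tq : ℕ → ℕ → ℝ} {c : ℕ}
    (h : D.Supports K tp tq c) (hk : k ∈ K) (hn : 2 ≤ n) {es : List (Fin n × Fin n)}
    (hes : IsEdgeList G es) (hw : (n + k + 2) ^ c ≤ 2 ^ w) (hp : p.IsWord w)
    (hin : HoldsInput k es p) :
    Does w D.init p fun t p' => t ≤ ⌊tp k n * (n + es.length)⌋₊ ∧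
      D.Ready w k (tq k n) G (⌊tp k n * (n + es.length)⌋₊ - t) p' := by
  obtain ⟨t, p', h1, h2, h3⟩ := h k hk n hn G es hes w hw p hp hin
  have ht := Nat.le_floor h2
  refine ⟨t, p', h1, ht, _, ?_, h3⟩
  push_cast [ht]
  have := Nat.lt_floor_add_one (tp k n * (n + es.length))
  linarith

end Interface

section Calls

variable {D : Decremental} {w k : ℕ} {tq : ℝ} {n : ℕ} {I : Finset (Fin n × Fin n)} {B : ℕ}

/-- A call of the shifted query procedure. -/
def Decremental.queryCmd (D : Decremental) (e₁ e₂ : Expr) : Cmd :=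
  .seq (.assign 100 e₁) (.seq (.assign 101 e₂) D.query.shift)

/-- A call of the shifted deletion procedure. -/
def Decremental.deleteCmd (D : Decremental) (e₁ e₂ : Expr) : Cmd :=
  .seq (.assign 100 e₁) (.seq (.assign 101 e₂) D.delete.shift)

theorem high_passArgs (s : State) (u v : Fin n) :
    ((s.setVar 100 u).setVar 101 v).high = passArgs s.high u v := by
  simp only [State.high, passArgs, State.setVar, State.mk.injEq, and_true]
  funext x
  simp only [Function.update_apply]
  rcases x with _ | _ | x <;> simp

theorem withHigh_passArgs (s p : State) (u v : ℕ) :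
    ((s.setVar 100 u).setVar 101 v).withHigh p = s.withHigh p := by
  simp only [State.withHigh, State.setVar, State.mk.injEq, and_true]
  funext x
  simp only [Function.update_apply]
  split
  · rw [if_neg (by omega), if_neg (by omega)]
  · rfl

theorem does_queryCmd {s : State} {e₁ e₂ : Expr} {u v : Fin n} (hI : Simple I)
    (h : D.Ready w k tq (graphOf I) B s.high) (h₁ : e₁.eval w s = u)
    (h₂ : e₂.eval w (s.setVar 100 u) = v) :
    Does w (D.queryCmd e₁ e₂) s fun t s' => t ≤ ⌊tq⌋₊ + e₁.cost + e₂.cost + 2 ∧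
      ∃ p, s' = s.withHigh p ∧ (p.var 0 ≠ 0 ↔ Reach k I u v) ∧
        D.Ready w k tq (graphOf I) B p := by
  unfold Decremental.queryCmd
  rw [does_seq, does_assign, does_seq, does_assign, h₁, h₂]
  refine does_shift ?_
  rw [high_passArgs]
  refine (h.query u v).mono ?_
  rintro t p ⟨ht, hp, hr⟩
  refine ⟨by omega, p, withHigh_passArgs _ _ _ _, ?_, hr⟩
  rw [hp, isEdgeReachable_graphOf hI]

theorem does_deleteCmd {s : State} {e₁ e₂ : Expr} {q : Fin n × Fin n} (hI : Simple I)
    (hq : q ∈ I)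
    (h : D.Ready w k tq (graphOf I) B s.high) (h₁ : e₁.eval w s = q.1)
    (h₂ : e₂.eval w (s.setVar 100 q.1) = q.2) :
    Does w (D.deleteCmd e₁ e₂) s fun t s' => ∃ t' p, t = t' + e₁.cost + e₂.cost + 2 ∧ t' ≤ B ∧
      s' = s.withHigh p ∧ D.Ready w k tq (graphOf (I.erase q)) (B - t') p := by
  unfold Decremental.deleteCmd
  rw [does_seq, does_assign, does_seq, does_assign, h₁, h₂]
  refine does_shift ?_
  rw [high_passArgs]
  refine (h.delete ((adj_graphOf hI).2 ⟨q, hq, rfl⟩)).mono ?_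
  rintro t p ⟨ht, hr⟩
  refine ⟨t, p, by omega, ht, withHigh_passArgs _ _ _ _, ?_⟩
  rw [graphOf_erase hI hq]
  exact hr

end Calls

/-! ### Linked lists of incident edges -/

/-- `l` is the list that starts at `p` and continues with the links `nx`; `0` is the end. -/
def Chain (nx : ℕ → ℕ) : ℕ → List ℕ → Prop
  | p, [] => p = 0
  | p, s :: l => p = s ∧ s ≠ 0 ∧ Chain nx (nx s) l

theorem Chain.congr {nx nx' : ℕ → ℕ} {l : List ℕ} (hl : ∀ s ∈ l, nx' s = nx s) {p : ℕ}
    (h : Chain nx p l) : Chain nx' p l := by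
  induction l generalizing p with
  | nil => exact h
  | cons s l ih =>
    obtain ⟨h1, h2, h3⟩ := h
    refine ⟨h1, h2, ih (fun x hx => hl x (List.mem_cons_of_mem _ hx)) ?_⟩
    rw [hl s List.mem_cons_self]
    exact h3

/-- The owner of a slot: the slots `2 i + 1` and `2 i + 2` belong to the endpoints of edge `i`. -/
def src (a b : ℕ → ℕ) (s : ℕ) : ℕ := if s % 2 = 1 then a ((s - 1) / 2) else b ((s - 1) / 2)

/-- The slots of the first `M` edges that belong to `v`, omitting loops. -/
def adjList (a b : ℕ → ℕ) : ℕ → ℕ → List ℕ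
  | 0, _ => []
  | M + 1, v =>
    if a M = b M then adjList a b M v
    else if b M = v then (2 * M + 2) :: adjList a b M v
    else if a M = v then (2 * M + 1) :: adjList a b M v
    else adjList a b M v

theorem src_odd (a b : ℕ → ℕ) (i : ℕ) : src a b (2 * i + 1) = a i := by
  simp [src, Nat.add_mod]

theorem src_even (a b : ℕ → ℕ) (i : ℕ) : src a b (2 * i + 2) = b i := by
  have h1 : (2 * i + 1) / 2 = i := by omega
  simp [src, h1]

theorem adjList_succ (a b : ℕ → ℕ) (M v : ℕ) : adjList a b (M + 1) v =
    if a M = b M then adjList a b M v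
    else if b M = v then (2 * M + 2) :: adjList a b M v
    else if a M = v then (2 * M + 1) :: adjList a b M v
    else adjList a b M v := rfl

theorem mem_adjList {a b : ℕ → ℕ} {M v s : ℕ} : s ∈ adjList a b M v ↔
    ∃ i < M, a i ≠ b i ∧ (s = 2 * i + 1 ∧ a i = v ∨ s = 2 * i + 2 ∧ b i = v) := by
  induction M with
  | zero => simp [adjList]
  | succ M ih =>
    have : (∃ i < M + 1, a i ≠ b i ∧ (s = 2 * i + 1 ∧ a i = v ∨ s = 2 * i + 2 ∧ b i = v)) ↔
        (a M ≠ b M ∧ (s = 2 * M + 1 ∧ a M = v ∨ s = 2 * M + 2 ∧ b M = v)) ∨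
        s ∈ adjList a b M v := by
      rw [ih]
      constructor
      · rintro ⟨i, hi, h⟩
        rcases Nat.lt_succ_iff_lt_or_eq.1 hi with hi | rfl
        · exact Or.inr ⟨i, hi, h⟩
        · exact Or.inl h
      · rintro (h | ⟨i, hi, h⟩)
        · exact ⟨M, by omega, h⟩
        · exact ⟨i, by omega, h⟩
    rw [this, adjList_succ]
    split_ifs with h1 h2 h3
    · simp [h1]
    · have : a M ≠ v := fun h => h1 (h.trans h2.symm)
      simp [h2, this]
    · simp [h2, h3, Ne.symm h2]
    · simp [h2, h3]

theorem adjList_le {a b : ℕ → ℕ} {M v s : ℕ} (h : s ∈ adjList a b M v) : s ≤ 2 * M := by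
  obtain ⟨i, hi, -, h | h⟩ := mem_adjList.1 h <;> omega

theorem adjList_ne_zero {a b : ℕ → ℕ} {M v s : ℕ} (h : s ∈ adjList a b M v) : s ≠ 0 := by
  obtain ⟨i, hi, -, h | h⟩ := mem_adjList.1 h <;> omega

theorem nodup_adjList (a b : ℕ → ℕ) (M v : ℕ) : (adjList a b M v).Nodup := by
  induction M with
  | zero => simp [adjList]
  | succ M ih =>
    rw [adjList_succ]
    split_ifs
    · exact ih
    · exact List.nodup_cons.2 ⟨fun h => by have := adjList_le h; omega, ih⟩
    · exact List.nodup_cons.2 ⟨fun h => by have := adjList_le h; omega, ih⟩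
    · exact ih

/-- The program that builds the lists of incident edges for the edges with the endpoints `ea` and
`eb` in round `i = var 6`: heads in array `hd`, links in `nx`, other endpoints in `ds`. -/
def buildAdj (hd nx ds y : ℕ) (ea eb : Expr) : Cmd :=
  Cmd.for 6 y <|
    .seq (.assign 22 ea) <| .seq (.assign 23 eb) <|
    .cond (.op .eq (.var 22) (.var 23)) .skip <|
      .seq (.assign 24 (.op .add (.op .mul (.lit 2) (.var 6)) (.lit 1))) <|
      .seq (.store nx (.var 24) (.load hd (.var 22))) <|
      .seq (.store ds (.var 24) (.var 23)) <|
      .seq (.store hd (.var 22) (.var 24)) <|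
      .seq (.assign 24 (.op .add (.var 24) (.lit 1))) <|
      .seq (.store nx (.var 24) (.load hd (.var 23))) <|
      .seq (.store ds (.var 24) (.var 22)) <|
      .store hd (.var 23) (.var 24)

/-- Used twice: for the vertices of the input graph, and for the classes, whose end expressions go
through the labels. Slots start at `1` because `0` marks the end of a list; those of edge `i` exceed
all earlier ones, so old links are never overwritten. -/
theorem does_buildAdj {w hd nx ds y M N : ℕ} {ea eb : Expr} {a b : ℕ → ℕ} {s₀ : State}
    (hne : hd ≠ nx ∧ hd ≠ ds ∧ nx ≠ ds) (hy : y ≠ 6 ∧ y ≠ 22 ∧ y ≠ 23 ∧ y ≠ 24)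
    (hM : s₀.var y = M) (hw : 2 * M + 2 < 2 ^ w) (hca : ea.cost ≤ 5) (hcb : eb.cost ≤ 5)
    (hea : ∀ s i, i < M → s.var 6 = i → (∀ z, z ≠ hd → z ≠ nx → z ≠ ds → s.arr z = s₀.arr z) →
      ea.eval w s = a i)
    (heb : ∀ s i, i < M → s.var 6 = i → (∀ z, z ≠ hd → z ≠ nx → z ≠ ds → s.arr z = s₀.arr z) →
      eb.eval w s = b i)
    (h0 : ∀ v < N, s₀.arr hd v = 0) :
    Does w (buildAdj hd nx ds y ea eb) s₀ fun t s => t ≤ 80 * M + 6 ∧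
      (∀ v < N, Chain (s.arr nx) (s.arr hd v) (adjList a b M v) ∧
        ∀ x ∈ adjList a b M v, s.arr ds x = src b a x) ∧
      (∀ z, z ≠ 6 → z ≠ 22 → z ≠ 23 → z ≠ 24 → s.var z = s₀.var z) ∧
      (∀ z, z ≠ hd → z ≠ nx → z ≠ ds → s.arr z = s₀.arr z) := by
  obtain ⟨hn1, hn2, hn3⟩ := hne
  unfold buildAdj
  refine (does_for (fun i τ s => τ ≤ 80 * i ∧ ∀ v < N,
      Chain (s.arr nx) (s.arr hd v) (adjList a b i v) ∧
        ∀ x ∈ adjList a b i v, s.arr ds x = src b a x) (80 * M) hy.1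
      (by simp [Cmd.KeepsVar]) (by simpa [Cmd.KeepsVar] using hy.2) hM (by omega)
      ⟨le_rfl, fun v hv => ⟨by simpa [adjList, Chain] using h0 v hv, by simp [adjList]⟩⟩
      (fun i τ s hi h => h.1.trans (by omega)) ?_).mono ?_
  · rintro i τ s hi ⟨hτ, hI⟩ hs6 hsy hfv hfa
    have hfa' : ∀ z, z ≠ hd → z ≠ nx → z ≠ ds → s.arr z = s₀.arr z := fun z h1 h2 h3 =>
      hfa z (by simp [Cmd.KeepsArr, h1, h2, h3])
    have ha := hea s i hi hs6 hfa'
    have hb := heb (s.setVar 22 (a i)) i hi (by simp [hs6]) hfa'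
    rw [does_seq, does_assign, ha, does_seq, does_assign, hb, does_cond]
    have hone : 1 % 2 ^ w = 1 := Nat.mod_eq_of_lt (by omega)
    have htwo : 2 % 2 ^ w = 2 := Nat.mod_eq_of_lt (by omega)
    have e1 : 2 * i % 2 ^ w = 2 * i := Nat.mod_eq_of_lt (by omega)
    have e2 : (2 * i + 1) % 2 ^ w = 2 * i + 1 := Nat.mod_eq_of_lt (by omega)
    have e3 : (2 * i + 1 + 1) % 2 ^ w = 2 * i + 2 := Nat.mod_eq_of_lt (by omega)
    by_cases hab : a i = b i
    · simp only [Expr.eval, Op.eval, var_setVar, hab, hone]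
      simp only [Nat.reduceEqDiff, if_true, if_false, one_ne_zero]
      rw [does_skip]
      refine ⟨by simp only [Expr.cost]; omega, ?_⟩
      simp only [adjList, hab, if_true]
      exact hI
    · simp only [Expr.eval, Op.eval, var_setVar, hone]
      simp only [Nat.reduceEqDiff, if_true, if_false, hab]
      simp only [does_seq, does_assign, does_store, Expr.eval, Op.eval, var_setVar, var_setArr,
        arr_setVar, arr_setArr, Nat.reduceEqDiff, if_true, if_false, hs6, hone, htwo, e1, e2, e3,
        hn1, hn2, hn3, hn1.symm, hn2.symm, hn3.symm]
      refine ⟨by simp only [Expr.cost]; omega, fun v hv => ?_⟩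
      obtain ⟨hc, hd'⟩ := hI v hv
      have hfresh : ∀ x ∈ adjList a b i v, x ≠ 2 * i + 1 ∧ x ≠ 2 * i + 2 := fun x hx => by
        have := adjList_le hx; omega
      have hc' : ∀ p q, Chain (Function.update (Function.update (s.arr nx) (2 * i + 1) p)
          (2 * i + 2) q) (s.arr hd v) (adjList a b i v) := fun p q =>
        hc.congr fun x hx => by
          rw [Function.update_of_ne (hfresh x hx).2, Function.update_of_ne (hfresh x hx).1]
      have hd'' : ∀ p q, ∀ x ∈ adjList a b i v, Function.update (Function.update (s.arr ds)
          (2 * i + 1) p) (2 * i + 2) q x = src b a x := fun p q x hx => by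
        rw [Function.update_of_ne (hfresh x hx).2, Function.update_of_ne (hfresh x hx).1, hd' x hx]
      rw [adjList_succ, if_neg hab]
      split_ifs with h1 h2
      · subst h1
        refine ⟨⟨by simp, by omega, ?_⟩, ?_⟩
        · have : Function.update (s.arr hd) (a i) (2 * i + 1) (b i) = s.arr hd (b i) :=
            Function.update_of_ne (Ne.symm hab) _ _
          rw [this, Function.update_self]
          exact hc' _ _
        · intro x hx
          rcases List.mem_cons.1 hx with rfl | hx
          · simp [src_even]
          · exact hd'' _ _ x hx
      · subst h2
        refine ⟨⟨?_, by omega, ?_⟩, ?_⟩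
        · rw [Function.update_of_ne hab, Function.update_self]
        · rw [Function.update_of_ne (show 2 * i + 1 ≠ 2 * i + 2 by omega), Function.update_self]
          exact hc' _ _
        · intro x hx
          rcases List.mem_cons.1 hx with rfl | hx
          · rw [Function.update_of_ne (show 2 * i + 1 ≠ 2 * i + 2 by omega), Function.update_self,
              src_odd]
          · exact hd'' _ _ x hx
      · rw [Function.update_of_ne (Ne.symm h1), Function.update_of_ne (Ne.symm h2)]
        exact ⟨hc' _ _, hd'' _ _⟩
  · rintro t s ⟨τ, rfl, ⟨hτ, hI⟩, -, hfv, hfa⟩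
    refine ⟨by omega, hI, fun z h1 h2 h3 h4 => hfv z h1 (by simp [Cmd.KeepsVar, h2, h3, h4]),
      fun z h1 h2 h3 => hfa z (by simp [Cmd.KeepsArr, h1, h2, h3])⟩

end EdgeConn

namespace EdgeConn

open WordRAM

/-! ### Linked lists of vertices -/

/-- The nonempty list `l` ends in `tl` and its elements are linked by `qn`. -/
def Linked (qn : ℕ → ℕ) (tl : ℕ) : List ℕ → Prop
  | [] => False
  | [v] => v = tl
  | u :: v :: l => qn u = v ∧ Linked qn tl (v :: l)

theorem Linked.congr {qn qn' : ℕ → ℕ} {tl : ℕ} {l : List ℕ} (h : Linked qn tl l)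
    (hq : ∀ v ∈ l, qn' v = qn v) : Linked qn' tl l := by
  induction l with
  | nil => exact h
  | cons u l ih =>
    cases l with
    | nil => exact h
    | cons v l =>
      exact ⟨(hq u List.mem_cons_self).trans h.1, ih h.2 fun x hx => hq x (List.mem_cons_of_mem _ hx)⟩

theorem Linked.mem {qn : ℕ → ℕ} {tl : ℕ} {l : List ℕ} (h : Linked qn tl l) : tl ∈ l := by
  induction l with
  | nil => exact h.elim
  | cons u l ih =>
    cases l with
    | nil => rw [show u = tl from h]; exact List.mem_cons_self
    | cons v l => exact List.mem_cons_of_mem _ (ih h.2)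

/-- Without repetitions `tl` occurs only at the end, so writing its link leaves the other links
intact. -/
theorem Linked.append {qn : ℕ → ℕ} {tl : ℕ} {l : List ℕ} (h : Linked qn tl l) (hl : l.Nodup)
    (v : ℕ) : Linked (Function.update qn tl v) v (l ++ [v]) := by
  induction l with
  | nil => exact h.elim
  | cons u l ih =>
    cases l with
    | nil =>
      rw [show u = tl from h]
      exact ⟨by simp, rfl⟩
    | cons x l =>
      refine ⟨?_, ih h.2 (List.nodup_cons.1 hl).2⟩
      have : u ≠ tl := fun hc => (List.nodup_cons.1 hl).1 (hc ▸ h.2.mem)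
      rw [Function.update_of_ne this]
      exact h.1

theorem Linked.suffix {qn : ℕ → ℕ} {tl cur : ℕ} {d rest : List ℕ}
    (h : Linked qn tl (d ++ cur :: rest)) : Linked qn tl (cur :: rest) := by
  induction d with
  | nil => exact h
  | cons u d ih =>
    cases d with
    | nil => exact h.2
    | cons v d => exact ih h.2

theorem Linked.rest_eq_nil {qn : ℕ → ℕ} {tl : ℕ} {rest : List ℕ}
    (h : Linked qn tl (tl :: rest)) (hl : (tl :: rest).Nodup) : rest = [] := by
  cases rest with
  | nil => rfl
  | cons v l => exact absurd h.2.mem (List.nodup_cons.1 hl).1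

theorem Linked.exists_rest {qn : ℕ → ℕ} {tl cur : ℕ} {rest : List ℕ}
    (h : Linked qn tl (cur :: rest)) (hne : cur ≠ tl) : ∃ rest', rest = qn cur :: rest' := by
  cases rest with
  | nil => exact absurd h hne
  | cons v l => exact ⟨l, by rw [h.1]⟩

/-! ### The graph on the classes -/

/-- A list of edges `E 0, …, E (h - 1)` together with classes of vertices, which `lab` numbers from
`0` to `nc - 1` and which have the representatives `rep`. -/
structure Net (n : ℕ) where
  h : ℕ
  E : ℕ → Fin n × Fin n
  lab : Fin n → ℕ
  nc : ℕ
  rep : ℕ → Fin n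
  lab_lt : ∀ u, lab u < nc
  lab_rep : ∀ a < nc, lab (rep a) = a
  inj : ∀ i < h, ∀ j < h, E i = E j → i = j
  simple : Simple ((Finset.range h).image E)

namespace Net

variable {n : ℕ} (N : Net n)

def edges : Finset (Fin n × Fin n) := (Finset.range N.h).image N.E

def a (i : ℕ) : ℕ := N.lab (N.E i).1

def b (i : ℕ) : ℕ := N.lab (N.E i).2

/-- The slots of a class. -/
def L (v : ℕ) : List ℕ := adjList N.a N.b N.h v

/-- The class at the other end of a slot. -/
def dst (s : ℕ) : ℕ := src N.b N.a s

def wt (v : ℕ) : ℕ := (N.L v).length + 1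

/-- The edges within the clusters of classes given by `comp`. -/
def cur (comp : ℕ → ℕ) : Finset (Fin n × Fin n) := live N.edges fun u => comp (N.lab u)

theorem mem_edges {p : Fin n × Fin n} : p ∈ N.edges ↔ ∃ i < N.h, N.E i = p := by
  simp [edges]

theorem mem_L {v s : ℕ} : s ∈ N.L v ↔ ∃ i < N.h, N.a i ≠ N.b i ∧
    (s = 2 * i + 1 ∧ N.a i = v ∨ s = 2 * i + 2 ∧ N.b i = v) := mem_adjList

theorem a_lt (i : ℕ) : N.a i < N.nc := N.lab_lt _

theorem b_lt (i : ℕ) : N.b i < N.nc := N.lab_lt _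

theorem dst_lt (s : ℕ) : N.dst s < N.nc := by
  unfold dst src
  split
  · exact N.b_lt _
  · exact N.a_lt _

theorem slot_lt {v s : ℕ} (h : s ∈ N.L v) : s ≠ 0 ∧ s ≤ 2 * N.h ∧ (s - 1) / 2 < N.h := by
  have h1 := adjList_ne_zero h
  have h2 := adjList_le h
  omega

/-- The edge of a slot joins the owner of the slot to the class at the other end. -/
theorem ends {v s : ℕ} (h : s ∈ N.L v) : v ≠ N.dst s ∧
    (N.a ((s - 1) / 2) = v ∧ N.b ((s - 1) / 2) = N.dst s ∨
      N.a ((s - 1) / 2) = N.dst s ∧ N.b ((s - 1) / 2) = v) := by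
  obtain ⟨i, hi, hne, ⟨rfl, rfl⟩ | ⟨rfl, rfl⟩⟩ := N.mem_L.1 h
  · have : (2 * i + 1 - 1) / 2 = i := by omega
    rw [dst, src_odd, this]
    exact ⟨hne, Or.inl ⟨rfl, rfl⟩⟩
  · have : (2 * i + 2 - 1) / 2 = i := by omega
    rw [dst, src_even, this]
    exact ⟨hne.symm, Or.inr ⟨rfl, rfl⟩⟩

theorem exists_slot {i : ℕ} (hi : i < N.h) (hne : N.a i ≠ N.b i) :
    (∃ s ∈ N.L (N.a i), (s - 1) / 2 = i ∧ N.dst s = N.b i) ∧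
    ∃ s ∈ N.L (N.b i), (s - 1) / 2 = i ∧ N.dst s = N.a i := by
  refine ⟨⟨2 * i + 1, N.mem_L.2 ⟨i, hi, hne, Or.inl ⟨rfl, rfl⟩⟩, by omega, ?_⟩,
    ⟨2 * i + 2, N.mem_L.2 ⟨i, hi, hne, Or.inr ⟨rfl, rfl⟩⟩, by omega, ?_⟩⟩
  · rw [dst, src_odd]
  · rw [dst, src_even]

/-- The total weight of a cluster. -/
def Wt (comp : ℕ → ℕ) (id : ℕ) : ℕ := ∑ u ∈ Finset.range N.nc, if comp u = id then N.wt u else 0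

/-- The potential that pays for the searches. -/
def Phi (comp : ℕ → ℕ) : ℕ :=
  ∑ v ∈ Finset.range N.nc, N.wt v * Nat.log 2 (N.Wt comp (comp v))

def tot : ℕ := ∑ u ∈ Finset.range N.nc, N.wt u

theorem Wt_le_tot (comp : ℕ → ℕ) (id : ℕ) : N.Wt comp id ≤ N.tot :=
  Finset.sum_le_sum fun u _ => by split <;> simp

/-- The initial potential, and thereby the total weight of all parts that are ever split off. -/
theorem Phi_le (comp : ℕ → ℕ) : N.Phi comp ≤ N.tot * Nat.log 2 N.tot := by
  rw [Phi, tot, Finset.sum_mul]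
  exact Finset.sum_le_sum fun v _ =>
    Nat.mul_le_mul_left _ (Nat.log_mono_right (N.Wt_le_tot _ _))

theorem sum_map_wt {l : List ℕ} (hl : l.Nodup) (hlt : ∀ v ∈ l, v < N.nc) :
    (l.map N.wt).sum = ∑ u ∈ Finset.range N.nc, if u ∈ l then N.wt u else 0 := by
  rw [← Finset.sum_filter]
  have : (Finset.range N.nc).filter (· ∈ l) = l.toFinset := by
    ext v
    simp only [Finset.mem_filter, Finset.mem_range, List.mem_toFinset]
    exact ⟨fun h => h.2, fun h => ⟨hlt v h, h⟩⟩
  rw [this, List.sum_toFinset _ hl]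

/-- Splitting off a part that weighs at most half of a cluster. -/
theorem Phi_split {comp comp' : ℕ → ℕ} {c new : ℕ} {l : List ℕ} (hl : l.Nodup)
    (hlt : ∀ v ∈ l, v < N.nc) (hc : ∀ v ∈ l, comp v = c)
    (hnew : ∀ v < N.nc, comp v ≠ new)
    (hcomp' : ∀ v, comp' v = if v ∈ l then new else comp v)
    (hhalf : 2 * (l.map N.wt).sum ≤ N.Wt comp c) :
    N.Phi comp' + (l.map N.wt).sum ≤ N.Phi comp := by
  have hWnew : N.Wt comp' new = (l.map N.wt).sum := by
    rw [N.sum_map_wt hl hlt, Wt]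
    refine Finset.sum_congr rfl fun u hu => ?_
    rw [hcomp']
    have := hnew u (Finset.mem_range.1 hu)
    by_cases h : u ∈ l <;> simp [h, this]
  have hWle : ∀ v, v < N.nc → v ∉ l → N.Wt comp' (comp v) ≤ N.Wt comp (comp v) := by
    intro v hv hvl
    refine Finset.sum_le_sum fun u hu => ?_
    rw [hcomp']
    have := hnew v hv
    by_cases h : u ∈ l
    · simp [h, this.symm]
    · simp [h]
  rw [N.sum_map_wt hl hlt, Phi, ← Finset.sum_add_distrib]
  refine Finset.sum_le_sum fun v hv => ?_
  rw [Finset.mem_range] at hv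
  by_cases h : v ∈ l
  · rw [if_pos h, hcomp', if_pos h, hWnew, hc v h]
    have h1 : (l.map N.wt).sum ≠ 0 := by
      have := List.single_le_sum (l := l.map N.wt) (by simp) _ (List.mem_map_of_mem h)
      have h3 : N.wt v ≠ 0 := by simp [wt]
      omega
    -- Halving the weight of the cluster lowers the logarithm of each member of the part by at least
    -- one.
    have h2 : Nat.log 2 (l.map N.wt).sum + 1 ≤ Nat.log 2 (N.Wt comp c) := by
      rw [← Nat.log_mul_base (by norm_num) h1]
      exact Nat.log_mono_right (by omega)
    calc _ = N.wt v * (Nat.log 2 (l.map N.wt).sum + 1) := by ring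
      _ ≤ _ := Nat.mul_le_mul_left _ h2
  · rw [if_neg h, hcomp', if_neg h, add_zero]
    exact Nat.mul_le_mul_left _ (Nat.log_mono_right (hWle v hv h))

/-! ### Searching a cluster -/

/-- The state of a search that started at `x` in cluster `c`: the list `l` of the classes found so
far, all of them in the relation `R`, is linked by `qn`; the search has finished with the classes
before `cur` and has to continue with the slot `ptr` of `cur`. -/
def Side (comp : ℕ → ℕ) (c : ℕ) (R : ℕ → Prop) (qn nx : ℕ → ℕ) (x cur tl ptr : ℕ) (l : List ℕ)
    (steps : ℕ) : Prop :=
  ∃ d rest pre rem, l = d ++ cur :: rest ∧ l.head? = some x ∧ Linked qn tl l ∧ l.Nodup ∧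
    (∀ v ∈ l, v < N.nc ∧ comp v = c ∧ R v) ∧ N.L cur = pre ++ rem ∧ Chain nx ptr rem ∧
    (∀ v ∈ d, ∀ s ∈ N.L v, comp (N.dst s) = c → R (N.dst s) → N.dst s ∈ l) ∧
    (∀ s ∈ pre, comp (N.dst s) = c → R (N.dst s) → N.dst s ∈ l) ∧
    steps = (d.map N.wt).sum + pre.length

variable {N} {comp : ℕ → ℕ} {c : ℕ} {R : ℕ → Prop} {qn nx : ℕ → ℕ} {x cur tl ptr : ℕ}
  {l : List ℕ} {steps : ℕ}

theorem Side.mem (h : N.Side comp c R qn nx x cur tl ptr l steps) :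
    x ∈ l ∧ cur ∈ l ∧ tl ∈ l := by
  obtain ⟨d, rest, pre, rem, h1, h2, h3, -⟩ := h
  refine ⟨List.mem_of_mem_head? h2, by simp [h1], h3.mem⟩

theorem Side.prop (h : N.Side comp c R qn nx x cur tl ptr l steps) :
    l.Nodup ∧ ∀ v ∈ l, v < N.nc ∧ comp v = c ∧ R v := by
  obtain ⟨d, rest, pre, rem, h1, h2, h3, h4, h5, -⟩ := h
  exact ⟨h4, h5⟩

theorem Side.linked (h : N.Side comp c R qn nx x cur tl ptr l steps) :
    l.head? = some x ∧ Linked qn tl l := by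
  obtain ⟨d, rest, pre, rem, h1, h2, h3, -⟩ := h
  exact ⟨h2, h3⟩

/-- A search spends one step per slot and one to leave a class, which is what `wt` counts. The last
class is never left, hence the `+ 1`. -/
theorem Side.steps_lt (h : N.Side comp c R qn nx x cur tl ptr l steps) :
    steps + 1 ≤ (l.map N.wt).sum := by
  obtain ⟨d, rest, pre, rem, rfl, h2, h3, h4, h5, h6, h7, h8, h9, rfl⟩ := h
  have : (N.L cur).length = pre.length + rem.length := by rw [h6, List.length_append]
  simp only [List.map_append, List.map_cons, List.sum_append, List.sum_cons, wt]
  omega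

theorem Side.init (hx : x < N.nc) (hc : comp x = c) (hR : R x) (hp : Chain nx ptr (N.L x)) :
    N.Side comp c R qn nx x x x ptr [x] 0 :=
  ⟨[], [], [], N.L x, rfl, rfl, rfl, List.nodup_singleton _, by simp [hx, hc, hR], rfl, hp,
    by simp, by simp, by simp⟩

theorem Side.congr {qn' : ℕ → ℕ} (h : N.Side comp c R qn nx x cur tl ptr l steps)
    (hq : ∀ v ∈ l, qn' v = qn v) : N.Side comp c R qn' nx x cur tl ptr l steps := by
  obtain ⟨d, rest, pre, rem, h1, h2, h3, h4⟩ := h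
  exact ⟨d, rest, pre, rem, h1, h2, h3.congr hq, h4⟩

theorem Side.ptr_mem (h : N.Side comp c R qn nx x cur tl ptr l steps) (hp : ptr ≠ 0) :
    ptr ∈ N.L cur := by
  obtain ⟨d, rest, pre, rem, h1, h2, h3, h4, h5, h6, h7, -⟩ := h
  cases rem with
  | nil => exact absurd h7 hp
  | cons s rem => rw [h6, show ptr = s from h7.1]; simp

/-- A slot may be passed over if its target is outside the cluster, unrelated to the source, or
already found. -/
theorem Side.skip (h : N.Side comp c R qn nx x cur tl ptr l steps) (hp : ptr ≠ 0)
    (hs : comp (N.dst ptr) = c → R (N.dst ptr) → N.dst ptr ∈ l) :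
    N.Side comp c R qn nx x cur tl (nx ptr) l (steps + 1) := by
  obtain ⟨d, rest, pre, rem, h1, h2, h3, h4, h5, h6, h7, h8, h9, h10⟩ := h
  cases rem with
  | nil => exact absurd h7 hp
  | cons s rem =>
    obtain ⟨rfl, h11, h12⟩ := h7
    refine ⟨d, rest, pre ++ [ptr], rem, h1, h2, h3, h4, h5, by simp [h6], h12, h8, ?_, ?_⟩
    · intro s hs'
      rcases List.mem_append.1 hs' with hs' | hs'
      · exact h9 s hs'
      · rw [List.mem_singleton.1 hs']; exact hs
    · simp [h10]; omega

theorem Side.add (h : N.Side comp c R qn nx x cur tl ptr l steps) (hp : ptr ≠ 0)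
    (hc : comp (N.dst ptr) = c) (hR : R (N.dst ptr)) (hl : N.dst ptr ∉ l) :
    N.Side comp c R (Function.update qn tl (N.dst ptr)) nx x cur (N.dst ptr) (nx ptr)
      (l ++ [N.dst ptr]) (steps + 1) := by
  have hlt := N.dst_lt ptr
  obtain ⟨d, rest, pre, rem, h1, h2, h3, h4, h5, h6, h7, h8, h9, h10⟩ := h
  cases rem with
  | nil => exact absurd h7 hp
  | cons s rem =>
    obtain ⟨rfl, h11, h12⟩ := h7
    refine ⟨d, rest ++ [N.dst ptr], pre ++ [ptr], rem, by simp [h1], ?_, h3.append h4 _, ?_, ?_,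
      by simp [h6], h12, fun v hv s hs h13 h14 => List.mem_append_left _ (h8 v hv s hs h13 h14),
      ?_, ?_⟩
    · cases l with
      | nil => simp at h2
      | cons y l => simpa using h2
    · rw [List.nodup_append]
      refine ⟨h4, List.nodup_singleton _, ?_⟩
      intro y hy z hz
      rw [List.mem_singleton.1 hz]
      exact fun hyz => hl (hyz ▸ hy)
    · intro v hv
      rcases List.mem_append.1 hv with hv | hv
      · exact h5 v hv
      · rw [List.mem_singleton.1 hv]; exact ⟨hlt, hc, hR⟩
    · intro s hs' h13 h14
      rcases List.mem_append.1 hs' with hs' | hs'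
      · exact List.mem_append_left _ (h9 s hs' h13 h14)
      · rw [List.mem_singleton.1 hs']; simp
    · simp [h10]; omega

theorem Side.advance (h : N.Side comp c R qn nx x cur tl 0 l steps) (hne : cur ≠ tl)
    (hp : Chain nx ptr (N.L (qn cur))) :
    N.Side comp c R qn nx x (qn cur) tl ptr l (steps + 1) := by
  obtain ⟨d, rest, pre, rem, h1, h2, h3, h4, h5, h6, h7, h8, h9, h10⟩ := h
  have hrem : rem = [] := by
    cases rem with
    | nil => rfl
    | cons s rem => exact absurd h7.1.symm h7.2.1
  subst hrem
  rw [List.append_nil] at h6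
  obtain ⟨rest', rfl⟩ := (h1 ▸ h3).suffix.exists_rest hne
  refine ⟨d ++ [cur], rest', [], N.L (qn cur), by simp [h1], h2, h3, h4, h5, rfl, hp, ?_,
    by simp, ?_⟩
  · intro v hv
    rcases List.mem_append.1 hv with hv | hv
    · exact h8 v hv
    · rw [List.mem_singleton.1 hv, h6]; exact h9
  · simp [h10, wt, h6]; omega

/-- All classes are exhausted, so no slot leads from the found set to a further related class of the
cluster, and the steps account for the full weight. -/
theorem Side.finish (h : N.Side comp c R qn nx x tl tl 0 l steps) :
    (∀ v ∈ l, ∀ s ∈ N.L v, comp (N.dst s) = c → R (N.dst s) → N.dst s ∈ l) ∧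
      (l.map N.wt).sum = steps + 1 := by
  obtain ⟨d, rest, pre, rem, h1, h2, h3, h4, h5, h6, h7, h8, h9, h10⟩ := h
  have hrem : rem = [] := by
    cases rem with
    | nil => rfl
    | cons s rem => exact absurd h7.1.symm h7.2.1
  subst hrem
  rw [List.append_nil] at h6
  have hrest : rest = [] :=
    (h1 ▸ h3).suffix.rest_eq_nil ((h1 ▸ h4).of_append_right)
  subst hrest
  subst h1
  constructor
  · intro v hv
    rcases List.mem_append.1 hv with hv | hv
    · exact h8 v hv
    · rw [List.mem_singleton.1 hv, h6]; exact h9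
  · simp [h10, wt, h6]; omega

theorem Side.le_tot (h : N.Side comp c R qn nx x cur tl ptr l steps) :
    (l.map N.wt).sum ≤ N.tot := by
  rw [N.sum_map_wt h.prop.1 fun v hv => (h.prop.2 v hv).1]
  exact Finset.sum_le_sum fun u _ => by split <;> simp

/-- Two disjoint parts of a cluster. -/
theorem add_le_Wt {l' : List ℕ} (hl : l.Nodup) (hl' : l'.Nodup)
    (h : ∀ v ∈ l, v < N.nc ∧ comp v = c) (h' : ∀ v ∈ l', v < N.nc ∧ comp v = c)
    (hd : ∀ v ∈ l, v ∉ l') : (l.map N.wt).sum + (l'.map N.wt).sum ≤ N.Wt comp c := by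
  rw [N.sum_map_wt hl fun v hv => (h v hv).1, N.sum_map_wt hl' fun v hv => (h' v hv).1,
    ← Finset.sum_add_distrib]
  refine Finset.sum_le_sum fun u _ => ?_
  by_cases h1 : u ∈ l
  · simp [h1, hd u h1, (h u h1).2]
  · by_cases h2 : u ∈ l'
    · simp [h1, h2, (h' u h2).2]
    · simp [h1, h2]

end Net

end EdgeConn

/-! ### Two interleaved searches, and loops over the list that they find -/

namespace EdgeConn

open WordRAM

/-- Exchanges the registers of the two searches. -/
def swapSides : Cmd :=
  .seq (.assign 22 (.var 13)) <| .seq (.assign 13 (.var 17)) <| .seq (.assign 17 (.var 22)) <|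
  .seq (.assign 22 (.var 14)) <| .seq (.assign 14 (.var 18)) <| .seq (.assign 18 (.var 22)) <|
  .seq (.assign 22 (.var 15)) <| .seq (.assign 15 (.var 19)) <| .seq (.assign 19 (.var 22)) <|
  .seq (.assign 22 (.var 16)) <| .seq (.assign 16 (.var 20)) <| .assign 20 (.var 22)

theorem does_swapSides (w : ℕ) (s : State) : Does w swapSides s fun t s' =>
    t = 24 ∧ s'.arr = s.arr ∧ s'.high = s.high ∧
    (s'.var 13 = s.var 17 ∧ s'.var 14 = s.var 18 ∧ s'.var 15 = s.var 19 ∧ s'.var 16 = s.var 20) ∧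
    (s'.var 17 = s.var 13 ∧ s'.var 18 = s.var 14 ∧ s'.var 19 = s.var 15 ∧ s'.var 20 = s.var 16) ∧
    s'.var 8 = s.var 8 ∧ s'.var 11 = s.var 11 ∧ s'.var 21 = s.var 21 := by
  simp [swapSides, does_seq, does_assign, Expr.eval, Expr.cost, State.high_setVar_low]

namespace Net

variable {n : ℕ} (N : Net n)

/-- The memory holds the edges, the representatives and the lists of incident edges. -/
structure Stored (s : State) : Prop where
  rep : ∀ a < N.nc, s.arr 8 a = N.rep a
  edge : ∀ i < N.h, s.arr 9 i = (N.E i).1 ∧ s.arr 10 i = (N.E i).2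
  adj : ∀ v < N.nc, Chain (s.arr 12) (s.arr 11 v) (N.L v)
  dst : ∀ v < N.nc, ∀ x ∈ N.L v, s.arr 13 x = N.dst x

variable {N}

theorem Stored.congr {s s' : State} (h : N.Stored s)
    (hz : ∀ z, 8 ≤ z → z ≤ 13 → s'.arr z = s.arr z) : N.Stored s' := by
  constructor
  · rw [hz 8 (by norm_num) (by norm_num)]; exact h.rep
  · rw [hz 9 (by norm_num) (by norm_num), hz 10 (by norm_num) (by norm_num)]; exact h.edge
  · rw [hz 12 (by norm_num) (by norm_num), hz 11 (by norm_num) (by norm_num)]; exact h.adj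
  · rw [hz 13 (by norm_num) (by norm_num)]; exact h.dst

variable (N)

/-- Two classes are `k`-edge-connected in the graph of the edges within clusters. -/
def Rel (k : ℕ) (comp : ℕ → ℕ) (u v : ℕ) : Prop := Reach k (N.cur comp) (N.rep u) (N.rep v)

theorem simple_cur (comp : ℕ → ℕ) : Simple (N.cur comp) := N.simple.mono (live_subset _ _)

end Net

/-- One step of the active search, followed by an exchange of the searches. -/
def searchStep (D : Decremental) : Cmd :=
  .cond (.var 16)
    (.seq (.seq (.assign 23 (.load 13 (.var 16))) <| .seq (.assign 16 (.load 12 (.var 16))) <|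
      .cond (.op .eq (.load 14 (.var 23)) (.var 11))
        (.cond (.op .eq (.load 15 (.var 23)) (.var 8)) .skip
          (.seq (D.queryCmd (.load 8 (.var 13)) (.load 8 (.var 23)))
            (.cond (.var 100)
              (.seq (.store 15 (.var 23) (.var 8)) <| .seq (.store 16 (.var 15) (.var 23)) <|
                .assign 15 (.var 23))
              .skip)))
        .skip) swapSides)
    (.cond (.op .eq (.var 14) (.var 15)) (.assign 21 (.lit 0))
      (.seq (.assign 14 (.load 16 (.var 14))) <| .seq (.assign 16 (.load 11 (.var 14))) swapSides))

/-- Two interleaved searches, until one of them finishes. -/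
def search (D : Decremental) : Cmd := .loop (.var 21) (searchStep D)

section Search

variable {n : ℕ} {N : Net n} {D : Decremental} {w k : ℕ} {tq : ℝ} {B c ncl r t : ℕ}
  {comp nx : ℕ → ℕ}

/-- The invariant of the interleaved searches from `r` and `t`. -/
structure SearchInv (N : Net n) (D : Decremental) (w k : ℕ) (tq : ℝ) (B c ncl r t : ℕ)
    (comp nx : ℕ → ℕ) (s : State) (l l' : List ℕ) (σ σ' : ℕ) : Prop where
  vars : s.var 8 = ncl ∧ s.var 11 = c
  comp_eq : s.arr 14 = comp
  nx_eq : s.arr 12 = nx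
  stored : N.Stored s
  ready : D.Ready w k tq (graphOf (N.cur comp)) B s.high
  sources : s.var 13 = r ∧ s.var 17 = t ∨ s.var 13 = t ∧ s.var 17 = r
  side : N.Side comp c (N.Rel k comp (s.var 13)) (s.arr 16) nx (s.var 13) (s.var 14) (s.var 15)
    (s.var 16) l σ
  side' : N.Side comp c (N.Rel k comp (s.var 17)) (s.arr 16) nx (s.var 17) (s.var 18) (s.var 19)
    (s.var 20) l' σ'
  mark : ∀ v < N.nc, s.arr 15 v = ncl ↔ v ∈ l ∨ v ∈ l'
  mark_le : ∀ v < N.nc, s.arr 15 v ≤ ncl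

/-- The searches explore equivalence classes of `Rel`, and their sources are not equivalent. Hence
they can share the links in array `16` and the marks in array `15`. -/
theorem SearchInv.disjoint {s : State} {l l' : List ℕ} {σ σ' : ℕ}
    (h : SearchInv N D w k tq B c ncl r t comp nx s l l' σ σ') (hrt : ¬N.Rel k comp r t) :
    (∀ v, N.Rel k comp (s.var 13) v → v ∉ l') ∧ ∀ v ∈ l, v ∉ l' := by
  have h1 : ∀ v, N.Rel k comp (s.var 13) v → v ∉ l' := by
    intro v hv hv'
    have h2 := (h.side'.prop.2 v hv').2.2
    have h3 : N.Rel k comp (s.var 13) (s.var 17) := Reach.trans hv (Reach.symm h2)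
    rcases h.sources with ⟨h4, h5⟩ | ⟨h4, h5⟩
    · rw [h4, h5] at h3; exact hrt h3
    · rw [h4, h5] at h3; exact hrt (Reach.symm h3)
  exact ⟨h1, fun v hv => h1 v (h.side.prop.2 v hv).2.2⟩

theorem SearchInv.swap {s s' : State} {l l' : List ℕ} {σ σ' : ℕ}
    (h : SearchInv N D w k tq B c ncl r t comp nx s l l' σ σ')
    (harr : s'.arr = s.arr) (hhigh : s'.high = s.high)
    (h1 : s'.var 13 = s.var 17 ∧ s'.var 14 = s.var 18 ∧ s'.var 15 = s.var 19 ∧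
      s'.var 16 = s.var 20)
    (h2 : s'.var 17 = s.var 13 ∧ s'.var 18 = s.var 14 ∧ s'.var 19 = s.var 15 ∧
      s'.var 20 = s.var 16)
    (h3 : s'.var 8 = s.var 8 ∧ s'.var 11 = s.var 11) :
    SearchInv N D w k tq B c ncl r t comp nx s' l' l σ' σ := by
  obtain ⟨h11, h12, h13, h14⟩ := h1
  obtain ⟨h21, h22, h23, h24⟩ := h2
  refine ⟨by rw [h3.1, h3.2]; exact h.vars, by rw [harr]; exact h.comp_eq,
    by rw [harr]; exact h.nx_eq, h.stored.congr fun z _ _ => by rw [harr], by rw [hhigh]; exact h.ready,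
    by rw [h11, h21]; exact h.sources.symm.imp And.symm And.symm, ?_, ?_, ?_, ?_⟩
  · rw [h11, h12, h13, h14, harr]; exact h.side'
  · rw [h21, h22, h23, h24, harr]; exact h.side
  · rw [harr]; intro v hv; rw [h.mark v hv, or_comm]
  · rw [harr]; exact h.mark_le

/-- The side in registers `13` to `16` does one elementary step, with at most one query, and the
sides are exchanged. When the active side is finished there is no exchange, so its registers
describe the part to split off. -/
theorem does_searchStep {s : State} {l l' : List ℕ} {σ σ' : ℕ}
    (h : SearchInv N D w k tq B c ncl r t comp nx s l l' σ σ') (hrt : ¬N.Rel k comp r t)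
    (hw : 1 < 2 ^ w) (h21 : s.var 21 = 1) :
    Does w (searchStep D) s fun τ s' => τ ≤ ⌊tq⌋₊ + 70 ∧
      ((s'.var 21 = 1 ∧ ∃ l₁, SearchInv N D w k tq B c ncl r t comp nx s' l' l₁ σ' (σ + 1)) ∨
      (s'.var 21 = 0 ∧ SearchInv N D w k tq B c ncl r t comp nx s' l l' σ σ' ∧ s'.var 16 = 0 ∧
        s'.var 14 = s'.var 15)) := by
  have hone : 1 % 2 ^ w = 1 := Nat.mod_eq_of_lt hw
  obtain ⟨hv8, hv11⟩ := h.vars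
  obtain ⟨hdis, -⟩ := h.disjoint hrt
  have hcurlt := (h.side.prop.2 _ h.side.mem.2.1).1
  have hxlt := (h.side.prop.2 _ h.side.mem.1).1
  have hset : ∀ x, s.setVar x (s.var x) = s := fun x => by
    simp [State.setVar]
  unfold searchStep
  rw [does_cond]
  by_cases hp : s.var 16 = 0
  · rw [if_pos (by simpa [Expr.eval] using hp), does_cond]
    by_cases hct : s.var 14 = s.var 15
    · rw [if_neg (by simp [Expr.eval, Op.eval, hct, hone]), does_assign]
      refine ⟨by simp only [Expr.cost]; omega, Or.inr ⟨by simp [Expr.eval], ?_, by simp [hp],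
        by simp [hct]⟩⟩
      exact ⟨by simp [hv8, hv11], h.comp_eq, h.nx_eq, h.stored.congr fun z _ _ => rfl,
        by rw [State.high_setVar_low (by norm_num)]; exact h.ready, by simpa using h.sources,
        by simpa using h.side, by simpa using h.side', h.mark, h.mark_le⟩
    · rw [if_pos (by simp [Expr.eval, Op.eval, hct]), does_seq, does_assign, does_seq, does_assign]
      refine (does_swapSides w _).mono ?_
      rintro τ s' ⟨rfl, harr, hhigh, h1, h2, h3, h4, h5⟩
      refine ⟨by simp only [Expr.cost]; omega, Or.inl ⟨by rw [h5]; simp [h21], l, ?_⟩⟩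
      refine SearchInv.swap (s := (s.setVar 14 (s.arr 16 (s.var 14))).setVar 16
        (s.arr 11 (s.arr 16 (s.var 14)))) ?_ (by simpa [Expr.eval] using harr)
        (by simpa [Expr.eval] using hhigh)
        (by simpa [Expr.eval] using h1) (by simpa [Expr.eval] using h2)
        (by simpa [Expr.eval] using ⟨h3, h4⟩)
      have hadv := (hp ▸ h.side).advance (ptr := s.arr 11 (s.arr 16 (s.var 14))) hct
      have hq : s.arr 16 (s.var 14) < N.nc := by
        obtain ⟨d, rest, pre, rem, e1, -, e3, -, e5, -⟩ := h.side
        obtain ⟨rest', hr'⟩ := (e1 ▸ e3).suffix.exists_rest hct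
        exact (e5 _ (by simp [e1, hr'])).1
      refine ⟨by simp [hv8, hv11], h.comp_eq, h.nx_eq, h.stored.congr fun z _ _ => rfl,
        by rw [State.high_setVar_low (by norm_num), State.high_setVar_low (by norm_num)]
           exact h.ready,
        by simpa using h.sources, ?_, by simpa using h.side', h.mark, h.mark_le⟩
      have := hadv (by rw [← h.nx_eq]; exact h.stored.adj _ hq)
      simpa using this
  · rw [if_neg (by simpa [Expr.eval] using hp), does_seq]
    have hpm := h.side.ptr_mem hp
    have hdst := h.stored.dst _ hcurlt _ hpm
    have hdlt := N.dst_lt (s.var 16)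
    suffices hs : Does w _ s (fun t₁ s₁ => t₁ ≤ ⌊tq⌋₊ + 44 ∧ s₁.var 21 = 1 ∧
        ∃ l₁, SearchInv N D w k tq B c ncl r t comp nx s₁ l₁ l' (σ + 1) σ') by
      refine hs.mono ?_
      rintro t₁ s₁ ⟨ht, h21', l₁, hI⟩
      refine (does_swapSides w s₁).mono ?_
      rintro τ s' ⟨rfl, harr, hhigh, h1, h2, h3, h4, h5⟩
      exact ⟨by simp only [Expr.cost]; omega,
        Or.inl ⟨h5.trans h21', l₁, hI.swap harr hhigh h1 h2 ⟨h3, h4⟩⟩⟩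
    rw [does_seq, does_assign, does_seq, does_assign, does_cond]
    have he1 : Expr.eval w s (.load 13 (.var 16)) = N.dst (s.var 16) := by simp [Expr.eval, hdst]
    rw [he1]
    have he2 : Expr.eval w (s.setVar 23 (N.dst (s.var 16))) (.load 12 (.var 16)) =
        nx (s.var 16) := by simp [Expr.eval, h.nx_eq]
    rw [he2]
    set s₂ := (s.setVar 23 (N.dst (s.var 16))).setVar 16 (nx (s.var 16)) with hs₂
    have hhigh2 : s₂.high = s.high := by
      rw [hs₂, State.high_setVar_low (by norm_num), State.high_setVar_low (by norm_num)]
    have hv2 : ∀ z, z ≠ 16 → z ≠ 23 → s₂.var z = s.var z := fun z h1 h2 => by simp [hs₂, h1, h2]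
    have hv216 : s₂.var 16 = nx (s.var 16) := by simp [hs₂]
    have hv223 : s₂.var 23 = N.dst (s.var 16) := by simp [hs₂]
    have harr2 : s₂.arr = s.arr := rfl
    clear_value s₂
    -- All cases but one pass over the slot without changing the list.
    have hskip : (comp (N.dst (s.var 16)) = c → N.Rel k comp (s.var 13) (N.dst (s.var 16)) →
        N.dst (s.var 16) ∈ l) → SearchInv N D w k tq B c ncl r t comp nx s₂ l l' (σ + 1) σ' := by
      intro hmem
      have := h.side.skip hp hmem
      exact ⟨by simp [hv2, hv8, hv11], by rw [harr2, h.comp_eq], by rw [harr2, h.nx_eq],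
        h.stored.congr fun z _ _ => by rw [harr2], by rw [hhigh2]; exact h.ready,
        by simpa [hv2] using h.sources, by simpa [hv2, hv216, harr2] using this,
        by simpa [hv2, harr2] using h.side', by rw [harr2]; exact h.mark,
        by rw [harr2]; exact h.mark_le⟩
    by_cases hcc : comp (N.dst (s.var 16)) = c
    · rw [if_neg (by simp [Expr.eval, Op.eval, hv223, hv2, harr2, h.comp_eq, hcc, hv11, hone]),
        does_cond]
      -- A marked class was found by one of the searches; if by the other one, it is not related to
      -- this source.
      by_cases hm : s.arr 15 (N.dst (s.var 16)) = ncl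
      · rw [if_neg (by simp [Expr.eval, Op.eval, hv223, hv2, harr2, hm, hv8, hone]), does_skip]
        refine ⟨by simp only [Expr.cost]; omega, by simp [hv2, h21], l, hskip fun _ hR => ?_⟩
        rcases (h.mark _ hdlt).1 hm with hl | hl
        · exact hl
        · exact absurd hl (hdis _ hR)
      · rw [if_pos (by simp [Expr.eval, Op.eval, hv223, hv2, harr2, hm, hv8]), does_seq]
        have hnl : N.dst (s.var 16) ∉ l := fun hc => hm ((h.mark _ hdlt).2 (Or.inl hc))
        have hnl' : N.dst (s.var 16) ∉ l' := fun hc => hm ((h.mark _ hdlt).2 (Or.inr hc))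
        refine (does_queryCmd (N.simple_cur comp) (s := s₂) (B := B) (by rw [hhigh2]; exact h.ready)
          (u := N.rep (s.var 13)) (v := N.rep (N.dst (s.var 16))) ?_ ?_).mono ?_
        · simp [Expr.eval, hv2, harr2, h.stored.rep _ hxlt]
        · simp [Expr.eval, hv223, harr2, h.stored.rep _ hdlt]
        rintro τ₁ _ ⟨hτ₁, p, rfl, hpR, hpr⟩
        rw [does_cond]
        have h100 : Expr.eval w (s₂.withHigh p) (.var 100) = p.var 0 := by
          simp [Expr.eval, State.withHigh]
        simp only [Expr.cost] at hτ₁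
        by_cases hR : N.Rel k comp (s.var 13) (N.dst (s.var 16))
        · rw [if_neg (by rw [h100]; exact hpR.2 hR)]
          have hadd := h.side.add hp hcc hR hnl
          have htl' : s.var 15 ∉ l' := fun hc =>
            hdis _ (h.side.prop.2 _ h.side.mem.2.2).2.2 hc
          -- The link written belongs to a class that the other search has not found.
          have hs' := h.side'.congr (qn' := Function.update (s.arr 16) (s.var 15)
            (N.dst (s.var 16))) fun v hv =>
            Function.update_of_ne (show v ≠ s.var 15 by rintro rfl; exact htl' hv) _ _
          simp only [does_seq, does_assign, does_store]
          refine ⟨by simp only [Expr.cost]; omega, by simp [State.var_withHigh, hv2, h21],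
            l ++ [N.dst (s.var 16)], ?_⟩
          refine ⟨by simp [State.var_withHigh, hv2, hv8, hv11],
            by simp [State.arr_withHigh, harr2, h.comp_eq],
            by simp [State.arr_withHigh, harr2, h.nx_eq], h.stored.congr fun z h1 h2 => ?_, ?_,
            by simpa [State.var_withHigh, hv2] using h.sources, ?_, ?_, ?_, ?_⟩
          · have e1 : z ≠ 15 := by omega
            have e2 : z ≠ 16 := by omega
            simp [e1, e2, State.arr_withHigh (show z < 100 by omega), harr2]
          · rw [State.high_setVar_low (by norm_num), State.high_setArr_low (by norm_num),
              State.high_setArr_low (by norm_num), State.high_withHigh]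
            exact hpr
          · simpa [Expr.eval, State.var_withHigh, State.arr_withHigh, hv2, hv223, hv216, harr2]
              using hadd
          · simpa [Expr.eval, State.var_withHigh, State.arr_withHigh, hv2, hv223, hv216, harr2]
              using hs'
          · intro v hv
            by_cases hvd : v = N.dst (s.var 16)
            · simp [Expr.eval, State.var_withHigh, State.arr_withHigh, hv2, hv223, hvd, hv8]
            · simp [Expr.eval, State.var_withHigh, State.arr_withHigh, hv2, hv223, hvd, harr2,
                h.mark v hv]
          · intro v hv
            by_cases hvd : v = N.dst (s.var 16)
            · simp [Expr.eval, State.var_withHigh, State.arr_withHigh, hv2, hv223, hvd, hv8]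
            · simp [Expr.eval, State.var_withHigh, State.arr_withHigh, hv2, hv223, hvd, harr2,
                h.mark_le v hv]
        · rw [if_pos (by rw [h100]; by_contra hc; exact hR (hpR.1 hc)), does_skip]
          have hI := hskip fun _ hc => absurd hc hR
          refine ⟨by simp only [Expr.cost]; omega, by simp [State.var_withHigh, hv2, h21], l, ?_⟩
          exact ⟨by simpa [State.var_withHigh] using hI.vars,
            by simpa [State.arr_withHigh] using hI.comp_eq,
            by simpa [State.arr_withHigh] using hI.nx_eq,
            hI.stored.congr fun z h1 h2 => State.arr_withHigh (by omega),
            by rw [State.high_withHigh]; exact hpr,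
            by simpa [State.var_withHigh] using hI.sources,
            by simpa [State.var_withHigh, State.arr_withHigh] using hI.side,
            by simpa [State.var_withHigh, State.arr_withHigh] using hI.side',
            by simpa [State.arr_withHigh] using hI.mark,
            by simpa [State.arr_withHigh] using hI.mark_le⟩
    · rw [if_pos (by simp [Expr.eval, Op.eval, hv223, hv2, harr2, h.comp_eq, hcc, hv11]), does_skip]
      exact ⟨by simp only [Expr.cost]; omega, by simp [hv2, h21], l,
        hskip fun hc => absurd hc hcc⟩

/-- By alternation the loser has done at least as many steps as the winner, so it has found at least
the same weight elsewhere in the cluster. Hence the winner has at most half of the weight, and the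
time is proportional to the weight of the winner. -/
theorem does_search {s : State} (hw : 1 < 2 ^ w) (h21 : s.var 21 = 1) (hrt : ¬N.Rel k comp r t)
    (h : SearchInv N D w k tq B c ncl r t comp nx s [r] [t] 0 0) :
    Does w (search D) s fun τ s' => ∃ l l' σ σ', SearchInv N D w k tq B c ncl r t comp nx s' l l' σ σ' ∧
      (∀ v ∈ l, ∀ x ∈ N.L v, comp (N.dst x) = c → N.Rel k comp (s'.var 13) (N.dst x) →
        N.dst x ∈ l) ∧
      2 * (l.map N.wt).sum ≤ N.Wt comp c ∧
      τ ≤ 2 * (⌊tq⌋₊ + 73) * (l.map N.wt).sum + 2 ∧ Agree (searchStep D) s s' := by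
  -- The active side is never ahead and at most one step behind: `σ ≤ σ' ≤ σ + 1`.
  refine (does_loop (fun τ s => ∃ l l' σ σ', SearchInv N D w k tq B c ncl r t comp nx s l l' σ σ' ∧
    σ ≤ σ' ∧ σ' ≤ σ + 1 ∧
    ((s.var 21 = 1 ∧ τ ≤ (⌊tq⌋₊ + 73) * (σ + σ')) ∨
      (s.var 21 = 0 ∧ τ ≤ (⌊tq⌋₊ + 73) * (σ + σ' + 1) ∧ s.var 16 = 0 ∧ s.var 14 = s.var 15)))
    ((⌊tq⌋₊ + 73) * (2 * N.tot)) ⟨[r], [t], 0, 0, h, le_rfl, by omega, Or.inl ⟨h21, by simp⟩⟩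
    ?_ ?_).mono ?_
  · rintro τ s ⟨l, l', σ, σ', hI, h1, h2, h3⟩
    have h4 := hI.side.steps_lt.trans hI.side.le_tot
    have h5 := hI.side'.steps_lt.trans hI.side'.le_tot
    rcases h3 with ⟨-, h3⟩ | ⟨-, h3, -⟩ <;>
    exact h3.trans (Nat.mul_le_mul_left _ (by omega))
  · rintro τ s ⟨l, l', σ, σ', hI, h1, h2, h3⟩ - he
    have he : s.var 21 ≠ 0 := he
    obtain ⟨h21, hτ⟩ : s.var 21 = 1 ∧ τ ≤ (⌊tq⌋₊ + 73) * (σ + σ') := by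
      rcases h3 with h3 | h3
      · exact h3
      · exact absurd h3.1 he
    refine (does_searchStep hI hrt hw h21).mono ?_
    rintro τ' s' ⟨hτ', ⟨h4, l₁, h5⟩ | ⟨h4, h5, h6, h7⟩⟩
    · refine ⟨l', l₁, σ', σ + 1, h5, by omega, by omega, Or.inl ⟨h4, ?_⟩⟩
      simp only [Expr.cost]
      calc _ ≤ (⌊tq⌋₊ + 73) * (σ + σ') + (⌊tq⌋₊ + 73) := by omega
        _ = _ := by ring
    · refine ⟨l, l', σ, σ', h5, by omega, by omega, Or.inr ⟨h4, ?_, h6, h7⟩⟩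
      simp only [Expr.cost]
      calc _ ≤ (⌊tq⌋₊ + 73) * (σ + σ') + (⌊tq⌋₊ + 73) := by omega
        _ = _ := by ring
  · rintro τ s' ⟨τ', rfl, ⟨l, l', σ, σ', hI, h1, h2, h3⟩, he, hA⟩
    have he : s'.var 21 = 0 := he
    rcases h3 with ⟨h3, -⟩ | ⟨-, hτ, h16, h14⟩
    · omega
    have hside := hI.side
    rw [h16, h14] at hside
    obtain ⟨hcl, hsum⟩ := hside.finish
    have hsum' := hI.side'.steps_lt
    have := Net.add_le_Wt hI.side.prop.1 hI.side'.prop.1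
      (fun v hv => ⟨(hI.side.prop.2 v hv).1, (hI.side.prop.2 v hv).2.1⟩)
      (fun v hv => ⟨(hI.side'.prop.2 v hv).1, (hI.side'.prop.2 v hv).2.1⟩) (hI.disjoint hrt).2
    refine ⟨l, l', σ, σ', hI, hcl, by omega, ?_, hA⟩
    simp only [Expr.cost]
    have h6 : (⌊tq⌋₊ + 73) * (σ + σ' + 1) ≤ (⌊tq⌋₊ + 73) * (2 * (l.map N.wt).sum) :=
      Nat.mul_le_mul_left _ (by omega)
    calc _ ≤ (⌊tq⌋₊ + 73) * (2 * (l.map N.wt).sum) + 2 := by omega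
      _ = _ := by ring

end Search

/-- Runs `c` with each element of the list that starts at `var 13`, ends at `var 15` and is linked
by array `16`, in register `14`. -/
def Cmd.forList (c : Cmd) : Cmd :=
  .seq (.assign 21 (.lit 1)) <| .seq (.assign 14 (.var 13)) <|
    -- The end is recognised by the last element, as `0` is a valid class. The `skip` gives both
    -- branches the same cost, so each round has overhead `9`.
    .loop (.var 21) (.seq c (.cond (.op .eq (.var 14) (.var 15)) (.seq .skip (.assign 21 (.lit 0)))
      (.assign 14 (.load 16 (.var 14)))))

theorem does_forList {w : ℕ} {c : Cmd} {s₀ : State} {l : List ℕ} (Inv : List ℕ → ℕ → State → Prop)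
    (T : ℕ) (hw : 1 < 2 ^ w) (h14 : c.KeepsVar 14) (h15 : c.KeepsVar 15) (h21 : c.KeepsVar 21)
    (h16 : c.KeepsArr 16) (hhead : l.head? = some (s₀.var 13))
    (hlink : Linked (s₀.arr 16) (s₀.var 15) l) (hl : l.Nodup)
    (hst : ∀ d τ s z, Inv d τ s → Inv d τ (s.setVar 14 z) ∧ Inv d τ (s.setVar 21 z))
    (h0 : Inv [] 0 s₀) (hT : ∀ d τ s, Inv d τ s → d <+: l → τ ≤ T)
    (step : ∀ d v rest τ s, l = d ++ v :: rest → Inv d τ s → s.var 14 = v →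
      (∀ z, z ≠ 14 → z ≠ 21 → c.KeepsVar z → s.var z = s₀.var z) →
      (∀ a, c.KeepsArr a → s.arr a = s₀.arr a) →
      Does w c s fun t s' => Inv (d ++ [v]) (τ + t + 9) s') :
    Does w (Cmd.forList c) s₀ fun t s' => ∃ τ, t = τ + 6 ∧ Inv l τ s' ∧
      (∀ z, z ≠ 14 → z ≠ 21 → c.KeepsVar z → s'.var z = s₀.var z) ∧
      (∀ a, c.KeepsArr a → s'.arr a = s₀.arr a) := by
  have hone : 1 % 2 ^ w = 1 := Nat.mod_eq_of_lt hw
  unfold Cmd.forList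
  rw [does_seq, does_assign, does_seq, does_assign]
  simp only [Expr.eval, hone]
  set s₁ := (s₀.setVar 21 1).setVar 14 ((s₀.setVar 21 1).var 13) with hs₁
  have hs1v : ∀ z, z ≠ 14 → z ≠ 21 → s₁.var z = s₀.var z := fun z h1 h2 => by simp [hs₁, h1, h2]
  have hI1 : Inv [] 0 s₁ := (hst _ _ _ _ (hst _ _ _ _ h0).2).1
  have h114 : s₁.var 14 = s₀.var 13 := by simp [hs₁]
  have h121 : s₁.var 21 = 1 := by simp [hs₁]
  have hs1a : s₁.arr = s₀.arr := rfl
  clear_value s₁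
  set body : Cmd := .seq c (.cond (.op .eq (.var 14) (.var 15)) (.seq .skip (.assign 21 (.lit 0)))
      (.assign 14 (.load 16 (.var 14)))) with hbody
  have hkv : ∀ z, z ≠ 14 → z ≠ 21 → c.KeepsVar z → body.KeepsVar z := fun z h1 h2 h3 => by
    simp [hbody, Cmd.KeepsVar, h1, h2, h3]
  have hka : ∀ a, c.KeepsArr a → body.KeepsArr a := fun a h => by
    simp [hbody, Cmd.KeepsArr, h]
  refine (does_loop (s₀ := s₁) (fun τ s =>
    (s.var 21 = 1 ∧ ∃ d rest, l = d ++ s.var 14 :: rest ∧ Inv d τ s) ∨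
      (s.var 21 = 0 ∧ Inv l τ s)) T ?_ ?_ ?_).mono ?_
  · refine Or.inl ⟨h121, ?_⟩
    cases l with
    | nil => simp at hhead
    | cons x l =>
      refine ⟨[], l, ?_, hI1⟩
      rw [h114]
      simpa using hhead
  · rintro τ s (⟨-, d, rest, rfl, h⟩ | ⟨-, h⟩)
    · exact hT _ _ _ h (List.prefix_append _ _)
    · exact hT _ _ _ h List.prefix_rfl
  · rintro τ s hI hA he
    have he : s.var 21 ≠ 0 := he
    rcases hI with ⟨h1, d, rest, hd, hI⟩ | ⟨h1, -⟩
    swap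
    · exact absurd h1 he
    have hfv : ∀ z, z ≠ 14 → z ≠ 21 → c.KeepsVar z → s.var z = s₀.var z := fun z h1 h2 h3 =>
      (hA.1 z (hkv z h1 h2 h3)).trans (hs1v z h1 h2)
    have hfa : ∀ a, c.KeepsArr a → s.arr a = s₀.arr a := fun a h =>
      (hA.2 a (hka a h)).trans (by rw [hs1a])
    rw [hbody, does_seq]
    refine (step d _ rest τ s hd hI rfl hfv hfa).agree.mono ?_
    rintro t s' ⟨hI', hA'⟩
    have e14 : s'.var 14 = s.var 14 := hA'.1 14 h14
    have e15 : s'.var 15 = s₀.var 15 :=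
      (hA'.1 15 h15).trans (hfv 15 (by norm_num) (by norm_num) h15)
    have e21 : s'.var 21 = 1 := (hA'.1 21 h21).trans h1
    have e16 : s'.arr 16 = s₀.arr 16 := (hA'.2 16 h16).trans (hfa 16 h16)
    have hlk := (hd ▸ hlink).suffix
    have hnd := (hd ▸ hl).of_append_right
    rw [does_cond]
    by_cases hc : s.var 14 = s₀.var 15
    · rw [if_neg (by simp [Expr.eval, Op.eval, e14, e15, hc, hone]), does_seq, does_skip, does_assign]
      refine Or.inr ⟨by simp [Expr.eval], (hst _ _ _ _ ?_).2⟩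
      rw [hc] at hlk hnd hd hI'
      rw [hlk.rest_eq_nil hnd] at hd
      rw [hd]
      convert hI' using 1
      simp only [Expr.cost]; omega
    · rw [if_pos (by simp [Expr.eval, Op.eval, e14, e15, hc]), does_assign]
      obtain ⟨rest', hr⟩ := hlk.exists_rest hc
      refine Or.inl ⟨by simpa using e21, d ++ [s.var 14], rest', ?_, (hst _ _ _ _ ?_).1⟩
      · rw [hd, hr]; simp [Expr.eval, e14, e16]
      · convert hI' using 1
        simp only [Expr.cost]; omega
  · rintro t s' ⟨τ, rfl, hI, he, hA⟩
    have he : s'.var 21 = 0 := he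
    rcases hI with ⟨h1, -⟩ | ⟨-, hI⟩
    · omega
    refine ⟨τ, by simp only [Expr.cost]; omega, hI, fun z h1 h2 h3 =>
      (hA.1 z (hkv z h1 h2 h3)).trans (hs1v z h1 h2), fun a h =>
      (hA.2 a (hka a h)).trans (by rw [hs1a])⟩

end EdgeConn

namespace EdgeConn

open WordRAM

/-! ### The edges that a split removes -/

namespace Net

variable {n : ℕ} (N : Net n)

/-- The class that owns a slot. -/
def own (s : ℕ) : ℕ := src N.a N.b s

theorem own_eq {v s : ℕ} (h : s ∈ N.L v) : N.own s = v := by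
  obtain ⟨i, hi, hne, ⟨rfl, rfl⟩ | ⟨rfl, rfl⟩⟩ := N.mem_L.1 h
  · rw [own, src_odd]
  · rw [own, src_even]

theorem slot_inj {v s s' : ℕ} (h : s ∈ N.L v) (h' : s' ∈ N.L v) (he : (s - 1) / 2 = (s' - 1) / 2) :
    s = s' := by
  obtain ⟨i, hi, hne, h⟩ := N.mem_L.1 h
  obtain ⟨j, hj, hne', h'⟩ := N.mem_L.1 h'
  have hij : i = j := by omega
  subst hij
  rcases h with ⟨rfl, h1⟩ | ⟨rfl, h1⟩ <;> rcases h' with ⟨rfl, h2⟩ | ⟨rfl, h2⟩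
  · rfl
  · exact absurd (h1.trans h2.symm) hne
  · exact absurd (h2.trans h1.symm) hne
  · rfl

/-- The edges of the slots in `sl` that lead to the cluster `c`. -/
def dels (comp' : ℕ → ℕ) (c : ℕ) (sl : List ℕ) : Finset (Fin n × Fin n) :=
  ((sl.filter fun s => comp' (N.dst s) = c).map fun s => N.E ((s - 1) / 2)).toFinset

variable {N} {comp comp' : ℕ → ℕ} {c new : ℕ} {l sl : List ℕ}

theorem mem_dels {p : Fin n × Fin n} :
    p ∈ N.dels comp' c sl ↔ ∃ s ∈ sl, comp' (N.dst s) = c ∧ N.E ((s - 1) / 2) = p := by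
  simp [dels, and_assoc]

theorem dels_append_of_ne {s : ℕ} (h : comp' (N.dst s) ≠ c) :
    N.dels comp' c (sl ++ [s]) = N.dels comp' c sl := by
  simp [dels, h]

theorem sdiff_dels_append {I : Finset (Fin n × Fin n)} {s : ℕ} (h : comp' (N.dst s) = c) :
    I \ N.dels comp' c (sl ++ [s]) = (I \ N.dels comp' c sl).erase (N.E ((s - 1) / 2)) := by
  ext p
  simp only [Finset.mem_sdiff, mem_dels, Finset.mem_erase, List.mem_append, List.mem_singleton]
  constructor
  · rintro ⟨h1, h2⟩
    exact ⟨fun hp => h2 ⟨s, Or.inr rfl, h, hp.symm⟩, h1,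
      fun ⟨x, hx, hx'⟩ => h2 ⟨x, Or.inl hx, hx'⟩⟩
  · rintro ⟨h1, h2, h3⟩
    refine ⟨h2, ?_⟩
    rintro ⟨x, hx | rfl, hx', rfl⟩
    · exact h3 ⟨x, hx, hx', rfl⟩
    · exact h1 rfl

section Split

variable (hc : ∀ v ∈ l, comp v = c) (hcn : c ≠ new)
  (hcomp' : ∀ v, comp' v = if v ∈ l then new else comp v)

-- Every edge to be deleted has one end in `l` and the other in the rest of `c`. Only its slot at
-- the end in `l` is visited, so it is deleted once and is still present at that moment.
include hc hcn hcomp' in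
theorem mem_sdiff_dels {v s : ℕ} (hv : v ∈ l) (hs : s ∈ N.L v) (hsl : s ∉ sl)
    (hown : ∀ x ∈ sl, ∃ u ∈ l, x ∈ N.L u) (hd : comp' (N.dst s) = c) :
    N.E ((s - 1) / 2) ∈ N.cur comp \ N.dels comp' c sl := by
  have hdl : ∀ x, comp' (N.dst x) = c → N.dst x ∉ l ∧ comp (N.dst x) = c := by
    intro x hx
    rw [hcomp'] at hx
    by_cases h : N.dst x ∈ l
    · rw [if_pos h] at hx; exact absurd hx.symm hcn
    · rw [if_neg h] at hx; exact ⟨h, hx⟩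
  obtain ⟨h1, h2⟩ := N.ends hs
  obtain ⟨h0, h00, hlt⟩ := N.slot_lt hs
  rw [Finset.mem_sdiff]
  constructor
  · rw [cur, mem_live]
    refine ⟨N.mem_edges.2 ⟨_, hlt, rfl⟩, ?_⟩
    change comp (N.a _) = comp (N.b _)
    rcases h2 with ⟨h3, h4⟩ | ⟨h3, h4⟩ <;> rw [h3, h4, hc v hv, (hdl s hd).2]
  · rw [mem_dels]
    rintro ⟨x, hx, hxc, hxe⟩
    obtain ⟨u, hu, hxu⟩ := hown x hx
    obtain ⟨-, -, hlt'⟩ := N.slot_lt hxu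
    have hij := N.inj _ hlt' _ hlt hxe
    obtain ⟨h5, h6⟩ := N.ends hxu
    rw [hij] at h6
    -- Two slots of one edge, both owned by classes of `l` and both leading out of `l`, have the
    -- same owner.
    have huv : u = v := by
      have e1 := (hdl s hd).1
      have e2 := (hdl x hxc).1
      rcases h2 with ⟨h3, h4⟩ | ⟨h3, h4⟩ <;> rcases h6 with ⟨h7, h8⟩ | ⟨h7, h8⟩
      · exact h7.symm.trans h3
      · rw [h7] at h3; exact absurd (h3 ▸ hv) e2
      · rw [h8] at h4; exact absurd (h4 ▸ hv) e2
      · exact h8.symm.trans h4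
    subst huv
    exact hsl (N.slot_inj hxu hs hij ▸ hx)

-- When all slots of the new cluster are done, the graph of the decremental algorithm is again the
-- graph of the edges within clusters.
include hc hcn hcomp' in
theorem sdiff_dels_all (hnew : ∀ v < N.nc, comp v ≠ new) :
    N.cur comp \ N.dels comp' c (l.flatMap N.L) = N.cur comp' := by
  ext p
  rw [Finset.mem_sdiff, cur, cur, mem_live, mem_live, mem_dels]
  constructor
  · rintro ⟨⟨hp, he⟩, hd⟩
    refine ⟨hp, ?_⟩
    obtain ⟨i, hi, rfl⟩ := N.mem_edges.1 hp
    change comp (N.a i) = comp (N.b i) at he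
    change comp' (N.a i) = comp' (N.b i)
    rw [hcomp', hcomp']
    by_cases h1 : N.a i ∈ l <;> by_cases h2 : N.b i ∈ l
    · simp [h1, h2]
    · exfalso
      obtain ⟨⟨s, hs, hsi, hsd⟩, -⟩ := N.exists_slot hi fun hc => h2 (hc ▸ h1)
      refine hd ⟨s, List.mem_flatMap.2 ⟨_, h1, hs⟩, ?_, by rw [hsi]⟩
      rw [hsd, hcomp', if_neg h2, ← he, hc _ h1]
    · exfalso
      obtain ⟨-, s, hs, hsi, hsd⟩ := N.exists_slot hi fun hc => h1 (hc ▸ h2)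
      refine hd ⟨s, List.mem_flatMap.2 ⟨_, h2, hs⟩, ?_, by rw [hsi]⟩
      rw [hsd, hcomp', if_neg h1, he, hc _ h2]
    · simp [h1, h2, he]
  · rintro ⟨hp, he⟩
    obtain ⟨i, hi, rfl⟩ := N.mem_edges.1 hp
    change comp' (N.a i) = comp' (N.b i) at he
    rw [hcomp', hcomp'] at he
    have ha := hnew _ (N.a_lt i)
    have hb := hnew _ (N.b_lt i)
    have hiff : N.a i ∈ l ↔ N.b i ∈ l := by
      by_cases h1 : N.a i ∈ l <;> by_cases h2 : N.b i ∈ l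
      · simp [h1, h2]
      · simp [h1, h2] at he; exact absurd he.symm hb
      · simp [h1, h2] at he; exact absurd he ha
      · simp [h1, h2]
    refine ⟨⟨hp, ?_⟩, ?_⟩
    · change comp (N.a i) = comp (N.b i)
      by_cases h1 : N.a i ∈ l
      · rw [hc _ h1, hc _ (hiff.1 h1)]
      · rwa [if_neg h1, if_neg fun h => h1 (hiff.2 h)] at he
    · rintro ⟨s, hs, hsc, hse⟩
      obtain ⟨u, hu, hsu⟩ := List.mem_flatMap.1 hs
      obtain ⟨-, -, hlt⟩ := N.slot_lt hsu
      have hij := N.inj _ hlt _ hi hse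
      obtain ⟨-, h6⟩ := N.ends hsu
      rw [hij] at h6
      have hdl : N.dst s ∉ l := by
        intro h
        rw [hcomp', if_pos h] at hsc
        exact hcn hsc.symm
      rcases h6 with ⟨h7, h8⟩ | ⟨h7, h8⟩
      · rw [h7, h8] at hiff; exact hdl (hiff.1 hu)
      · rw [h7, h8] at hiff; exact hdl (hiff.2 hu)

end Split

end Net

/-! ### A stack in an array -/

/-- The cells of `f` hold the stack `W`. -/
def Stack (f : ℕ → ℕ) : List ℕ → Prop
  | [] => True
  | t :: W => f W.length = t ∧ Stack f W

theorem Stack.update {f : ℕ → ℕ} {W : List ℕ} (h : Stack f W) {i v : ℕ} (hi : W.length ≤ i) :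
    Stack (Function.update f i v) W := by
  induction W with
  | nil => trivial
  | cons t W ih =>
    simp only [List.length_cons] at hi
    exact ⟨by rw [Function.update_of_ne (by omega)]; exact h.1, ih h.2 (by omega)⟩

theorem Stack.push {f : ℕ → ℕ} {W : List ℕ} (h : Stack f W) (v : ℕ) :
    Stack (Function.update f W.length v) (v :: W) :=
  ⟨by simp, h.update le_rfl⟩

/-! ### Deleting the edges that leave a new cluster -/

/-- Handles the slot in register `16` of the class in register `14`. -/
def deleteSlot (D : Decremental) : Cmd :=
  .seq (.assign 23 (.load 13 (.var 16))) <|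
  .seq (.cond (.op .eq (.load 14 (.var 23)) (.var 11))
    (.seq (.assign 24 (.op .div (.op .sub (.var 16) (.lit 1)) (.lit 2))) <|
      .seq (D.deleteCmd (.load 9 (.var 24)) (.load 10 (.var 24))) <|
      .seq (.store 17 (.var 9) (.var 23)) <| .seq (.assign 9 (.op .add (.var 9) (.lit 1))) <|
      .seq (.store 17 (.var 9) (.var 14)) (.assign 9 (.op .add (.var 9) (.lit 1))))
    .skip) <|
  .assign 16 (.load 12 (.var 16))

/-- Handles all slots of the class in register `14`. -/
def deleteSlots (D : Decremental) : Cmd :=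
  .seq (.assign 16 (.load 11 (.var 14))) (.loop (.var 16) (deleteSlot D))

section Deletion

variable {n : ℕ} {N : Net n} {D : Decremental} {w k : ℕ} {tq : ℝ} {c M : ℕ}
  {comp comp' : ℕ → ℕ} {l sl W : List ℕ}

/-- The invariant of the deletions after the slots in `sl`. -/
structure DelInv (N : Net n) (D : Decremental) (w k : ℕ) (tq : ℝ) (c M : ℕ) (comp comp' : ℕ → ℕ)
    (l W sl : List ℕ) (B : ℕ) (s : State) : Prop where
  ready : D.Ready w k tq (graphOf (N.cur comp \ N.dels comp' c sl)) B s.high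
  stack : ∃ W', Stack (s.arr 17) W' ∧ s.var 9 = W'.length ∧ (∀ a ∈ W, a ∈ W') ∧
    (∀ x ∈ sl, comp' (N.dst x) = c → N.own x ∈ W' ∧ N.dst x ∈ W') ∧ (∀ a ∈ W', a < N.nc) ∧
    W'.length + 2 * (N.cur comp \ N.dels comp' c sl).card ≤ M ∧
    W'.length ≤ W.length + 2 * sl.length

/-- `B` is the remaining deletion budget of the decremental algorithm; the bound on `t + B'`
separates it from the constant overhead. A deletion pushes two classes but removes one edge, so the
bound `M` on the stack pointer is kept. -/
theorem does_deleteSlot {s : State} {B v : ℕ} {new : ℕ}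
    (hc : ∀ v ∈ l, comp v = c) (hcn : c ≠ new)
    (hcomp' : ∀ v, comp' v = if v ∈ l then new else comp v) (hlt : ∀ v ∈ l, v < N.nc)
    (hM : M < 2 ^ w) (hh : 2 * N.h + 2 < 2 ^ w)
    (hI : DelInv N D w k tq c M comp comp' l W sl B s) (hst : N.Stored s) (h14 : s.arr 14 = comp')
    (h11 : s.var 11 = c) (hv14 : s.var 14 = v) (hv : v ∈ l) (hs : s.var 16 ∈ N.L v)
    (hsl : s.var 16 ∉ sl) (hown : ∀ x ∈ sl, ∃ u ∈ l, x ∈ N.L u) :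
    Does w (deleteSlot D) s fun t s' => ∃ B', t + B' ≤ B + 50 ∧
      DelInv N D w k tq c M comp comp' l W (sl ++ [s.var 16]) B' s' ∧
      s'.var 16 = s.arr 12 (s.var 16) := by
  have hone : 1 % 2 ^ w = 1 := Nat.mod_eq_of_lt (by omega)
  have htwo : 2 % 2 ^ w = 2 := Nat.mod_eq_of_lt (by omega)
  obtain ⟨hs0, hs1, hs2⟩ := N.slot_lt hs
  have hds := hst.dst v (hlt v hv) _ hs
  unfold deleteSlot
  rw [does_seq, does_assign, does_seq, does_cond]
  have e1 : Expr.eval w s (.load 13 (.var 16)) = N.dst (s.var 16) := by simp [Expr.eval, hds]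
  rw [e1]
  obtain ⟨W', hW1, hW2, hW3, hW4, hW5, hW6, hW7⟩ := hI.stack
  by_cases hd : comp' (N.dst (s.var 16)) = c
  · rw [if_neg (by simp [Expr.eval, Op.eval, h14, hd, h11, hone])]
    have hmem := Net.mem_sdiff_dels (N := N) hc hcn hcomp' hv hs hsl hown hd
    have hcard := Finset.card_erase_of_mem hmem
    have hpos := Finset.card_pos.2 ⟨_, hmem⟩
    have hsub : (s.var 16 + 2 ^ w - 1) % 2 ^ w = s.var 16 - 1 := by
      rw [show s.var 16 + 2 ^ w - 1 = (s.var 16 - 1) + 2 ^ w by omega, Nat.add_mod_right]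
      exact Nat.mod_eq_of_lt (by omega)
    rw [does_seq, does_assign, does_seq]
    have e2 : Expr.eval w (s.setVar 23 (N.dst (s.var 16)))
        (.op .div (.op .sub (.var 16) (.lit 1)) (.lit 2)) = (s.var 16 - 1) / 2 := by
      simp [Expr.eval, Op.eval, hone, htwo, hsub]
    rw [e2]
    have hedge := hst.edge _ hs2
    refine (does_deleteCmd (N.simple_cur comp |>.mono Finset.sdiff_subset) hmem (B := B) (k := k) (tq := tq) ?_ ?_
      ?_).mono ?_
    · rw [State.high_setVar_low (by norm_num), State.high_setVar_low (by norm_num)]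
      exact hI.ready
    · simp [Expr.eval, hedge.1]
    · simp [Expr.eval, hedge.2]
    rintro t s' ⟨t', p, rfl, ht', rfl, hr⟩
    have e3 : (W'.length + 1) % 2 ^ w = W'.length + 1 := Nat.mod_eq_of_lt (by omega)
    have e4 : (W'.length + 1 + 1) % 2 ^ w = W'.length + 2 := Nat.mod_eq_of_lt (by omega)
    simp only [does_seq, does_assign, does_store]
    refine ⟨B - t', by simp only [Expr.cost]; omega, ⟨?_, ?_⟩, ?_⟩
    · simp only [State.high_setVar_low, State.high_setArr_low, Nat.reduceLT, State.high_withHigh]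
      rw [Net.sdiff_dels_append hd]
      exact hr
    · refine ⟨N.own (s.var 16) :: N.dst (s.var 16) :: W', ?_, ?_, ?_, ?_, ?_, ?_, ?_⟩
      · have := (hW1.push (N.dst (s.var 16))).push (N.own (s.var 16))
        rw [N.own_eq hs] at this ⊢
        simpa [Expr.eval, Op.eval, State.var_withHigh, State.arr_withHigh, hone, hW2, e3, hv14]
          using this
      · simp [Expr.eval, Op.eval, State.var_withHigh, hone, hW2, e3, e4]
      · intro a ha; simp [hW3 a ha]
      · intro x hx hxc
        rcases List.mem_append.1 hx with hx | hx
        · simp [hW4 x hx hxc]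
        · rw [List.mem_singleton.1 hx]; simp
      · intro a ha
        simp only [List.mem_cons] at ha
        rcases ha with rfl | rfl | ha
        · rw [N.own_eq hs]; exact hlt v hv
        · exact N.dst_lt _
        · exact hW5 a ha
      · rw [Net.sdiff_dels_append hd, hcard]
        simp only [List.length_cons]
        omega
      · simp only [List.length_cons, List.length_append, List.length_nil]
        omega
    · simp [Expr.eval, State.var_withHigh, State.arr_withHigh]
  · rw [if_pos (by simp [Expr.eval, Op.eval, h14, hd, h11]), does_skip, does_assign]
    refine ⟨B, by simp only [Expr.cost]; omega, ⟨?_, ?_⟩, by simp [Expr.eval]⟩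
    · rw [State.high_setVar_low (by norm_num), State.high_setVar_low (by norm_num),
        Net.dels_append_of_ne hd]
      exact hI.ready
    · refine ⟨W', by simpa using hW1, by simpa using hW2, hW3, ?_, hW5, ?_, ?_⟩
      · intro x hx hxc
        rcases List.mem_append.1 hx with hx | hx
        · exact hW4 x hx hxc
        · rw [List.mem_singleton.1 hx] at hxc; exact absurd hxc hd
      · rw [Net.dels_append_of_ne hd]; exact hW6
      · simp only [List.length_append]; omega

theorem does_deleteSlots {s : State} {B v : ℕ} {new : ℕ}
    (hc : ∀ v ∈ l, comp v = c) (hcn : c ≠ new)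
    (hcomp' : ∀ v, comp' v = if v ∈ l then new else comp v) (hlt : ∀ v ∈ l, v < N.nc)
    (hM : M < 2 ^ w) (hh : 2 * N.h + 2 < 2 ^ w)
    (hI : DelInv N D w k tq c M comp comp' l W sl B s) (hst : N.Stored s) (h14 : s.arr 14 = comp')
    (h11 : s.var 11 = c) (hv14 : s.var 14 = v) (hv : v ∈ l)
    (hsl : ∀ x ∈ N.L v, x ∉ sl) (hown : ∀ x ∈ sl, ∃ u ∈ l, x ∈ N.L u) :
    Does w (deleteSlots D) s fun t s' => ∃ B', t + B' ≤ B + 52 * (N.L v).length + 5 ∧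
      DelInv N D w k tq c M comp comp' l W (sl ++ N.L v) B' s' := by
  unfold deleteSlots
  rw [does_seq, does_assign]
  have e1 : Expr.eval w s (.load 11 (.var 14)) = s.arr 11 v := by simp [Expr.eval, hv14]
  rw [e1]
  have hkeep : ∀ z, 8 ≤ z → z ≤ 14 → (deleteSlot D).KeepsArr z := fun z h1 h2 => by
    have : z < 100 := by omega
    have h17 : z ≠ 17 := by omega
    simp [deleteSlot, Decremental.deleteCmd, Cmd.KeepsArr, Cmd.keepsArr_shift _ this, h17]
  have hkeepv : ∀ z, z = 11 ∨ z = 14 → (deleteSlot D).KeepsVar z := fun z hz => by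
    rcases hz with rfl | rfl <;>
    simp [deleteSlot, Decremental.deleteCmd, Cmd.KeepsVar, Cmd.keepsVar_shift]
  refine (does_loop (s₀ := s.setVar 16 (s.arr 11 v)) (fun τ s' => ∃ pre rem B',
    N.L v = pre ++ rem ∧ Chain (s.arr 12) (s'.var 16) rem ∧
    DelInv N D w k tq c M comp comp' l W (sl ++ pre) B' s' ∧ τ + B' ≤ B + 52 * pre.length)
    (B + 52 * (N.L v).length) ?_ ?_ ?_).mono ?_
  · refine ⟨[], N.L v, B, rfl, ?_, ?_, by simp⟩
    · simpa using hst.adj v (hlt v hv)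
    · rw [List.append_nil]
      refine ⟨?_, ?_⟩
      · rw [State.high_setVar_low (by norm_num)]; exact hI.ready
      · simpa using hI.stack
  · rintro τ s' ⟨pre, rem, B', h1, -, -, h2⟩
    rw [h1, List.length_append]
    omega
  · rintro τ s' ⟨pre, rem, B', h1, h2, h3, h4⟩ hA he
    have he : s'.var 16 ≠ 0 := he
    cases rem with
    | nil => exact absurd h2 he
    | cons x rem =>
      obtain ⟨hx1, hx2, hx3⟩ := h2
      have hfa : ∀ z, 8 ≤ z → z ≤ 14 → s'.arr z = s.arr z := fun z h1 h2 => hA.2 z (hkeep z h1 h2)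
      have hxL : s'.var 16 ∈ N.L v := by rw [h1, hx1]; simp
      refine (does_deleteSlot (v := v) hc hcn hcomp' hlt hM hh h3
        (hst.congr fun z h1 h2 => hfa z h1 (by omega))
        (by rw [hfa 14 (by norm_num) (by norm_num), h14])
        (by rw [hA.1 11 (hkeepv 11 (Or.inl rfl))]; simpa using h11)
        (by rw [hA.1 14 (hkeepv 14 (Or.inr rfl))]; simpa using hv14) hv hxL ?_ ?_).mono ?_
      · intro hc
        rcases List.mem_append.1 hc with hc | hc
        · exact hsl _ hxL hc
        · have hnd := nodup_adjList N.a N.b N.h v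
          change (N.L v).Nodup at hnd
          rw [h1, hx1.symm, List.nodup_append] at hnd
          exact hnd.2.2 _ hc _ List.mem_cons_self rfl
      · intro y hy
        rcases List.mem_append.1 hy with hy | hy
        · exact hown y hy
        · exact ⟨v, hv, by rw [h1]; exact List.mem_append_left _ hy⟩
      · rintro t s'' ⟨B'', h5, h6, h7⟩
        refine ⟨pre ++ [x], rem, B'', by simp [h1], ?_, ?_, ?_⟩
        · rw [h7, hfa 12 (by norm_num) (by norm_num), hx1]; exact hx3
        · rw [hx1, List.append_assoc] at h6; exact h6
        · simp only [Expr.cost, List.length_append, List.length_cons, List.length_nil]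
          omega
  · rintro t s' ⟨τ, rfl, ⟨pre, rem, B', h1, h2, h3, h4⟩, he, -⟩
    have he : s'.var 16 = 0 := he
    cases rem with
    | cons x rem => exact absurd (h2.1.symm.trans he) h2.2.1
    | nil =>
      rw [List.append_nil] at h1
      refine ⟨B', ?_, by rw [h1]; exact h3⟩
      rw [h1]
      simp only [Expr.cost]
      omega

end Deletion

end EdgeConn

/-! ### Splitting a cluster -/

namespace EdgeConn

open WordRAM

/-- Splits the cluster in register `11` with the anchor in register `12`, which is not in relation
to the class in register `10`. -/
def splitCluster (D : Decremental) : Cmd :=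
  .seq (.seq (.assign 13 (.var 12)) <| .seq (.assign 14 (.var 12)) <|
    .seq (.assign 15 (.var 12)) <| .seq (.assign 16 (.load 11 (.var 12))) <|
    .seq (.assign 17 (.var 10)) <| .seq (.assign 18 (.var 10)) <|
    .seq (.assign 19 (.var 10)) <| .seq (.assign 20 (.load 11 (.var 10))) <|
    .seq (.store 15 (.var 12) (.var 8)) <| .seq (.store 15 (.var 10) (.var 8)) <|
    .assign 21 (.lit 1)) <|
  .seq (search D) <|
  .seq (Cmd.forList (.store 14 (.var 14) (.var 8))) <|
  .seq (Cmd.forList (deleteSlots D)) <|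
  .seq (.store 18 (.var 8) (.var 13)) <| .seq (.store 18 (.var 11) (.var 17)) <|
    .assign 8 (.op .add (.var 8) (.lit 1))

/-- The part of `splitCluster` that starts the two searches. -/
theorem does_startSearch {w : ℕ} {s : State} {Q : ℕ → State → Prop} {c : Cmd} (hw : 1 < 2 ^ w)
    (h : ∀ s', s'.high = s.high → (∀ z, z < 13 → s'.var z = s.var z) →
      (s'.var 13 = s.var 12 ∧ s'.var 14 = s.var 12 ∧ s'.var 15 = s.var 12 ∧
        s'.var 16 = s.arr 11 (s.var 12)) →
      (s'.var 17 = s.var 10 ∧ s'.var 18 = s.var 10 ∧ s'.var 19 = s.var 10 ∧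
        s'.var 20 = s.arr 11 (s.var 10)) → s'.var 21 = 1 →
      (∀ z, z ≠ 15 → s'.arr z = s.arr z) →
      s'.arr 15 = Function.update (Function.update (s.arr 15) (s.var 12) (s.var 8)) (s.var 10)
        (s.var 8) →
      Does w c s' fun t s'' => Q (26 + t) s'') :
    Does w (.seq (.seq (.assign 13 (.var 12)) <| .seq (.assign 14 (.var 12)) <|
    .seq (.assign 15 (.var 12)) <| .seq (.assign 16 (.load 11 (.var 12))) <|
    .seq (.assign 17 (.var 10)) <| .seq (.assign 18 (.var 10)) <|
    .seq (.assign 19 (.var 10)) <| .seq (.assign 20 (.load 11 (.var 10))) <|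
    .seq (.store 15 (.var 12) (.var 8)) <| .seq (.store 15 (.var 10) (.var 8)) <|
    .assign 21 (.lit 1)) c) s Q := by
  have hone : 1 % 2 ^ w = 1 := Nat.mod_eq_of_lt hw
  rw [does_seq]
  simp only [does_seq, does_assign, does_store]
  refine h _ ?_ ?_ ?_ ?_ ?_ ?_ ?_
  · simp only [State.high_setVar_low, State.high_setArr_low, Nat.reduceLT]
  · intro z hz
    have h1 : z ≠ 13 := by omega
    have h2 : z ≠ 14 := by omega
    have h3 : z ≠ 15 := by omega
    have h4 : z ≠ 16 := by omega
    have h5 : z ≠ 17 := by omega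
    have h6 : z ≠ 18 := by omega
    have h7 : z ≠ 19 := by omega
    have h8 : z ≠ 20 := by omega
    have h9 : z ≠ 21 := by omega
    simp [h1, h2, h3, h4, h5, h6, h7, h8, h9]
  · simp [Expr.eval]
  · simp [Expr.eval]
  · simp [Expr.eval, hone]
  · intro z hz
    simp [hz]
  · simp [Expr.eval]

section

variable {n : ℕ} {N : Net n} {D : Decremental} {w k : ℕ} {tq : ℝ} {c M : ℕ}
  {comp comp' : ℕ → ℕ} {l W : List ℕ}

theorem does_relabel {s : State} (hw : 1 < 2 ^ w) (hhead : l.head? = some (s.var 13))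
    (hlink : Linked (s.arr 16) (s.var 15) l) (hl : l.Nodup) :
    Does w (Cmd.forList (.store 14 (.var 14) (.var 8))) s fun t s' => t ≤ 12 * l.length + 6 ∧
      (∀ v, s'.arr 14 v = if v ∈ l then s.var 8 else s.arr 14 v) ∧ s'.high = s.high ∧
      (∀ z, z ≠ 14 → z ≠ 21 → s'.var z = s.var z) ∧ ∀ z, z ≠ 14 → s'.arr z = s.arr z := by
  refine (does_forList (c := .store 14 (.var 14) (.var 8)) (fun d τ s' => τ ≤ 12 * d.length ∧
    (∀ v, s'.arr 14 v = if v ∈ d then s.var 8 else s.arr 14 v) ∧ s'.high = s.high)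
    (12 * l.length) hw trivial trivial trivial (by simp [Cmd.KeepsArr]) hhead hlink hl ?_ ?_ ?_
    ?_).mono ?_
  · rintro d τ s' z ⟨h1, h2, h3⟩
    exact ⟨⟨h1, h2, by rw [State.high_setVar_low (by norm_num), h3]⟩,
      h1, h2, by rw [State.high_setVar_low (by norm_num), h3]⟩
  · simp
  · rintro d τ s' ⟨h1, -⟩ hd
    exact h1.trans (Nat.mul_le_mul_left _ hd.length_le)
  · rintro d v rest τ s' hd ⟨h1, h2, h3⟩ h4 h5 h6
    rw [does_store]
    refine ⟨by simp only [Expr.cost, List.length_append, List.length_cons, List.length_nil]; omega,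
      ?_, by rw [State.high_setArr_low (by norm_num), h3]⟩
    intro u
    simp only [Expr.eval, arr_setArr, if_true, h4]
    rw [Function.update_apply]
    have h8 : s'.var 8 = s.var 8 := h5 8 (by norm_num) (by norm_num) trivial
    by_cases hu : u = v
    · simp [hu, h8]
    · simp [hu, h2]
  · rintro t s' ⟨τ, rfl, ⟨h1, h2, h3⟩, h4, h5⟩
    exact ⟨by omega, h2, h3, fun z h6 h7 => h4 z h6 h7 trivial,
      fun z hz => h5 z (by simpa [Cmd.KeepsArr] using hz)⟩

theorem length_flatMap_add (N : Net n) (l : List ℕ) :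
    (l.flatMap N.L).length + l.length = (l.map N.wt).sum := by
  induction l with
  | nil => rfl
  | cons v l ih =>
    simp only [List.flatMap_cons, List.length_append, List.length_cons, List.map_cons,
      List.sum_cons, Net.wt]
    omega

theorem deleteSlots_keepsVar {z : ℕ} (hz : z < 100) (h9 : z ≠ 9) (h16 : z ≠ 16)
    (h23 : z ≠ 23) (h24 : z ≠ 24) : (deleteSlots D).KeepsVar z := by
  have h100 : z ≠ 100 := by omega
  have h101 : z ≠ 101 := by omega
  simp [deleteSlots, deleteSlot, Decremental.deleteCmd, Cmd.KeepsVar, Cmd.keepsVar_shift _ hz, h9,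
    h16, h23, h24, h100, h101]

theorem deleteSlots_keepsArr {z : ℕ} (hz : z < 100) (h17 : z ≠ 17) :
    (deleteSlots D).KeepsArr z := by
  simp [deleteSlots, deleteSlot, Decremental.deleteCmd, Cmd.KeepsArr, Cmd.keepsArr_shift _ hz, h17]

/-- Apart from the deletion budget, the time and the number of pushed classes are linear in the
weight of the part. -/
theorem does_deleteList {s : State} {B new : ℕ} (hw : 1 < 2 ^ w)
    (hhead : l.head? = some (s.var 13)) (hlink : Linked (s.arr 16) (s.var 15) l) (hl : l.Nodup)
    (hc : ∀ v ∈ l, comp v = c) (hcn : c ≠ new) (hnew : ∀ v < N.nc, comp v ≠ new)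
    (hcomp' : ∀ v, comp' v = if v ∈ l then new else comp v) (hlt : ∀ v ∈ l, v < N.nc)
    (hM : M < 2 ^ w) (hh : 2 * N.h + 2 < 2 ^ w) (hst : N.Stored s) (h14 : s.arr 14 = comp')
    (h11 : s.var 11 = c) (hr : D.Ready w k tq (graphOf (N.cur comp)) B s.high)
    (hW1 : Stack (s.arr 17) W) (hW2 : s.var 9 = W.length) (hW3 : ∀ a ∈ W, a < N.nc)
    (hW4 : W.length + 2 * (N.cur comp).card ≤ M) :
    Does w (Cmd.forList (deleteSlots D)) s fun t s' => ∃ B' W',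
      t + B' ≤ B + 66 * (l.map N.wt).sum + 6 ∧
      D.Ready w k tq (graphOf (N.cur comp')) B' s'.high ∧
      Stack (s'.arr 17) W' ∧ s'.var 9 = W'.length ∧ (∀ a ∈ W, a ∈ W') ∧
      (∀ v ∈ l, ∀ x ∈ N.L v, comp' (N.dst x) = c → v ∈ W' ∧ N.dst x ∈ W') ∧
      (∀ a ∈ W', a < N.nc) ∧ W'.length + 2 * (N.cur comp').card ≤ M ∧
      W'.length ≤ W.length + 2 * (l.map N.wt).sum ∧
      (∀ z, z < 14 → z ≠ 9 → s'.var z = s.var z) ∧ s'.var 17 = s.var 17 ∧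
      (∀ z, z < 100 → z ≠ 17 → s'.arr z = s.arr z) := by
  refine (does_forList (fun d τ s' => ∃ B',
    DelInv N D w k tq c M comp comp' l W (d.flatMap N.L) B' s' ∧
    τ + B' ≤ B + 66 * (d.map N.wt).sum) (B + 66 * (l.map N.wt).sum) hw
    (deleteSlots_keepsVar (by norm_num) (by norm_num) (by norm_num) (by norm_num) (by norm_num))
    (deleteSlots_keepsVar (by norm_num) (by norm_num) (by norm_num) (by norm_num) (by norm_num))
    (deleteSlots_keepsVar (by norm_num) (by norm_num) (by norm_num) (by norm_num) (by norm_num))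
    (deleteSlots_keepsArr (by norm_num) (by norm_num)) hhead hlink hl ?_ ?_ ?_ ?_).mono ?_
  · rintro d τ s' z ⟨B', ⟨h1, h2⟩, h3⟩
    refine ⟨⟨B', ⟨?_, by simpa using h2⟩, h3⟩, ⟨B', ⟨?_, by simpa using h2⟩, h3⟩⟩ <;>
    · rw [State.high_setVar_low (by norm_num)]; exact h1
  · refine ⟨B, ⟨?_, W, hW1, hW2, fun a h => h, by simp, hW3, ?_, by simp⟩, by simp⟩
    · simpa [Net.dels] using hr
    · simpa [Net.dels] using hW4
  · rintro d τ s' ⟨B', -, h3⟩ ⟨e, rfl⟩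
    rw [List.map_append, List.sum_append]
    omega
  · rintro d v rest τ s' hd ⟨B', h1, h2⟩ hv hfv hfa
    have hvl : v ∈ l := by rw [hd]; simp
    have hdl : ∀ u ∈ d, u ∈ l := fun u hu => by rw [hd]; exact List.mem_append_left _ hu
    refine (does_deleteSlots (v := v) hc hcn hcomp' hlt hM hh h1
      (hst.congr fun z h3 h4 => hfa z (deleteSlots_keepsArr (by omega) (by omega)))
      (by rw [hfa 14 (deleteSlots_keepsArr (by norm_num) (by norm_num)), h14])
      (by rw [hfv 11 (by norm_num) (by norm_num) (deleteSlots_keepsVar (by norm_num) (by norm_num)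
        (by norm_num) (by norm_num) (by norm_num)), h11])
      hv hvl ?_ ?_).mono ?_
    · intro x hx hxd
      obtain ⟨u, hu, hxu⟩ := List.mem_flatMap.1 hxd
      have : u = v := (N.own_eq hxu).symm.trans (N.own_eq hx)
      subst this
      rw [hd, List.nodup_append] at hl
      exact hl.2.2 _ hu _ List.mem_cons_self rfl
    · intro x hx
      obtain ⟨u, hu, hxu⟩ := List.mem_flatMap.1 hx
      exact ⟨u, hdl u hu, hxu⟩
    · rintro t s'' ⟨B'', h3, h4⟩
      refine ⟨B'', by simpa using h4, ?_⟩
      simp only [List.map_append, List.map_cons, List.map_nil, List.sum_append, List.sum_cons,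
        List.sum_nil, Net.wt]
      omega
  · rintro t s' ⟨τ, rfl, ⟨B', ⟨h1, W', h2, h3, h4, h5, h6, h7, h8⟩, h9⟩, hfv, hfa⟩
    rw [Net.sdiff_dels_all hc hcn hcomp' hnew] at h1 h7
    have hlen := length_flatMap_add N l
    refine ⟨B', W', by omega, h1, h2, h3, h4, ?_, h6, h7, by omega, ?_, ?_, ?_⟩
    · intro v hv x hx hxc
      have := h5 x (List.mem_flatMap.2 ⟨v, hv, hx⟩) hxc
      rwa [N.own_eq hx] at this
    · intro z hz h9
      exact hfv z (by omega) (by omega) (deleteSlots_keepsVar (by omega) h9 (by omega) (by omega)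
        (by omega))
    · exact hfv 17 (by norm_num) (by norm_num) (deleteSlots_keepsVar (by norm_num) (by norm_num)
        (by norm_num) (by norm_num) (by norm_num))
    · intro z hz h17
      exact hfa z (deleteSlots_keepsArr hz h17)

end

/-- The memory of the partition refinement: clusters `comp` with anchors `anchor`, the stack `W`;
`Wr` are the classes that the invariant on cuts may refer to. -/
structure SolveInv {n : ℕ} (N : Net n) (D : Decremental) (w k : ℕ) (tq : ℝ) (M : ℕ)
    (comp anchor : ℕ → ℕ) (ncl : ℕ) (Wr W : List ℕ) (B : ℕ) (s : State) : Prop where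
  var8 : s.var 8 = ncl
  arr14 : s.arr 14 = comp
  arr18 : s.arr 18 = anchor
  stored : N.Stored s
  ready : D.Ready w k tq (graphOf (N.cur comp)) B s.high
  refines : Refines k N.edges N.lab comp anchor Wr
  comp_lt : ∀ v < N.nc, comp v < ncl
  anchor_ok : ∀ id < ncl, anchor id < N.nc ∧ comp (anchor id) = id
  mark : ∀ v < N.nc, s.arr 15 v < ncl
  stack : Stack (s.arr 17) W
  var9 : s.var 9 = W.length
  stack_lt : ∀ a ∈ W, a < N.nc
  bound : W.length + 2 * (N.cur comp).card ≤ M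

/-- Different clusters have different anchors, so the cluster numbers fit into words. -/
theorem SolveInv.ncl_le {n : ℕ} {N : Net n} {D : Decremental} {w k : ℕ} {tq : ℝ} {M : ℕ}
    {comp anchor : ℕ → ℕ} {ncl : ℕ} {Wr W : List ℕ} {B : ℕ} {s : State}
    (h : SolveInv N D w k tq M comp anchor ncl Wr W B s) : ncl ≤ N.nc := by
  have := Finset.card_le_card_of_injOn (s := Finset.range ncl) (t := Finset.range N.nc) anchor
    (fun id hid => by
      simp only [Finset.coe_range, Set.mem_Iio] at hid ⊢
      exact (h.anchor_ok id hid).1)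
    (fun i hi j hj hij => by
      simp only [Finset.coe_range, Set.mem_Iio] at hi hj
      rw [← (h.anchor_ok i hi).2, ← (h.anchor_ok j hj).2, hij])
  simpa using this

theorem search_keepsVar {D : Decremental} {z : ℕ} (hz : z < 13) :
    (searchStep D).KeepsVar z := by
  have h1 : z < 100 := by omega
  have h2 : z ≠ 13 := by omega
  have h3 : z ≠ 14 := by omega
  have h4 : z ≠ 15 := by omega
  have h5 : z ≠ 16 := by omega
  have h6 : z ≠ 17 := by omega
  have h7 : z ≠ 18 := by omega
  have h8 : z ≠ 19 := by omega
  have h9 : z ≠ 20 := by omega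
  have h10 : z ≠ 21 := by omega
  have h11 : z ≠ 22 := by omega
  have h12 : z ≠ 23 := by omega
  have h13 : z ≠ 100 := by omega
  have h14 : z ≠ 101 := by omega
  simp [searchStep, swapSides, Decremental.queryCmd, Cmd.KeepsVar, Cmd.keepsVar_shift _ h1, h2, h3,
    h4, h5, h6, h7, h8, h9, h10, h11, h12, h13, h14]

theorem search_keepsArr {D : Decremental} {z : ℕ} (hz : z < 100) (h15 : z ≠ 15) (h16 : z ≠ 16) :
    (searchStep D).KeepsArr z := by
  simp [searchStep, swapSides, Decremental.queryCmd, Cmd.KeepsArr, Cmd.keepsArr_shift _ hz, h15, h16]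

/-- `X` is the weight of the part split off: the potential pays for it, and it bounds the search,
the relabelling, the deletions and the growth of the stack. -/
theorem does_splitCluster {n : ℕ} {N : Net n} {D : Decremental} {w k : ℕ} {tq : ℝ} {M : ℕ}
    {comp anchor : ℕ → ℕ} {ncl : ℕ} {W : List ℕ} {B : ℕ} {s : State} {t c r : ℕ}
    (hk : 1 ≤ k) (hcls : ∀ u, KEC k N.edges {v | N.lab v = N.lab u})
    (hM : M < 2 ^ w) (hh : 2 * N.h + 2 < 2 ^ w) (hnc : N.nc + 1 < 2 ^ w)
    (h : SolveInv N D w k tq M comp anchor ncl (t :: W) W B s) (ht : t < N.nc)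
    (h10 : s.var 10 = t) (h11 : s.var 11 = c) (h12 : s.var 12 = r) (hc : comp t = c)
    (hr : anchor c = r) (hrt : ¬N.Rel k comp r t) :
    Does w (splitCluster D) s fun τ s' => ∃ comp' anchor' ncl' W' B' X,
      SolveInv N D w k tq M comp' anchor' ncl' W' W' B' s' ∧
      N.Phi comp' + X ≤ N.Phi comp ∧ 1 ≤ X ∧ W'.length ≤ W.length + 2 * X ∧
      τ + B' ≤ B + (2 * ⌊tq⌋₊ + 300) * X := by
  have hone : 1 % 2 ^ w = 1 := Nat.mod_eq_of_lt (by omega)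
  have hcn : c < ncl := hc ▸ h.comp_lt t ht
  obtain ⟨hrlt, hrc⟩ := h.anchor_ok c hcn
  rw [hr] at hrlt hrc
  have hncl := h.ncl_le
  unfold splitCluster
  refine does_startSearch (by omega) fun s₁ hhi1 hv1 hx1 hy1 h211 ha1 hm1 => ?_
  obtain ⟨hx11, hx12, hx13, hx14⟩ := hx1
  obtain ⟨hy11, hy12, hy13, hy14⟩ := hy1
  rw [h12] at hx11 hx12 hx13 hx14
  rw [h10] at hy11 hy12 hy13 hy14
  rw [h12, h10, h.var8] at hm1
  have hst1 : N.Stored s₁ := h.stored.congr fun z _ _ => ha1 z (by omega)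
  have hI1 : SearchInv N D w k tq B c ncl r t comp (s.arr 12) s₁ [r] [t] 0 0 := by
    refine ⟨⟨by rw [hv1 8 (by norm_num), h.var8], by rw [hv1 11 (by norm_num), h11]⟩,
      by rw [ha1 14 (by norm_num), h.arr14], ha1 12 (by norm_num), hst1,
      by rw [hhi1]; exact h.ready, Or.inl ⟨hx11, hy11⟩, ?_, ?_, ?_, ?_⟩
    · rw [hx11, hx12, hx13, hx14]
      exact Net.Side.init hrlt hrc (Reach.refl _ _ _) (h.stored.adj r hrlt)
    · rw [hy11, hy12, hy13, hy14]
      exact Net.Side.init ht hc (Reach.refl _ _ _) (h.stored.adj t ht)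
    -- All stored marks are below `ncl`, so `ncl` serves as a fresh mark and array `15` is never
    -- cleared.
    · intro v hv
      have := h.mark v hv
      rw [hm1, Function.update_apply, Function.update_apply]
      by_cases h1 : v = t
      · simp [h1]
      · by_cases h2 : v = r
        · simp [h2]
        · simp [h1, h2]; omega
    · intro v hv
      have := h.mark v hv
      rw [hm1, Function.update_apply, Function.update_apply]
      split
      · exact le_rfl
      · split
        · exact le_rfl
        · omega
  rw [does_seq]
  refine (does_search (by omega) h211 hrt hI1).mono ?_
  rintro t₂ s₂ ⟨l, l', σ, σ', hI2, hcl, hhalf, ht2, hA2⟩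
  have hv2 : ∀ z, z < 13 → s₂.var z = s.var z := fun z hz =>
    (hA2.1 z (search_keepsVar hz)).trans (hv1 z hz)
  have ha2 : ∀ z, z < 100 → z ≠ 15 → z ≠ 16 → s₂.arr z = s.arr z := fun z hz h1 h2 =>
    (hA2.2 z (search_keepsArr hz h1 h2)).trans (ha1 z h1)
  obtain ⟨hnd, hprop⟩ := hI2.side.prop
  obtain ⟨hhead, hlink⟩ := hI2.side.linked
  obtain ⟨hxl, -, -⟩ := hI2.side.mem
  obtain ⟨hyl', -, -⟩ := hI2.side'.mem
  have hyl : s₂.var 17 ∉ l := fun hc => (hI2.disjoint hrt).2 _ hc hyl'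
  have hylt := hI2.side'.prop.2 _ hyl'
  rw [does_seq]
  refine (does_relabel (by omega) hhead hlink hnd).mono ?_
  rintro t₃ s₃ ⟨ht3, h143, hhi3, hv3, ha3⟩
  have h82 : s₂.var 8 = ncl := (hv2 8 (by norm_num)).trans h.var8
  rw [h82, hI2.comp_eq] at h143
  have hcomp' : ∀ v, s₃.arr 14 v = if v ∈ l then ncl else comp v := h143
  set comp' := s₃.arr 14 with hcomp'def
  have hnew : ∀ v < N.nc, comp v ≠ ncl := fun v hv => (h.comp_lt v hv).ne
  rw [does_seq]
  refine (does_deleteList (N := N) (D := D) (k := k) (tq := tq) (M := M) (W := W) (B := B)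
    (c := c) (comp := comp) (comp' := comp') (new := ncl) (by omega)
    (by rw [hv3 13 (by norm_num) (by norm_num)]; exact hhead)
    (by rw [hv3 15 (by norm_num) (by norm_num), ha3 16 (by norm_num)]; exact hlink) hnd
    (fun v hv => (hprop v hv).2.1) hcn.ne hnew hcomp' (fun v hv => (hprop v hv).1) hM hh
    (hI2.stored.congr fun z h1 h2 => ha3 z (by omega)) rfl
    (by rw [hv3 11 (by norm_num) (by norm_num), hv2 11 (by norm_num), h11])
    (by rw [hhi3]; exact hI2.ready)
    (by rw [ha3 17 (by norm_num), ha2 17 (by norm_num) (by norm_num) (by norm_num)]; exact h.stack)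
    (by rw [hv3 9 (by norm_num) (by norm_num), hv2 9 (by norm_num)]; exact h.var9)
    h.stack_lt h.bound).mono ?_
  rintro t₄ s₄ ⟨B', W', ht4, hr4, hW1, hW2, hW3, hW4, hW5, hW6, hW7, hv4, hv417, ha4⟩
  simp only [does_seq, does_store, does_assign]
  have h8 : s₄.var 8 = ncl := by
    rw [hv4 8 (by norm_num) (by norm_num), hv3 8 (by norm_num) (by norm_num), h82]
  have h114 : s₄.var 11 = c := by
    rw [hv4 11 (by norm_num) (by norm_num), hv3 11 (by norm_num) (by norm_num),
      hv2 11 (by norm_num), h11]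
  have h13 : s₄.var 13 = s₂.var 13 := by
    rw [hv4 13 (by norm_num) (by norm_num), hv3 13 (by norm_num) (by norm_num)]
  have h17 : s₄.var 17 = s₂.var 17 := by
    rw [hv417, hv3 17 (by norm_num) (by norm_num)]
  have h184 : s₄.arr 18 = anchor := by
    rw [ha4 18 (by norm_num) (by norm_num), ha3 18 (by norm_num),
      ha2 18 (by norm_num) (by norm_num) (by norm_num), h.arr18]
  have ha4' : ∀ z, z < 100 → z ≠ 14 → z ≠ 17 → s₄.arr z = s₂.arr z := fun z h1 h2 h3 =>
    (ha4 z h1 h3).trans (ha3 z h2)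
  have hadd : (ncl + 1) % 2 ^ w = ncl + 1 := Nat.mod_eq_of_lt (by omega)
  have hlen := length_flatMap_add N l
  have hlpos : 0 < l.length := List.length_pos_of_mem hxl
  have hanch : ∀ id, Function.update (Function.update anchor ncl (s₂.var 13)) c (s₂.var 17) id =
      if id = ncl then s₂.var 13 else if id = c then s₂.var 17 else anchor id := by
    intro id
    simp only [Function.update_apply]
    by_cases h1 : id = c
    · simp [h1, hcn.ne]
    · simp [h1]
  refine ⟨comp', Function.update (Function.update anchor ncl (s₂.var 13)) c (s₂.var 17), ncl + 1,
    W', B', (l.map N.wt).sum, ?_, ?_, by omega, by omega, ?_⟩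
  · constructor
    · simp [Expr.eval, Op.eval, h8, hone, hadd]
    · simp [ha4 14 (by norm_num) (by norm_num), hcomp'def]
    · simp [Expr.eval, h8, h114, h13, h17, h184]
    · exact hI2.stored.congr fun z h1 h2 => by
        have e1 : z ≠ 18 := by omega
        have e2 : z ≠ 14 := by omega
        have e3 : z ≠ 17 := by omega
        simp [e1, ha4' z (by omega) e2 e3]
    · simp only [State.high_setVar_low, State.high_setArr_low, Nat.reduceLT]
      exact hr4
    · refine Refines.split (C := {v | v ∈ l}) (x := s₂.var 13) (y := s₂.var 17) (new := ncl)
        hk h.refines hc ?_ hxl hyl (fun a ha => (hprop a ha).2.1)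
        (fun u => hnew _ (N.lab_lt u)) ?_ hanch ?_ hW3 ?_
      · rw [hr]; exact hI2.sources
      · intro u
        rw [hcomp']
        by_cases hu : N.lab u ∈ l <;> simp [hu]
      -- An edge leaving the part with k-edge-connected ends would lead to a class related to the
      -- source, which the finished search would have found. Reachability passes from the ends to
      -- representatives because classes are k-edge-connected by live edges.
      · intro p hp hpC hreach
        obtain ⟨hpe, hpc⟩ := mem_live.1 hp
        obtain ⟨i, hi, rfl⟩ := N.mem_edges.1 hpe
        have hcr : ∀ u v, N.lab u = N.lab v → Reach k (N.cur comp) u v := fun u v huv => by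
          refine (hcls u).reach (fun q hq => ?_) rfl (Eq.symm huv)
          obtain ⟨hq1, hq2, hq3⟩ := mem_inside.1 hq
          refine mem_live.2 ⟨hq1, ?_⟩
          have hq2 : N.lab q.1 = N.lab u := hq2
          have hq3 : N.lab q.2 = N.lab u := hq3
          rw [hq2, hq3]
        have hrepE : ∀ u, Reach k (N.cur comp) (N.rep (N.lab u)) u := fun u =>
          hcr _ _ (N.lab_rep _ (N.lab_lt u))
        have hrel : N.Rel k comp (N.a i) (N.b i) :=
          ((hrepE _).trans hreach).trans (hrepE _).symm
        by_cases h1 : N.a i ∈ l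
        · have h2 : N.b i ∉ l := fun h2 => hpC (iff_of_true h1 h2)
          obtain ⟨⟨x, hx, hxi, hxd⟩, -⟩ := N.exists_slot hi fun hc => h2 (hc ▸ h1)
          have := hcl _ h1 x hx (by rw [hxd, ← (hprop _ h1).2.1]; exact hpc.symm)
            (by rw [hxd]; exact Reach.trans (hprop _ h1).2.2 hrel)
          rw [hxd] at this
          exact h2 this
        · have h2 : N.b i ∈ l := by by_contra h2; exact hpC (iff_of_false h1 h2)
          obtain ⟨-, x, hx, hxi, hxd⟩ := N.exists_slot hi fun hc => h1 (hc ▸ h2)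
          have := hcl _ h2 x hx (by rw [hxd, ← (hprop _ h2).2.1]; exact hpc)
            (by rw [hxd]; exact Reach.trans (hprop _ h2).2.2 (Reach.symm hrel))
          rw [hxd] at this
          exact h1 this
      · intro p hp hpC
        obtain ⟨hpe, hpc⟩ := mem_live.1 hp
        obtain ⟨i, hi, rfl⟩ := N.mem_edges.1 hpe
        change comp (N.a i) = comp (N.b i) at hpc
        by_cases h1 : N.a i ∈ l
        · have h2 : N.b i ∉ l := fun h2 => hpC (iff_of_true h1 h2)
          obtain ⟨⟨x, hx, hxi, hxd⟩, -⟩ := N.exists_slot hi fun hc => h2 (hc ▸ h1)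
          have := hW4 _ h1 x hx (by rw [hxd, hcomp', if_neg h2, ← hpc, (hprop _ h1).2.1])
          rwa [hxd] at this
        · have h2 : N.b i ∈ l := by by_contra h2; exact hpC (iff_of_false h1 h2)
          obtain ⟨-, x, hx, hxi, hxd⟩ := N.exists_slot hi fun hc => h1 (hc ▸ h2)
          have := hW4 _ h2 x hx (by rw [hxd, hcomp', if_neg h1, hpc, (hprop _ h2).2.1])
          rw [hxd] at this
          exact this.symm
    · intro v hv
      rw [hcomp']
      split
      · omega
      · have := h.comp_lt v hv; omega
    · intro id hid
      rw [hanch, hcomp']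
      by_cases h1 : id = ncl
      · simp only [h1, if_true]
        exact ⟨(hprop _ hxl).1, by rw [if_pos hxl]⟩
      · rw [if_neg h1]
        by_cases h2 : id = c
        · rw [if_pos h2, if_neg hyl, h2]
          exact ⟨hylt.1, hylt.2.1⟩
        · rw [if_neg h2]
          obtain ⟨h3, h4⟩ := h.anchor_ok id (by omega)
          refine ⟨h3, ?_⟩
          rw [if_neg fun hc => h2 (h4.symm.trans (hprop _ hc).2.1), h4]
    · intro v hv
      have := hI2.mark_le v hv
      simp [ha4' 15 (by norm_num) (by norm_num) (by norm_num)]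
      omega
    · simpa using hW1
    · simpa using hW2
    · exact hW5
    · exact hW6
  · exact N.Phi_split hnd (fun v hv => (hprop v hv).1) (fun v hv => (hprop v hv).2.1) hnew hcomp'
      hhalf
  · simp only [Expr.cost]
    -- Since `2 * 73 + 154 = 300`, the search leaves `154` per unit of weight for relabelling,
    -- deletions and overhead.
    have hexp : (2 * ⌊tq⌋₊ + 300) * (l.map N.wt).sum =
      2 * (⌊tq⌋₊ + 73) * (l.map N.wt).sum + 154 * (l.map N.wt).sum := by ring
    rw [hexp]
    omega

end EdgeConn

/-! ### The refinement loop and its amortised time -/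

namespace EdgeConn

open WordRAM

/-- Handles the topmost class of the stack. -/
def refineStep (D : Decremental) : Cmd :=
  .seq (.assign 9 (.op .sub (.var 9) (.lit 1))) <| .seq (.assign 10 (.load 17 (.var 9))) <|
  .seq (.assign 11 (.load 14 (.var 10))) <| .seq (.assign 12 (.load 18 (.var 11))) <|
  .seq (D.queryCmd (.load 8 (.var 12)) (.load 8 (.var 10))) <|
  .cond (.var 100) .skip (splitCluster D)

section

variable {n : ℕ} {N : Net n} {D : Decremental} {w k : ℕ} {tq : ℝ} {M : ℕ}
  {comp anchor : ℕ → ℕ} {ncl : ℕ} {W : List ℕ} {B : ℕ} {s : State}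

/-- A successful query removes `t` by `Refines.pop` with `X = 0`; a failed one leads to a split.
Until then the invariant on cuts still refers to `t`, although it has left the stack in memory. -/
theorem does_refineStep {t : ℕ} (hk : 1 ≤ k) (hcls : ∀ u, KEC k N.edges {v | N.lab v = N.lab u})
    (hM : M < 2 ^ w) (hh : 2 * N.h + 2 < 2 ^ w) (hnc : N.nc + 1 < 2 ^ w)
    (h : SolveInv N D w k tq M comp anchor ncl (t :: W) (t :: W) B s) :
    Does w (refineStep D) s fun τ s' => ∃ comp' anchor' ncl' W' B' X,
      SolveInv N D w k tq M comp' anchor' ncl' W' W' B' s' ∧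
      N.Phi comp' + X ≤ N.Phi comp ∧ W'.length ≤ W.length + 2 * X ∧
      τ + B' ≤ B + (2 * ⌊tq⌋₊ + 300) * X + (⌊tq⌋₊ + 28) := by
  have hone : 1 % 2 ^ w = 1 := Nat.mod_eq_of_lt (by omega)
  have hlen : (t :: W).length = W.length + 1 := rfl
  have h9 := h.var9
  have hb := h.bound
  rw [hlen] at h9 hb
  have hsub : (W.length + 1 + 2 ^ w - 1) % 2 ^ w = W.length := by
    rw [show W.length + 1 + 2 ^ w - 1 = W.length + 2 ^ w by omega, Nat.add_mod_right,
      Nat.mod_eq_of_lt (by omega)]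
  have ht : t < N.nc := h.stack_lt t List.mem_cons_self
  obtain ⟨hanc, hac⟩ := h.anchor_ok _ (h.comp_lt t ht)
  have htop : s.arr 17 W.length = t := h.stack.1
  have e1 : Expr.eval w s (.op .sub (.var 9) (.lit 1)) = W.length := by
    simp only [Expr.eval, Op.eval, h9, hone, hsub]
  unfold refineStep
  rw [does_seq, does_assign, e1, does_seq, does_assign]
  have e2 : Expr.eval w (s.setVar 9 W.length) (.load 17 (.var 9)) = t := by
    simp [Expr.eval, htop]
  rw [e2, does_seq, does_assign]
  have e3 : Expr.eval w ((s.setVar 9 W.length).setVar 10 t) (.load 14 (.var 10)) = comp t := by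
    simp [Expr.eval, h.arr14]
  rw [e3, does_seq, does_assign]
  have e4 : Expr.eval w (((s.setVar 9 W.length).setVar 10 t).setVar 11 (comp t))
      (.load 18 (.var 11)) = anchor (comp t) := by
    simp [Expr.eval, h.arr18]
  rw [e4]
  set s₁ := ((((s.setVar 9 W.length).setVar 10 t).setVar 11 (comp t)).setVar 12
    (anchor (comp t))) with hs₁
  have hhi : s₁.high = s.high := by simp only [hs₁, State.high_setVar_low, Nat.reduceLT]
  have harr : s₁.arr = s.arr := rfl
  have h18 : s₁.var 8 = ncl := by simp [hs₁, h.var8]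
  have h19 : s₁.var 9 = W.length := by simp [hs₁]
  have h110 : s₁.var 10 = t := by simp [hs₁]
  have h111 : s₁.var 11 = comp t := by simp [hs₁]
  have h112 : s₁.var 12 = anchor (comp t) := by simp [hs₁]
  clear_value s₁
  rw [does_seq]
  refine (does_queryCmd (k := k) (tq := tq) (N.simple_cur comp) (s := s₁) (B := B)
    (by rw [hhi]; exact h.ready) (u := N.rep (anchor (comp t))) (v := N.rep t) ?_ ?_).mono ?_
  · simp [Expr.eval, h112, harr, h.stored.rep _ hanc]
  · simp [Expr.eval, h110, harr, h.stored.rep _ ht]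
  rintro τ₁ _ ⟨hτ₁, p, rfl, hpR, hpr⟩
  rw [does_cond]
  have h100 : Expr.eval w (s₁.withHigh p) (.var 100) = p.var 0 := by
    simp [Expr.eval, State.withHigh]
  simp only [Expr.cost] at hτ₁
  have hinv : ∀ Wr, Refines k N.edges N.lab comp anchor Wr →
      SolveInv N D w k tq M comp anchor ncl Wr W B (s₁.withHigh p) := fun Wr hWr => by
    refine ⟨by simp [State.var_withHigh, h18], by simp [State.arr_withHigh, harr, h.arr14],
      by simp [State.arr_withHigh, harr, h.arr18],
      h.stored.congr fun z _ _ => by rw [State.arr_withHigh (by omega), harr],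
      by rw [State.high_withHigh]; exact hpr, hWr, h.comp_lt, h.anchor_ok, ?_, ?_, ?_,
      fun a ha => h.stack_lt a (List.mem_cons_of_mem _ ha), by omega⟩
    · simpa [State.arr_withHigh, harr] using h.mark
    · simpa [State.arr_withHigh, harr] using h.stack.2
    · simp [State.var_withHigh, h19]
  by_cases hR : N.Rel k comp (anchor (comp t)) t
  · rw [if_neg (by rw [h100]; exact hpR.2 hR), does_skip]
    refine ⟨comp, anchor, ncl, W, B, 0, hinv W (h.refines.pop (N.lab_rep t ht)
      (N.lab_rep _ hanc) hR), by omega, by omega, ?_⟩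
    simp only [Expr.cost]
    omega
  · rw [if_pos (by rw [h100]; by_contra hc; exact hR (hpR.1 hc))]
    refine (does_splitCluster hk hcls hM hh hnc (hinv _ h.refines) ht (by simp [State.var_withHigh, h110])
      (by simp [State.var_withHigh, h111]) (by simp [State.var_withHigh, h112]) rfl rfl hR).mono ?_
    rintro τ s' ⟨comp', anchor', ncl', W', B', X, h1, h2, -, h4, h5⟩
    refine ⟨comp', anchor', ncl', W', B', X, h1, h2, h4, ?_⟩
    simp only [Expr.cost]
    omega

/-- Deletion budget, `Phi` and stack height together form the potential. A unit of weight split off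
costs `2 * ⌊tq⌋₊ + 300` itself and `2 * (⌊tq⌋₊ + 30)` for the two classes that it may push. -/
theorem does_refineLoop (hk : 1 ≤ k) (hcls : ∀ u, KEC k N.edges {v | N.lab v = N.lab u})
    (hM : M < 2 ^ w) (hh : 2 * N.h + 2 < 2 ^ w) (hnc : N.nc + 1 < 2 ^ w)
    (h : SolveInv N D w k tq M comp anchor ncl W W B s) :
    Does w (.loop (.var 9) (refineStep D)) s fun t s' => ∃ comp' anchor' ncl' B',
      t ≤ B + (4 * ⌊tq⌋₊ + 360) * N.Phi comp + (⌊tq⌋₊ + 30) * W.length + 2 ∧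
      SolveInv N D w k tq M comp' anchor' ncl' [] [] B' s' ∧ Agree (refineStep D) s s' := by
  refine (does_loop (fun τ s => ∃ comp' anchor' ncl' W' B',
    SolveInv N D w k tq M comp' anchor' ncl' W' W' B' s ∧
    τ + B' + (4 * ⌊tq⌋₊ + 360) * N.Phi comp' + (⌊tq⌋₊ + 30) * W'.length ≤
      B + (4 * ⌊tq⌋₊ + 360) * N.Phi comp + (⌊tq⌋₊ + 30) * W.length)
    (B + (4 * ⌊tq⌋₊ + 360) * N.Phi comp + (⌊tq⌋₊ + 30) * W.length)
    ⟨comp, anchor, ncl, W, B, h, by omega⟩ ?_ ?_).mono ?_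
  · rintro τ s ⟨comp', anchor', ncl', W', B', -, h1⟩
    omega
  · rintro τ s ⟨comp', anchor', ncl', W', B', h1, h2⟩ - he
    have he : s.var 9 ≠ 0 := he
    cases W' with
    | nil => exact absurd h1.var9 he
    | cons t W₁ =>
      refine (does_refineStep hk hcls hM hh hnc h1).mono ?_
      rintro τ' s' ⟨comp₂, anchor₂, ncl₂, W₂, B₂, X, h3, h4, h5, h6⟩
      refine ⟨comp₂, anchor₂, ncl₂, W₂, B₂, h3, ?_⟩
      rw [List.length_cons] at h2
      have h7 : (4 * ⌊tq⌋₊ + 360) * N.Phi comp₂ + (4 * ⌊tq⌋₊ + 360) * X ≤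
          (4 * ⌊tq⌋₊ + 360) * N.Phi comp' := by
        rw [← mul_add]; exact Nat.mul_le_mul_left _ h4
      have h8 : (⌊tq⌋₊ + 30) * W₂.length ≤ (⌊tq⌋₊ + 30) * (W₁.length + 2 * X) :=
        Nat.mul_le_mul_left _ h5
      have e1 : (⌊tq⌋₊ + 30) * (W₁.length + 1) = (⌊tq⌋₊ + 30) * W₁.length + (⌊tq⌋₊ + 30) := by ring
      have e2 : (⌊tq⌋₊ + 30) * (W₁.length + 2 * X) + (2 * ⌊tq⌋₊ + 300) * X =
        (⌊tq⌋₊ + 30) * W₁.length + (4 * ⌊tq⌋₊ + 360) * X := by ring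
      simp only [Expr.cost]
      omega
  · rintro t s' ⟨τ, rfl, ⟨comp', anchor', ncl', W', B', h1, h2⟩, he, hA⟩
    have he : s'.var 9 = 0 := he
    have hW : W' = [] := List.length_eq_zero_iff.1 (h1.var9.symm.trans he)
    subst hW
    exact ⟨comp', anchor', ncl', B', by simp only [Expr.cost]; omega, h1, hA⟩

end

theorem refineStep_keepsVar {D : Decremental} {z : ℕ} (hz : z < 8) :
    (refineStep D).KeepsVar z := by
  have h1 : z < 100 := by omega
  have e8 : z ≠ 8 := by omega
  have e9 : z ≠ 9 := by omega
  have e10 : z ≠ 10 := by omega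
  have e11 : z ≠ 11 := by omega
  have e12 : z ≠ 12 := by omega
  have e13 : z ≠ 13 := by omega
  have e14 : z ≠ 14 := by omega
  have e15 : z ≠ 15 := by omega
  have e16 : z ≠ 16 := by omega
  have e17 : z ≠ 17 := by omega
  have e18 : z ≠ 18 := by omega
  have e19 : z ≠ 19 := by omega
  have e20 : z ≠ 20 := by omega
  have e21 : z ≠ 21 := by omega
  have e100 : z ≠ 100 := by omega
  have e101 : z ≠ 101 := by omega
  simp [refineStep, splitCluster, search, Cmd.forList, Decremental.queryCmd, Cmd.KeepsVar,
    Cmd.keepsVar_shift _ h1, search_keepsVar (D := D) (show z < 13 by omega),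
    deleteSlots_keepsVar (D := D) h1 e9 e16 (show z ≠ 23 by omega) (show z ≠ 24 by omega),
    e8, e9, e10, e11, e12, e13, e14, e15, e16, e17, e18, e19, e20, e21, e100, e101]

theorem refineStep_keepsArr {D : Decremental} {z : ℕ} (hz : z < 14) :
    (refineStep D).KeepsArr z := by
  have h1 : z < 100 := by omega
  have e14 : z ≠ 14 := by omega
  have e15 : z ≠ 15 := by omega
  have e16 : z ≠ 16 := by omega
  have e17 : z ≠ 17 := by omega
  have e18 : z ≠ 18 := by omega
  simp [refineStep, splitCluster, search, Cmd.forList, Decremental.queryCmd, Cmd.KeepsArr,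
    Cmd.keepsArr_shift _ h1, search_keepsArr (D := D) h1 e15 e16,
    deleteSlots_keepsArr (D := D) h1 e17, e14, e15, e18]

end EdgeConn

/-! ### Recomputation of the partition for the stored edges -/

namespace EdgeConn

open WordRAM

namespace Net

variable {n : ℕ} (N : Net n)

/-- The edges as a list. -/
def edgeList : List (Fin n × Fin n) := List.ofFn fun i : Fin N.h => N.E i

theorem length_edgeList : N.edgeList.length = N.h := List.length_ofFn

theorem isEdgeList : IsEdgeList (graphOf N.edges) N.edgeList := by
  have hmem : ∀ i : Fin N.h, N.E i ∈ N.edges := fun i => N.mem_edges.2 ⟨i, i.2, rfl⟩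
  constructor
  · rw [edgeList, List.map_ofFn, List.nodup_ofFn]
    intro i j hij
    exact Fin.ext (N.inj _ i.2 _ j.2 (N.simple.inj (hmem i) (hmem j) hij))
  · intro e
    rw [mem_edgeSet_graphOf (I := N.edges) N.simple, List.mem_map]
    constructor
    · rintro ⟨p, hp, rfl⟩
      obtain ⟨i, rfl⟩ := List.mem_ofFn.1 hp
      exact ⟨_, hmem i, rfl⟩
    · rintro ⟨p, hp, rfl⟩
      obtain ⟨i, hi, rfl⟩ := N.mem_edges.1 hp
      exact ⟨_, List.mem_ofFn.2 ⟨⟨i, hi⟩, rfl⟩, rfl⟩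

theorem nc_le : N.nc ≤ n := by
  have := Finset.card_le_card_of_injOn (s := Finset.range N.nc) (t := Finset.univ) N.rep
    (fun _ _ => Finset.mem_univ _) (fun i hi j hj hij => by
      simp only [Finset.coe_range, Set.mem_Iio] at hi hj
      rw [← N.lab_rep i hi, hij, N.lab_rep j hj])
  simpa using this

theorem card_edges : N.edges.card = N.h := by
  rw [edges, Finset.card_image_of_injOn, Finset.card_range]
  intro i hi j hj hij
  simp only [Finset.coe_range, Set.mem_Iio] at hi hj
  exact N.inj i hi j hj hij

/-- The edges between different classes. -/
def cross : Finset (Fin n × Fin n) := N.edges.filter fun p => N.lab p.1 ≠ N.lab p.2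

/-- An edge between different classes has two slots, an edge within a class none. -/
theorem sum_length_adjList_le (a b : ℕ → ℕ) (M m : ℕ) :
    ∑ v ∈ Finset.range m, (adjList a b M v).length ≤
      2 * ((Finset.range M).filter fun i => a i ≠ b i).card := by
  induction M with
  | zero => simp [adjList]
  | succ M ih =>
    rw [Finset.range_add_one, Finset.filter_insert]
    simp only [adjList_succ]
    by_cases h : a M = b M
    · simpa [h] using ih
    · simp only [h, if_false]
      rw [if_pos h, Finset.card_insert_of_notMem (by simp)]
      have h1 : ∀ c, ∑ v ∈ Finset.range m, (if c = v then 1 else 0) ≤ 1 := fun c => by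
        rw [Finset.sum_ite_eq]
        split <;> omega
      have h2 := h1 (a M)
      have h3 := h1 (b M)
      have h4 : ∀ v, (if b M = v then (2 * M + 2) :: adjList a b M v
          else if a M = v then (2 * M + 1) :: adjList a b M v else adjList a b M v).length ≤
          (adjList a b M v).length + ((if a M = v then 1 else 0) + (if b M = v then 1 else 0)) := by
        intro v
        split_ifs <;> simp
      have h5 := Finset.sum_le_sum fun v (_ : v ∈ Finset.range m) => h4 v
      rw [Finset.sum_add_distrib, Finset.sum_add_distrib] at h5
      omega

/-- The search cost depends only on the edges between classes, not on all stored edges. -/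
theorem tot_le : N.tot ≤ N.nc + 2 * N.cross.card := by
  have h1 := sum_length_adjList_le N.a N.b N.h N.nc
  have h2 : ((Finset.range N.h).filter fun i => N.a i ≠ N.b i).card = N.cross.card := by
    rw [cross, edges, Finset.filter_image, Finset.card_image_of_injOn]
    · rfl
    · intro i hi j hj hij
      simp only [Finset.coe_filter, Finset.mem_range, Set.mem_ofPred_eq] at hi hj
      exact N.inj i hi.1 j hj.1 hij
  rw [tot]
  simp only [wt, L, Finset.sum_add_distrib, Finset.sum_const, Finset.card_range, smul_eq_mul,
    mul_one]
  omega

/-- The memory holds the edges, the labels and the representatives. -/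
structure Held (k : ℕ) (s : State) : Prop where
  vars : s.var 0 = n ∧ s.var 2 = k ∧ s.var 3 = N.h ∧ s.var 5 = N.nc
  lab : ∀ u : Fin n, s.arr 7 u = N.lab u
  rep : ∀ a < N.nc, s.arr 8 a = N.rep a
  edge : ∀ i < N.h, s.arr 9 i = (N.E i).1 ∧ s.arr 10 i = (N.E i).2

theorem Held.congr {N : Net n} {k : ℕ} {s s' : State} (h : N.Held k s)
    (hv : ∀ z, z = 0 ∨ z = 2 ∨ z = 3 ∨ z = 5 → s'.var z = s.var z)
    (ha : ∀ z, 7 ≤ z → z ≤ 10 → s'.arr z = s.arr z) : N.Held k s' := by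
  constructor
  · rw [hv 0 (by simp), hv 2 (by simp), hv 3 (by simp), hv 5 (by simp)]; exact h.vars
  · rw [ha 7 (by norm_num) (by norm_num)]; exact h.lab
  · rw [ha 8 (by norm_num) (by norm_num)]; exact h.rep
  · rw [ha 9 (by norm_num) (by norm_num), ha 10 (by norm_num) (by norm_num)]; exact h.edge

end Net

/-- Passes the edges to the decremental algorithm. -/
def initDecremental (D : Decremental) : Cmd :=
  .seq (.assign 100 (.var 0)) <| .seq (.assign 101 (.var 3)) <| .seq (.assign 102 (.var 2)) <|
  .seq (Cmd.for 6 3 (.seq (.store 100 (.var 6) (.load 9 (.var 6)))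
    (.store 101 (.var 6) (.load 10 (.var 6)))))
    D.init.shift

/-- Puts all classes into one cluster and on the stack. -/
def initClusters : Cmd :=
  .seq (Cmd.for 6 5 (.seq (.store 11 (.var 6) (.lit 0)) <| .seq (.store 14 (.var 6) (.lit 0)) <|
    .seq (.store 15 (.var 6) (.lit 0)) (.store 17 (.var 6) (.var 6)))) <|
  .seq (.store 18 (.lit 0) (.lit 0)) <| .seq (.assign 8 (.lit 1)) <| .assign 9 (.var 5)

/-- Writes the labels that result from the clusters. -/
def relabel : Cmd :=
  .seq (Cmd.for 7 0 (.seq (.store 7 (.var 7) (.load 14 (.load 7 (.var 7))))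
    (.store 8 (.load 7 (.var 7)) (.var 7)))) (.assign 5 (.var 8))

/-- Replaces the labels by those of the maximal `k`-edge-connected subgraphs of the graph of the
stored edges. -/
def solve (D : Decremental) : Cmd :=
  .seq (initDecremental D) <| .seq initClusters <|
  .seq (buildAdj 11 12 13 3 (.load 7 (.load 9 (.var 6))) (.load 7 (.load 10 (.var 6)))) <|
  .seq (.loop (.var 9) (refineStep D)) relabel

section

variable {n : ℕ} {N : Net n} {D : Decremental} {K : Set ℕ} {tp tq : ℕ → ℕ → ℝ} {w c k : ℕ}
  {s : State}

/-- The decremental algorithm receives the uncontracted graph on all `n` vertices with every stored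
edge, including those inside classes. -/
theorem does_initDecremental (hD : D.Supports K tp tq c) (hkK : k ∈ K) (hn : 2 ≤ n)
    (hw : (n + k + 2) ^ c ≤ 2 ^ w) (hh : 2 * N.h + 2 < 2 ^ w) (hs : s.IsWord w)
    (h : N.Held k s) :
    Does w (initDecremental D) s fun t s' => ∃ B, t + B ≤ ⌊tp k n * (n + N.h)⌋₊ + 20 * N.h + 20 ∧
      D.Ready w k (tq k n) (graphOf N.edges) B s'.high ∧
      (∀ z, z ≠ 6 → z < 100 → s'.var z = s.var z) ∧ (∀ z, z < 100 → s'.arr z = s.arr z) := by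
  obtain ⟨hv0, hv2, hv3, -⟩ := h.vars
  unfold initDecremental
  rw [does_seq, does_assign, does_seq, does_assign, does_seq, does_assign, does_seq]
  set s₁ := ((s.setVar 100 (Expr.eval w s (.var 0))).setVar 101 (Expr.eval w _ (.var 3))).setVar 102
    (Expr.eval w _ (.var 2)) with hs₁
  have hs1w : s₁.IsWord w := by
    refine State.IsWord.setVar (State.IsWord.setVar (State.IsWord.setVar hs _ ?_) _ ?_) _ ?_
    · exact hs.1 _
    · exact Expr.eval_lt (hs.setVar _ (hs.1 _)) _
    · exact Expr.eval_lt ((hs.setVar _ (hs.1 _)).setVar _ (Expr.eval_lt (hs.setVar _ (hs.1 _)) _)) _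
  have h1v : ∀ z, z < 100 → s₁.var z = s.var z := fun z hz => by
    have e1 : z ≠ 100 := by omega
    have e2 : z ≠ 101 := by omega
    have e3 : z ≠ 102 := by omega
    simp [hs₁, e1, e2, e3]
  have h100 : s₁.var 100 = n := by simp [hs₁, Expr.eval, hv0]
  have h101 : s₁.var 101 = N.h := by simp [hs₁, Expr.eval, hv3]
  have h102 : s₁.var 102 = k := by simp [hs₁, Expr.eval, hv2]
  have h1a : s₁.arr = s.arr := rfl
  clear_value s₁
  refine ((does_for (N := N.h) (fun i τ s' => τ ≤ 20 * i ∧ ∀ j < i,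
    s'.arr 100 j = (N.E j).1 ∧ s'.arr 101 j = (N.E j).2) (20 * N.h) (by norm_num)
    (by simp [Cmd.KeepsVar]) (by simp [Cmd.KeepsVar]) ((h1v 3 (by norm_num)).trans hv3) (by omega)
    (by simp) (fun i τ s' hi h => h.1.trans (by omega)) ?_).isWord hs1w).mono ?_
  · rintro i τ s' hi ⟨hτ, hI⟩ h6 - - hfa
    have h9 : s'.arr 9 = s.arr 9 := (hfa 9 (by simp [Cmd.KeepsArr])).trans (by rw [h1a])
    have h10 : s'.arr 10 = s.arr 10 := (hfa 10 (by simp [Cmd.KeepsArr])).trans (by rw [h1a])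
    rw [does_seq, does_store, does_store]
    refine ⟨by simp only [Expr.cost]; omega, fun j hj => ?_⟩
    simp only [Expr.eval, arr_setVar, arr_setArr, var_setArr, h6, h9, h10]
    simp only [Nat.reduceEqDiff, if_true, if_false]
    rcases Nat.lt_succ_iff_lt_or_eq.1 hj with hj | rfl
    · rw [Function.update_of_ne hj.ne, Function.update_of_ne hj.ne]; exact hI j hj
    · rw [Function.update_self, Function.update_self]; exact h.edge j hi
  · rintro t s₂ ⟨⟨τ, rfl, ⟨hτ, hI⟩, -, hfv, hfa⟩, hs2w⟩
    have hkv : ∀ z, z ≠ 6 → s₂.var z = s₁.var z := fun z hz => hfv z hz (by simp [Cmd.KeepsVar])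
    refine does_shift ((hD.init hkK hn N.isEdgeList hw hs2w.high ⟨?_, ?_, ?_, ?_⟩).mono ?_)
    · exact (hkv 100 (by norm_num)).trans h100
    · exact (hkv 101 (by norm_num)).trans (h101.trans N.length_edgeList.symm)
    · exact (hkv 102 (by norm_num)).trans h102
    · intro i hi
      rw [N.length_edgeList] at hi
      have : N.edgeList[i]'(by rw [N.length_edgeList]; exact hi) = N.E i := by
        simp [Net.edgeList]
      rw [this]
      exact hI i hi
    · rintro t p ⟨ht, hr⟩
      rw [N.length_edgeList] at ht hr
      refine ⟨⌊tp k n * (n + N.h)⌋₊ - t, ?_, by rw [State.high_withHigh]; exact hr, ?_, ?_⟩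
      · simp only [Expr.cost]
        omega
      · intro z h6 hz
        rw [State.var_withHigh hz, hkv z h6, h1v z hz]
      · intro z hz
        rw [State.arr_withHigh hz, hfa z (by simp [Cmd.KeepsArr]; omega), h1a]

theorem does_initClusters (hw : N.nc + 1 < 2 ^ w) (h5 : s.var 5 = N.nc) :
    Does w initClusters s fun t s' => t ≤ 30 * N.nc + 20 ∧ s'.var 8 = 1 ∧ s'.var 9 = N.nc ∧
      (∀ v < N.nc, s'.arr 11 v = 0 ∧ s'.arr 14 v = 0 ∧ s'.arr 15 v = 0 ∧ s'.arr 17 v = v) ∧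
      s'.arr 18 0 = 0 ∧ s'.high = s.high ∧ (∀ z, z < 6 → s'.var z = s.var z) ∧
      ∀ z, z < 11 → s'.arr z = s.arr z := by
  have hone : 1 % 2 ^ w = 1 := Nat.mod_eq_of_lt (by omega)
  unfold initClusters
  rw [does_seq]
  refine (does_for (N := N.nc) (fun i τ s' => τ ≤ 30 * i ∧ s'.high = s.high ∧ ∀ v < i,
    s'.arr 11 v = 0 ∧ s'.arr 14 v = 0 ∧ s'.arr 15 v = 0 ∧ s'.arr 17 v = v) (30 * N.nc) (by norm_num)
    (by simp [Cmd.KeepsVar]) (by simp [Cmd.KeepsVar]) h5 (by omega)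
    (by simp [State.high_setVar_low]) (fun i τ s' hi h => h.1.trans (by omega)) ?_).mono ?_
  · rintro i τ s' hi ⟨hτ, hhi, hI⟩ h6 - - -
    simp only [does_seq, does_store]
    refine ⟨by simp only [Expr.cost]; omega, by
      simp only [State.high_setVar_low, State.high_setArr_low, Nat.reduceLT, hhi], fun v hv => ?_⟩
    simp only [Expr.eval, arr_setVar, arr_setArr, var_setArr, h6]
    simp only [Nat.reduceEqDiff, if_true, if_false, Nat.zero_mod]
    rcases Nat.lt_succ_iff_lt_or_eq.1 hv with hv | rfl
    · simp only [Function.update_of_ne hv.ne]; exact hI v hv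
    · simp
  · rintro t s₁ ⟨τ, rfl, ⟨hτ, hhi, hI⟩, -, hfv, hfa⟩
    simp only [does_seq, does_store, does_assign]
    refine ⟨by simp only [Expr.cost]; omega, by simp [Expr.eval, hone], ?_, ?_, ?_, ?_, ?_, ?_⟩
    · simp [Expr.eval, hfv 5 (by norm_num) (by simp [Cmd.KeepsVar]), h5]
    · simpa using hI
    · simp [Expr.eval]
    · simp only [State.high_setVar_low, State.high_setArr_low, Nat.reduceLT, hhi]
    · intro z hz
      have e1 : z ≠ 9 := by omega
      have e2 : z ≠ 8 := by omega
      simp [e1, e2, hfv z (by omega) (by simp [Cmd.KeepsVar])]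
    · intro z hz
      have e1 : z ≠ 18 := by omega
      simp only [arr_setVar, arr_setArr, e1, if_false]
      exact hfa z (by simp [Cmd.KeepsArr]; omega)

theorem stack_range {f : ℕ → ℕ} {m : ℕ} (hf : ∀ v < m, f v = v) :
    Stack f (List.range m).reverse := by
  induction m with
  | zero => trivial
  | succ m ih =>
    rw [List.range_succ, List.reverse_append]
    refine ⟨?_, ih fun v hv => hf v (by omega)⟩
    have : ((List.append [] (List.range m).reverse)).length = m := by simp
    exact (congrArg f this).trans (hf m (by omega))

/-- Each vertex writes itself as representative of its new class; whichever entry remains is a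
vertex of that class. -/
theorem does_relabelVertices {comp : ℕ → ℕ} {ncl : ℕ} (hw : n < 2 ^ w) (h0 : s.var 0 = n)
    (h8 : s.var 8 = ncl) (hlab : ∀ u : Fin n, s.arr 7 u = N.lab u) (h14 : s.arr 14 = comp) :
    Does w relabel s fun t s' => t ≤ 30 * n + 10 ∧ s'.var 5 = ncl ∧
      (∀ u : Fin n, s'.arr 7 u = comp (N.lab u)) ∧
      (∀ u : Fin n, ∃ v : Fin n, s'.arr 8 (comp (N.lab u)) = v ∧ comp (N.lab v) = comp (N.lab u)) ∧
      (∀ z, z < 5 → s'.var z = s.var z) ∧ ∀ z, z ≠ 7 → z ≠ 8 → s'.arr z = s.arr z := by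
  unfold relabel
  rw [does_seq]
  refine (does_for (N := n) (fun i τ s' => τ ≤ 30 * i ∧
    (∀ u : Fin n, s'.arr 7 u = if (u : ℕ) < i then comp (N.lab u) else N.lab u) ∧
    ∀ u : Fin n, (u : ℕ) < i →
      ∃ v : Fin n, s'.arr 8 (comp (N.lab u)) = v ∧ comp (N.lab v) = comp (N.lab u)) (30 * n)
    (by norm_num) (by simp [Cmd.KeepsVar]) (by simp [Cmd.KeepsVar]) h0 hw
    (by simpa using hlab) (fun i τ s' hi h => h.1.trans (by omega)) ?_).mono ?_
  · rintro i τ s' hi ⟨hτ, h1, h2⟩ h7 - - hfa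
    have h14' : s'.arr 14 = comp := (hfa 14 (by simp [Cmd.KeepsArr])).trans h14
    have hi7 : s'.arr 7 i = N.lab ⟨i, hi⟩ := by simpa using h1 ⟨i, hi⟩
    rw [does_seq, does_store, does_store]
    simp only [Expr.eval, arr_setVar, arr_setArr, var_setArr, h7, h14', hi7]
    simp only [Nat.reduceEqDiff, if_true, if_false, Function.update_self]
    refine ⟨by simp only [Expr.cost]; omega, fun u => ?_, fun u hu => ?_⟩
    · rw [Function.update_apply, h1]
      by_cases hu : (u : ℕ) = i
      · have : u = ⟨i, hi⟩ := Fin.ext hu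
        subst this
        simp
      · have e1 : (u : ℕ) < i + 1 ↔ (u : ℕ) < i := by omega
        simp [hu, e1]
    · rw [Function.update_apply]
      split
      · next h => exact ⟨⟨i, hi⟩, rfl, h.symm⟩
      · next h =>
        refine h2 u ?_
        by_contra hc
        exact h (by rw [show u = ⟨i, hi⟩ from Fin.ext (by simp only; omega)])
  · rintro t s₁ ⟨τ, rfl, ⟨hτ, h1, h2⟩, -, hfv, hfa⟩
    rw [does_assign]
    refine ⟨by simp only [Expr.cost]; omega, ?_, ?_, ?_, ?_, ?_⟩
    · simp [Expr.eval, hfv 8 (by norm_num) (by simp [Cmd.KeepsVar]), h8]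
    · simpa using h1
    · simpa using h2
    · intro z hz
      have e1 : z ≠ 5 := by omega
      simp [e1, hfv z (by omega) (by simp [Cmd.KeepsVar])]
    · intro z e7 e8
      exact hfa z (by simp [Cmd.KeepsArr, e7, e8])

/-- The hypothesis `hcls` allows whole classes to be treated as nodes; no maximal k-edge-connected
subgraph splits one. -/
theorem does_solve (hD : D.Supports K tp tq c) (hkK : k ∈ K) (hk : 1 ≤ k) (hn : 2 ≤ n)
    (hw : (n + k + 2) ^ c ≤ 2 ^ w) (hh : n + 2 * N.h + 2 < 2 ^ w) (hs : s.IsWord w)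
    (hcls : ∀ u, KEC k N.edges {v | N.lab v = N.lab u}) (h : N.Held k s) :
    Does w (solve D) s fun t s' => ∃ N' : Net n, N'.h = N.h ∧ N'.E = N.E ∧ N'.Held k s' ∧
      IsKPart k N.edges N'.lab ∧
      t ≤ ⌊tp k n * (n + N.h)⌋₊ + (4 * ⌊tq k n⌋₊ + 360) * (N.tot * Nat.log 2 N.tot) +
        (⌊tq k n⌋₊ + 30) * n + 100 * (n + N.h) + 100 ∧
      (∀ z, z < 5 → s'.var z = s.var z) ∧ ∀ z, z < 7 → s'.arr z = s.arr z := by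
  have hncn := N.nc_le
  have hnc0 : 0 < N.nc := (Nat.zero_le _).trans_lt (N.lab_lt ⟨0, by omega⟩)
  obtain ⟨-, -, hv3, hv5⟩ := h.vars
  unfold solve
  rw [does_seq]
  refine (does_initDecremental hD hkK hn hw (by omega) hs h).mono ?_
  rintro t₁ s₁ ⟨B, ht1, hr1, hv1, ha1⟩
  rw [does_seq]
  refine (does_initClusters (N := N) (by omega)
    ((hv1 5 (by norm_num) (by norm_num)).trans hv5)).mono ?_
  rintro t₂ s₂ ⟨ht2, h28, h29, hz2, h218, hhi2, hv2, ha2⟩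
  have hH2 : N.Held k s₂ := h.congr (fun z hz => by
      rw [hv2 z (by omega), hv1 z (by omega) (by omega)]) fun z h1 h2 => by
      rw [ha2 z (by omega), ha1 z (by omega)]
  rw [does_seq]
  refine (does_buildAdj (N := N.nc) (a := N.a) (b := N.b) (M := N.h) (by norm_num) (by norm_num)
    hH2.vars.2.2.1 (by omega) (by simp [Expr.cost]) (by simp [Expr.cost]) ?_ ?_
    fun v hv => (hz2 v hv).1).agree.mono ?_
  · intro s i hi h6 hz
    simp only [Expr.eval, h6, hz 9 (by norm_num) (by norm_num) (by norm_num),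
      hz 7 (by norm_num) (by norm_num) (by norm_num), (hH2.edge i hi).1, hH2.lab]
    rfl
  · intro s i hi h6 hz
    simp only [Expr.eval, h6, hz 10 (by norm_num) (by norm_num) (by norm_num),
      hz 7 (by norm_num) (by norm_num) (by norm_num), (hH2.edge i hi).2, hH2.lab]
    rfl
  rintro t₃ s₃ ⟨⟨ht3, hadj, hv3', ha3⟩, hA3⟩
  have hhi3 : s₃.high = s₂.high := by
    refine hA3.high (fun x hx => ?_) fun a ha => ?_
    · simp [buildAdj, Cmd.for, Cmd.KeepsVar]; omega
    · simp [buildAdj, Cmd.for, Cmd.KeepsArr]; omega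
  have hH3 : N.Held k s₃ := hH2.congr (fun z hz => hv3' z (by omega) (by omega) (by omega)
    (by omega)) fun z h1 h2 => ha3 z (by omega) (by omega) (by omega)
  have hcomp0 : ∀ v < N.nc, s₃.arr 14 v = 0 := fun v hv => by
    rw [ha3 14 (by norm_num) (by norm_num) (by norm_num)]; exact (hz2 v hv).2.1
  have hcur : N.cur (s₃.arr 14) = N.edges := by
    refine Finset.filter_true_of_mem fun p _ => ?_
    simp only [hcomp0 _ (N.lab_lt _)]
  have hanc0 : s₃.arr 18 0 = 0 := by
    rw [ha3 18 (by norm_num) (by norm_num) (by norm_num)]; exact h218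
  -- The stack starts with all classes, and each of the `N.h` edges can push two more.
  have hI : SolveInv N D w k (tq k n) (N.nc + 2 * N.h) (s₃.arr 14) (s₃.arr 18) 1
      (List.range N.nc).reverse (List.range N.nc).reverse B s₃ := by
    refine ⟨(hv3' 8 (by norm_num) (by norm_num) (by norm_num) (by norm_num)).trans h28, rfl, rfl,
      ⟨hH3.rep, hH3.edge, fun v hv => (hadj v hv).1, fun v hv => (hadj v hv).2⟩, ?_, ?_, ?_, ?_,
      ?_, ?_, ?_, ?_, ?_⟩
    · rw [hcur, hhi3, hhi2]; exact hr1
    · refine Refines.init (fun u => hcomp0 _ (N.lab_lt u)) fun u => ?_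
      simpa using N.lab_lt u
    · intro v hv; rw [hcomp0 v hv]; exact one_pos
    · intro id hid
      have : id = 0 := by omega
      rw [this, hanc0]
      exact ⟨hnc0, hcomp0 0 hnc0⟩
    · intro v hv
      rw [ha3 15 (by norm_num) (by norm_num) (by norm_num), (hz2 v hv).2.2.1]; exact one_pos
    · rw [ha3 17 (by norm_num) (by norm_num) (by norm_num)]
      exact stack_range fun v hv => (hz2 v hv).2.2.2
    · rw [hv3' 9 (by norm_num) (by norm_num) (by norm_num) (by norm_num), h29]; simp
    · intro a ha; simpa using ha
    · rw [hcur, N.card_edges]; simp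
  rw [does_seq]
  refine (does_refineLoop hk hcls (by omega) (by omega) (by omega) hI).mono ?_
  rintro t₄ s₄ ⟨comp, anchor, ncl, B', ht4, hI4, hA4⟩
  have hv4 : ∀ z, z < 8 → s₄.var z = s₃.var z := fun z hz => hA4.1 z (refineStep_keepsVar hz)
  have ha4 : ∀ z, z < 14 → s₄.arr z = s₃.arr z := fun z hz => hA4.2 z (refineStep_keepsArr hz)
  have hH4 : N.Held k s₄ := hH3.congr (fun z hz => hv4 z (by omega)) fun z h1 h2 => ha4 z (by omega)
  refine (does_relabelVertices (N := N) (n := n) (comp := comp) (ncl := ncl) (by omega) hH4.vars.1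
    hI4.var8 hH4.lab hI4.arr14).mono ?_
  rintro t₅ s₅ ⟨ht5, h55, h57, h58, hv5', ha5⟩
  have hex : ∀ a < ncl, ∃ v : Fin n, comp (N.lab v) = a ∧ s₅.arr 8 a = v := by
    intro a ha
    obtain ⟨h1, h2⟩ := hI4.anchor_ok a ha
    obtain ⟨v, h3, h4⟩ := h58 (N.rep (anchor a))
    rw [N.lab_rep _ h1, h2] at h3 h4
    exact ⟨v, h4, h3⟩
  have : Nonempty (Fin n) := ⟨⟨0, by omega⟩⟩
  choose! rep hrep using hex
  refine ⟨⟨N.h, N.E, fun u => comp (N.lab u), ncl, rep, fun u => hI4.comp_lt _ (N.lab_lt u),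
    fun a ha => (hrep a ha).1, N.inj, N.simple⟩, rfl, rfl, ?_, hI4.refines.isKPart hcls, ?_, ?_, ?_⟩
  · obtain ⟨h1, h2, h3, -⟩ := hH4.vars
    refine ⟨⟨by rw [hv5' 0 (by norm_num), h1], by rw [hv5' 2 (by norm_num), h2],
      by rw [hv5' 3 (by norm_num), h3], h55⟩, h57, fun a ha => (hrep a ha).2, ?_⟩
    rw [ha5 9 (by norm_num) (by norm_num), ha5 10 (by norm_num) (by norm_num)]
    exact hH4.edge
  · have h1 : (4 * ⌊tq k n⌋₊ + 360) * N.Phi (s₃.arr 14) ≤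
        (4 * ⌊tq k n⌋₊ + 360) * (N.tot * Nat.log 2 N.tot) := Nat.mul_le_mul_left _ (N.Phi_le _)
    have h2 : (⌊tq k n⌋₊ + 30) * (List.range N.nc).reverse.length ≤ (⌊tq k n⌋₊ + 30) * n :=
      Nat.mul_le_mul_left _ (by simpa using hncn)
    omega
  · intro z hz
    rw [hv5' z hz, hv4 z (by omega), hv3' z (by omega) (by omega) (by omega) (by omega),
      hv2 z (by omega), hv1 z (by omega) (by omega)]
  · intro z hz
    rw [ha5 z (by omega) (by omega), ha4 z (by omega), ha3 z (by omega) (by omega) (by omega),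
      ha2 z (by omega), ha1 z (by omega)]

end

end EdgeConn

/-! ### Adding edges, and counting the classes that have edges left -/

namespace EdgeConn

open WordRAM

namespace Net

variable {n : ℕ} (N : Net n)

/-- Appends an edge. -/
def push (p : Fin n × Fin n) (hp : p ∉ N.edges) (hs : Simple (insert p N.edges)) : Net n where
  h := N.h + 1
  E := Function.update N.E N.h p
  lab := N.lab
  nc := N.nc
  rep := N.rep
  lab_lt := N.lab_lt
  lab_rep := N.lab_rep
  inj := by
    have key : ∀ i < N.h, N.E i ≠ p := fun i hi h => hp (N.mem_edges.2 ⟨i, hi, h⟩)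
    intro i hi j hj hij
    rw [Function.update_apply, Function.update_apply] at hij
    by_cases h1 : i = N.h <;> by_cases h2 : j = N.h
    · omega
    · rw [if_pos h1, if_neg h2] at hij
      exact absurd hij.symm (key j (by omega))
    · rw [if_neg h1, if_pos h2] at hij
      exact absurd hij (key i (by omega))
    · rw [if_neg h1, if_neg h2] at hij
      exact N.inj i (by omega) j (by omega) hij
  simple := by
    convert hs using 1
    rw [Finset.range_add_one, Finset.image_insert, Function.update_self, edges]
    congr 1
    refine Finset.image_congr fun i hi => Function.update_of_ne ?_ _ _
    simp only [Finset.coe_range, Set.mem_Iio] at hi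
    omega

theorem edges_push {p : Fin n × Fin n} (hp : p ∉ N.edges) (hs : Simple (insert p N.edges)) :
    (N.push p hp hs).edges = insert p N.edges := by
  ext x
  rw [mem_edges, Finset.mem_insert, mem_edges]
  change (∃ i < N.h + 1, Function.update N.E N.h p i = x) ↔ _
  constructor
  · rintro ⟨i, hi, rfl⟩
    by_cases h : i = N.h
    · left; rw [h, Function.update_self]
    · right; exact ⟨i, by omega, (Function.update_of_ne h _ _).symm⟩
  · rintro (rfl | ⟨i, hi, rfl⟩)
    · exact ⟨N.h, by omega, Function.update_self _ _ _⟩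
    · exact ⟨i, by omega, Function.update_of_ne hi.ne _ _⟩

end Net

/-- The input graph: pairwise different edges `F 0, …, F (m - 1)`. -/
structure Source (n : ℕ) where
  m : ℕ
  F : ℕ → Fin n × Fin n
  inj : ∀ i < m, ∀ j < m, F i = F j → i = j
  simple : Simple ((Finset.range m).image F)

namespace Source

variable {n : ℕ} (S : Source n)

def edges : Finset (Fin n × Fin n) := (Finset.range S.m).image S.F

theorem mem_edges {p : Fin n × Fin n} : p ∈ S.edges ↔ ∃ i < S.m, S.F i = p := by
  simp [edges]

theorem card_edges : S.edges.card = S.m := by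
  rw [edges, Finset.card_image_of_injOn, Finset.card_range]
  intro i hi j hj hij
  simp only [Finset.coe_range, Set.mem_Iio] at hi hj
  exact S.inj i hi j hj hij

/-- The slots of a vertex. -/
def L (v : ℕ) : List ℕ := adjList (fun i => (S.F i).1) (fun i => (S.F i).2) S.m v

theorem mem_L {v x : ℕ} : x ∈ S.L v ↔ ∃ i < S.m,
    x = 2 * i + 1 ∧ (S.F i).1 = v ∨ x = 2 * i + 2 ∧ ((S.F i).2 : ℕ) = v := by
  rw [L, mem_adjList]
  refine exists_congr fun i => and_congr_right fun hi => ?_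
  have : ((S.F i).1 : ℕ) ≠ (S.F i).2 := fun h =>
    S.simple.ne _ (S.mem_edges.2 ⟨i, hi, rfl⟩) (Fin.ext h)
  simp [this]

/-- The memory holds the edges in `N`, which are marked as used, and for each vertex the list `rem`
of the slots that have not been considered. The edges of other slots are used or within classes. -/
structure Tracked (N : Net n) (rem : Fin n → List ℕ) (s : State) : Prop where
  edge : ∀ e < S.m, s.arr 0 e = (S.F e).1 ∧ s.arr 1 e = (S.F e).2
  chain : ∀ v : Fin n, Chain (s.arr 3) (s.arr 2 v) (rem v)
  suffix : ∀ v : Fin n, rem v <:+ S.L v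
  used : ∀ e < S.m, s.arr 5 e ≠ 0 ↔ S.F e ∈ N.edges
  popped : ∀ v : Fin n, ∀ x ∈ S.L v, x ∉ rem v →
    S.F ((x - 1) / 2) ∈ N.edges ∨ N.lab (S.F ((x - 1) / 2)).1 = N.lab (S.F ((x - 1) / 2)).2
  sub : N.edges ⊆ S.edges

variable {S} {N N' : Net n} {rem rem' : Fin n → List ℕ} {s s' : State}

theorem Tracked.congr (h : S.Tracked N rem s) (ha : ∀ z, z < 6 → z ≠ 4 → s'.arr z = s.arr z) :
    S.Tracked N rem s' := by
  refine ⟨?_, ?_, h.suffix, ?_, h.popped, h.sub⟩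
  · rw [ha 0 (by norm_num) (by norm_num), ha 1 (by norm_num) (by norm_num)]; exact h.edge
  · rw [ha 3 (by norm_num) (by norm_num), ha 2 (by norm_num) (by norm_num)]; exact h.chain
  · rw [ha 5 (by norm_num) (by norm_num)]; exact h.used

theorem Tracked.h_le (h : S.Tracked N rem s) : N.h ≤ S.m := by
  rw [← N.card_edges, ← S.card_edges]
  exact Finset.card_le_card h.sub

/-- The two ends of an edge that is neither used nor within a class have been left. -/
theorem Tracked.rem_ne_nil (h : S.Tracked N rem s) {p : Fin n × Fin n} (hp : p ∈ S.edges)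
    (hpN : p ∉ N.edges) (hc : N.lab p.1 ≠ N.lab p.2) : rem p.1 ≠ [] ∧ rem p.2 ≠ [] := by
  obtain ⟨e, he, rfl⟩ := S.mem_edges.1 hp
  constructor
  · intro hr
    have e1 : (2 * e + 1 - 1) / 2 = e := by omega
    have := h.popped (S.F e).1 (2 * e + 1) (S.mem_L.2 ⟨e, he, Or.inl ⟨rfl, rfl⟩⟩) (by simp [hr])
    rw [e1] at this
    exact this.elim hpN hc
  · intro hr
    have e1 : (2 * e + 2 - 1) / 2 = e := by omega
    have := h.popped (S.F e).2 (2 * e + 2) (S.mem_L.2 ⟨e, he, Or.inr ⟨rfl, rfl⟩⟩) (by simp [hr])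
    rw [e1] at this
    exact this.elim hpN hc

/-- The classes that have a slot left. -/
def active (lab : Fin n → ℕ) (rem : Fin n → List ℕ) : Finset ℕ :=
  (Finset.univ.filter fun v => rem v ≠ []).image lab

theorem mem_active {lab : Fin n → ℕ} {a : ℕ} : a ∈ active lab rem ↔ ∃ v, rem v ≠ [] ∧ lab v = a := by
  simp [active]

/-- The new edges that are charged to the class `a`. -/
def charged (N N' : Net n) (ch : Fin n × Fin n → ℕ) (a : ℕ) : Finset (Fin n × Fin n) :=
  (N'.edges \ N.edges).filter fun p => ch p = a

theorem mem_charged {ch : Fin n × Fin n → ℕ} {a : ℕ} {p : Fin n × Fin n} :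
    p ∈ charged N N' ch a ↔ (p ∈ N'.edges ∧ p ∉ N.edges) ∧ ch p = a := by
  simp [charged]

/-- The situation while edges are added to `N`, at most `q` of which are charged to any class. -/
structure Adding (S : Source n) (N : Net n) (rem : Fin n → List ℕ) (k q : ℕ) (s : State)
    (N' : Net n) (rem' : Fin n → List ℕ) (ch : Fin n × Fin n → ℕ) : Prop where
  lab_eq : N'.lab = N.lab
  nc_eq : N'.nc = N.nc
  subset : N.edges ⊆ N'.edges
  tracked : S.Tracked N' rem' s
  held : N'.Held k s
  var4 : s.var 4 = q
  new : ∀ p ∈ N'.edges, p ∉ N.edges → N.lab p.1 ≠ N.lab p.2 ∧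
    (N.lab p.1 = ch p ∨ N.lab p.2 = ch p)
  count : ∀ a < N.nc, s.arr 6 a = (charged N N' ch a).card
  le : ∀ a < N.nc, (charged N N' ch a).card ≤ q
  suffix : ∀ v, rem' v <:+ rem v

/-- A new edge charged to a class that is not merged with another active class runs between
different classes after the merging. -/
theorem two_mul_active_le {k q : ℕ} {ch : Fin n × Fin n → ℕ} {lab' : Fin n → ℕ} {s₀ : State}
    (h0 : S.Tracked N rem s₀) (h : Adding S N rem k q s N' rem' ch)
    (hdone : ∀ v, rem' v ≠ [] → (charged N N' ch (N.lab v)).card = q)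
    (hcoarse : ∀ u v, N.lab u = N.lab v → lab' u = lab' v) (hP : IsKPart k N'.edges lab') :
    2 * (q * (active lab' rem').card) ≤ q * (active N.lab rem).card + k * n := by
  classical
  set A := active N.lab rem with hA
  set A' := active lab' rem' with hA'
  have hg : ∀ u, lab' (N.rep (N.lab u)) = lab' u := fun u =>
    hcoarse _ _ (N.lab_rep _ (N.lab_lt u))
  set g : ℕ → ℕ := fun a => lab' (N.rep a) with hgdef
  -- A vertex with slots left lies in an old class that was already active and has received its full
  -- charge.
  have hσ : ∀ x ∈ A', ∃ a ∈ A, g a = x ∧ (charged N N' ch a).card = q := by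
    intro x hx
    obtain ⟨v, hv, rfl⟩ := mem_active.1 hx
    refine ⟨N.lab v, mem_active.2 ⟨v, fun hr => hv ?_, rfl⟩, hg v, hdone v hv⟩
    have := h.suffix v
    rw [hr] at this
    exact List.suffix_nil.1 this
  choose! σ hσA hσg hσq using hσ
  -- The new active classes with only one old active class inside. All others contain at least two,
  -- so `2 |A'| ≤ |A| + |A₁|`.
  set A₁ := A'.filter fun x => ∀ a ∈ A, g a = x → a = σ x with hA₁
  have hsum : ∑ x ∈ A', (2 : ℕ) ≤ ∑ x ∈ A', ((A.filter fun a => g a = x).card +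
      if x ∈ A₁ then 1 else 0) := by
    refine Finset.sum_le_sum fun x hx => ?_
    have hmem : σ x ∈ A.filter fun a => g a = x := Finset.mem_filter.2 ⟨hσA x hx, hσg x hx⟩
    split
    · have := Finset.card_pos.2 ⟨_, hmem⟩
      omega
    · next hc =>
      have hc : ¬∀ a ∈ A, g a = x → a = σ x := fun hc' => hc (Finset.mem_filter.2 ⟨hx, hc'⟩)
      push Not at hc
      obtain ⟨a, ha, hax, hne⟩ := hc
      have : 1 < (A.filter fun a => g a = x).card :=
        Finset.one_lt_card.2 ⟨a, Finset.mem_filter.2 ⟨ha, hax⟩, _, hmem, hne⟩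
      omega
  rw [Finset.sum_add_distrib, Finset.sum_ite_mem, Finset.sum_card_fiberwise_eq_card_filter,
    Finset.sum_const, Finset.sum_const, smul_eq_mul, smul_eq_mul] at hsum
  have hint : (A' ∩ A₁).card ≤ A₁.card := Finset.card_le_card Finset.inter_subset_right
  have hfl := Finset.card_filter_le A fun a => g a ∈ A'
  have hcross := hP.card_cross_le
  rw [Fintype.card_fin] at hcross
  -- Both ends of a new edge were active. If an edge charged to `σ x` stayed inside `x`, both of its
  -- ends would be in `σ x`, contrary to the choice of edges between different classes.
  have hq : q * A₁.card ≤ (N'.edges.filter fun p => lab' p.1 ≠ lab' p.2).card := by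
    have hdisj : ∀ x ∈ A₁, ∀ y ∈ A₁, x ≠ y →
        Disjoint (charged N N' ch (σ x)) (charged N N' ch (σ y)) := by
      intro x hx y hy hxy
      rw [Finset.disjoint_left]
      intro p hp hp'
      refine hxy ?_
      rw [← hσg x (Finset.mem_filter.1 hx).1, ← hσg y (Finset.mem_filter.1 hy).1,
        ← (mem_charged.1 hp).2, ← (mem_charged.1 hp').2]
    have hcard := Finset.card_biUnion hdisj
    rw [Finset.sum_congr rfl fun x hx => hσq x (Finset.mem_filter.1 hx).1, Finset.sum_const,
      smul_eq_mul] at hcard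
    rw [mul_comm, ← hcard]
    refine Finset.card_le_card fun p hp => ?_
    obtain ⟨x, hx, hp⟩ := Finset.mem_biUnion.1 hp
    obtain ⟨hxA, huniq⟩ := Finset.mem_filter.1 hx
    obtain ⟨⟨hp1, hp2⟩, hpc⟩ := mem_charged.1 hp
    obtain ⟨hne, hend⟩ := h.new p hp1 hp2
    obtain ⟨hr1, hr2⟩ := h0.rem_ne_nil (h.tracked.sub hp1) hp2 hne
    refine Finset.mem_filter.2 ⟨hp1, fun heq => hne ?_⟩
    have hx1 : lab' p.1 = x ∧ lab' p.2 = x := by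
      rcases hend with he | he
      · have : lab' p.1 = x := by rw [← hg, he, hpc]; exact hσg x hxA
        exact ⟨this, heq ▸ this⟩
      · have : lab' p.2 = x := by rw [← hg, he, hpc]; exact hσg x hxA
        exact ⟨heq ▸ this, this⟩
    rw [huniq _ (mem_active.2 ⟨p.1, hr1, rfl⟩) ((hg _).trans hx1.1),
      huniq _ (mem_active.2 ⟨p.2, hr2, rfl⟩) ((hg _).trans hx1.2)]
  have h1 : q * (A'.card * 2) ≤ q * (A.card + A₁.card) := Nat.mul_le_mul_left _ (by omega)
  rw [mul_add] at h1
  calc 2 * (q * A'.card) = q * (A'.card * 2) := by ring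
    _ ≤ _ := by omega

/-- Only active classes are charged, each at most `q` times. -/
theorem h_le_add {k q : ℕ} {ch : Fin n × Fin n → ℕ} {s₀ : State}
    (h0 : S.Tracked N rem s₀) (h : Adding S N rem k q s N' rem' ch) :
    N'.h ≤ N.h + q * (active N.lab rem).card := by
  have h1 : ∀ p ∈ N'.edges \ N.edges, ch p ∈ active N.lab rem := by
    intro p hp
    obtain ⟨hp1, hp2⟩ := Finset.mem_sdiff.1 hp
    obtain ⟨hne, hend⟩ := h.new p hp1 hp2
    obtain ⟨hr1, hr2⟩ := h0.rem_ne_nil (h.tracked.sub hp1) hp2 hne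
    rcases hend with he | he
    · exact mem_active.2 ⟨_, hr1, he⟩
    · exact mem_active.2 ⟨_, hr2, he⟩
  have h2 := Finset.card_eq_sum_card_fiberwise h1
  have h3 : ∑ a ∈ active N.lab rem, ((N'.edges \ N.edges).filter fun p => ch p = a).card ≤
      ∑ a ∈ active N.lab rem, q := by
    refine Finset.sum_le_sum fun a ha => ?_
    obtain ⟨v, -, rfl⟩ := mem_active.1 ha
    exact h.le _ (N.lab_lt v)
  rw [← h2, Finset.sum_const, smul_eq_mul, Finset.card_sdiff_of_subset h.subset, N'.card_edges,
    N.card_edges, mul_comm] at h3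
  omega

end Source

end EdgeConn

/-! ### The program that adds a batch -/

namespace EdgeConn

open WordRAM

namespace Source

section Adding

variable {n : ℕ} {S : Source n} {N N' : Net n} {rem rem' : Fin n → List ℕ} {k q : ℕ}
  {s s' : State} {ch : Fin n × Fin n → ℕ} {v : Fin n} {x e : ℕ} {rest : List ℕ}

theorem slot_cases (h : x ∈ S.L v) : (x - 1) / 2 < S.m ∧ 1 ≤ x ∧ x ≤ 2 * S.m ∧
    ((S.F ((x - 1) / 2)).1 = v ∨ (S.F ((x - 1) / 2)).2 = v) := by
  obtain ⟨i, hi, ⟨rfl, h'⟩ | ⟨rfl, h'⟩⟩ := S.mem_L.1 h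
  · have : (2 * i + 1 - 1) / 2 = i := by omega
    rw [this]
    exact ⟨hi, by omega, by omega, Or.inl (Fin.ext h')⟩
  · have : (2 * i + 2 - 1) / 2 = i := by omega
    rw [this]
    exact ⟨hi, by omega, by omega, Or.inr (Fin.ext h')⟩

theorem Adding.mem_L (h : Adding S N rem k q s N' rem' ch) (hr : rem' v = x :: rest) :
    x ∈ S.L v :=
  (h.tracked.suffix v).subset (by rw [hr]; exact List.mem_cons_self)

/-- Removes the first slot of a vertex. -/
theorem Adding.pop (h : Adding S N rem k q s N' rem' ch) (hr : rem' v = x :: rest)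
    (hx : S.F ((x - 1) / 2) ∈ N'.edges ∨
      N'.lab (S.F ((x - 1) / 2)).1 = N'.lab (S.F ((x - 1) / 2)).2)
    (h2 : s'.arr 2 = Function.update (s.arr 2) v (s.arr 3 x))
    (ha : ∀ z, z ≠ 2 → s'.arr z = s.arr z) (hv : s'.var = s.var) :
    Adding S N rem k q s' N' (Function.update rem' v rest) ch := by
  have ht := h.tracked
  have hsuf : rest <:+ rem' v := by rw [hr]; exact List.suffix_cons _ _
  refine ⟨h.lab_eq, h.nc_eq, h.subset, ⟨?_, fun u => ?_, fun u => ?_, ?_, fun u y hy hyr => ?_,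
    ht.sub⟩, h.held.congr (fun z _ => by rw [hv]) fun z h1 _ => ha z (by omega),
    by rw [hv]; exact h.var4, h.new, by rw [ha 6 (by norm_num)]; exact h.count, h.le, fun u => ?_⟩
  · rw [ha 0 (by norm_num), ha 1 (by norm_num)]; exact ht.edge
  · rw [h2, ha 3 (by norm_num)]
    by_cases hu : u = v
    · subst hu
      have := ht.chain u
      rw [hr] at this
      rw [Function.update_self, Function.update_self]
      exact this.2.2
    · rw [Function.update_of_ne hu, Function.update_of_ne fun hc => hu (Fin.ext hc)]
      exact ht.chain u
  · by_cases hu : u = v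
    · subst hu; rw [Function.update_self]; exact hsuf.trans (ht.suffix u)
    · rw [Function.update_of_ne hu]; exact ht.suffix u
  · rw [ha 5 (by norm_num)]; exact ht.used
  · by_cases hu : u = v
    · subst hu
      rw [Function.update_self] at hyr
      by_cases hyx : y = x
      · rw [hyx]; exact hx
      · exact ht.popped u y hy (by rw [hr]; simp [hyx, hyr])
    · rw [Function.update_of_ne hu] at hyr
      exact ht.popped u y hy hyr
  · by_cases hu : u = v
    · subst hu; rw [Function.update_self]; exact hsuf.trans (h.suffix u)
    · rw [Function.update_of_ne hu]; exact h.suffix u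

/-- Adds an edge and charges it to the class of one of its ends. -/
theorem Adding.push (h : Adding S N rem k q s N' rem' ch) (he : e < S.m) (hnew : S.F e ∉ N'.edges)
    (hc : N.lab (S.F e).1 ≠ N.lab (S.F e).2) (hv : (S.F e).1 = v ∨ (S.F e).2 = v)
    (hlt : (charged N N' ch (N.lab v)).card < q)
    (h5 : s'.arr 5 = Function.update (s.arr 5) e 1)
    (h6 : s'.arr 6 = Function.update (s.arr 6) (N.lab v) (s.arr 6 (N.lab v) + 1))
    (h9 : s'.arr 9 = Function.update (s.arr 9) N'.h (S.F e).1)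
    (h10 : s'.arr 10 = Function.update (s.arr 10) N'.h (S.F e).2) (h3 : s'.var 3 = N'.h + 1)
    (ha : ∀ z, z ≠ 5 → z ≠ 6 → z ≠ 9 → z ≠ 10 → s'.arr z = s.arr z)
    (hva : ∀ z, z ≠ 3 → s'.var z = s.var z) :
    ∃ N'' ch', Adding S N rem k q s' N'' rem' ch' ∧ S.F e ∈ N''.edges ∧
      ∀ a, (charged N N' ch a).card ≤ (charged N N'' ch' a).card := by
  have ht := h.tracked
  have hp : S.F e ∈ S.edges := S.mem_edges.2 ⟨e, he, rfl⟩
  have hpN : S.F e ∉ N.edges := fun hc => hnew (h.subset hc)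
  have hs : Simple (insert (S.F e) N'.edges) := S.simple.mono (Finset.insert_subset hp ht.sub)
  have hed := N'.edges_push hnew hs
  have hch : ∀ a, charged N (N'.push _ hnew hs) (Function.update ch (S.F e) (N.lab v)) a =
      if a = N.lab v then insert (S.F e) (charged N N' ch a) else charged N N' ch a := by
    intro a
    ext p
    rw [mem_charged, hed, Finset.mem_insert, Function.update_apply]
    by_cases hpe : p = S.F e
    · subst hpe
      by_cases hav : a = N.lab v
      · simp [hav, hpN]
      · simp [hav, mem_charged, hnew, Ne.symm hav]
    · by_cases hav : a = N.lab v
      · simp [hav, hpe, mem_charged]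
      · simp [hav, hpe, mem_charged]
  have hnot : ∀ a, S.F e ∉ charged N N' ch a := fun a hm => hnew (mem_charged.1 hm).1.1
  have hcard : ∀ a, (charged N (N'.push _ hnew hs)
      (Function.update ch (S.F e) (N.lab v)) a).card =
      (charged N N' ch a).card + if a = N.lab v then 1 else 0 := by
    intro a
    rw [hch]
    split
    · rw [Finset.card_insert_of_notMem (hnot a)]
    · rfl
  refine ⟨N'.push _ hnew hs, Function.update ch (S.F e) (N.lab v), ⟨h.lab_eq, h.nc_eq, ?_,
    ⟨?_, ?_, ht.suffix, ?_, ?_, ?_⟩, ⟨?_, ?_, ?_, ?_⟩, ?_, ?_, ?_, ?_, h.suffix⟩, ?_, ?_⟩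
  · rw [hed]; exact h.subset.trans (Finset.subset_insert _ _)
  · rw [ha 0 (by norm_num) (by norm_num) (by norm_num) (by norm_num),
      ha 1 (by norm_num) (by norm_num) (by norm_num) (by norm_num)]
    exact ht.edge
  · rw [ha 2 (by norm_num) (by norm_num) (by norm_num) (by norm_num),
      ha 3 (by norm_num) (by norm_num) (by norm_num) (by norm_num)]
    exact ht.chain
  · intro i hi
    rw [h5, hed, Finset.mem_insert, Function.update_apply]
    by_cases hie : i = e
    · simp [hie]
    · rw [if_neg hie, ht.used i hi]
      exact (or_iff_right fun hc => hie (S.inj i hi e he hc)).symm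
  · intro u y hy hyr
    rw [hed, Finset.mem_insert]
    exact (ht.popped u y hy hyr).imp Or.inr id
  · rw [hed]; exact Finset.insert_subset hp ht.sub
  · obtain ⟨e0, e2, e3, e5⟩ := h.held.vars
    exact ⟨(hva 0 (by norm_num)).trans e0, (hva 2 (by norm_num)).trans e2, h3,
      (hva 5 (by norm_num)).trans e5⟩
  · rw [ha 7 (by norm_num) (by norm_num) (by norm_num) (by norm_num)]; exact h.held.lab
  · rw [ha 8 (by norm_num) (by norm_num) (by norm_num) (by norm_num)]; exact h.held.rep
  · intro i hi
    change i < N'.h + 1 at hi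
    change _ = ((Function.update N'.E N'.h (S.F e) i).1 : ℕ) ∧
      _ = ((Function.update N'.E N'.h (S.F e) i).2 : ℕ)
    rw [h9, h10]
    by_cases hie : i = N'.h
    · simp [hie]
    · rw [Function.update_of_ne hie, Function.update_of_ne hie, Function.update_of_ne hie]
      exact h.held.edge i (by omega)
  · rw [hva 4 (by norm_num)]; exact h.var4
  · intro p hp1 hp2
    rw [hed, Finset.mem_insert] at hp1
    rw [Function.update_apply]
    by_cases hpe : p = S.F e
    · rw [if_pos hpe, hpe]
      exact ⟨hc, hv.imp (congrArg N.lab) (congrArg N.lab)⟩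
    · rw [if_neg hpe]
      exact h.new p (hp1.resolve_left hpe) hp2
  · intro a ha'
    rw [hcard, h6, Function.update_apply]
    split
    · next hav => rw [hav, h.count _ (N.lab_lt v)]
    · rw [h.count a ha', add_zero]
  · intro a ha'
    rw [hcard]
    split
    · next hav => rw [hav]; exact hlt
    · exact h.le a ha'
  · rw [hed]; exact Finset.mem_insert_self _ _
  · intro a
    rw [hcard]
    exact Nat.le_add_right _ _

end Adding

end Source

/-- Adds the edge in register `23` unless it is used or within a class, and charges it to the class
of the vertex in register `7`. -/
def considerEdge : Cmd :=
  .cond (.load 5 (.var 23)) .skip <|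
  .cond (.op .eq (.load 7 (.load 0 (.var 23))) (.load 7 (.load 1 (.var 23)))) .skip <|
    .seq (.store 5 (.var 23) (.lit 1)) <| .seq (.store 9 (.var 3) (.load 0 (.var 23))) <|
    .seq (.store 10 (.var 3) (.load 1 (.var 23))) <|
    .seq (.assign 3 (.op .add (.var 3) (.lit 1))) <|
    .store 6 (.load 7 (.var 7)) (.op .add (.load 6 (.load 7 (.var 7))) (.lit 1))

/-- Handles the first slot of the vertex in register `7`. -/
def pickSlot : Cmd :=
  .seq (.assign 22 (.load 2 (.var 7))) <|
  .seq (.assign 23 (.op .div (.op .sub (.var 22) (.lit 1)) (.lit 2))) <|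
  .seq considerEdge <| .store 2 (.var 7) (.load 3 (.var 22))

/-- Handles the slots of the vertex in register `7` as long as its class has not been charged
enough edges. -/
def pickVertex : Cmd :=
  -- The product of the two comparisons is their conjunction.
  .loop (.op .mul (.op .lt (.lit 0) (.load 2 (.var 7)))
    (.op .lt (.load 6 (.load 7 (.var 7))) (.var 4))) pickSlot

/-- Adds a batch of edges. -/
def pick : Cmd :=
  .seq (Cmd.for 6 5 (.store 6 (.var 6) (.lit 0))) (Cmd.for 7 0 pickVertex)

namespace Source

section

variable {n : ℕ} {S : Source n} {N N' : Net n} {rem rem' : Fin n → List ℕ} {k q w : ℕ}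
  {s s' : State} {ch : Fin n × Fin n → ℕ} {v : Fin n} {x e : ℕ} {rest : List ℕ}

theorem does_considerEdge (h : Adding S N rem k q s N' rem' ch) (hm : 2 * S.m + 2 < 2 ^ w)
    (hq : q < 2 ^ w) (he : e < S.m) (hv : (S.F e).1 = v ∨ (S.F e).2 = v) (h7 : s.var 7 = v)
    (h23 : s.var 23 = e) (hlt : (charged N N' ch (N.lab v)).card < q) :
    Does w considerEdge s fun t s' => t ≤ 45 ∧ ∃ N'' ch', Adding S N rem k q s' N'' rem' ch' ∧
      (S.F e ∈ N''.edges ∨ N''.lab (S.F e).1 = N''.lab (S.F e).2) ∧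
      ∀ a, (charged N N' ch a).card ≤ (charged N N'' ch' a).card := by
  have hone : 1 % 2 ^ w = 1 := Nat.mod_eq_of_lt (by omega)
  obtain ⟨e0, e1⟩ := h.tracked.edge e he
  have hl := h.held.lab
  rw [h.lab_eq] at hl
  unfold considerEdge
  rw [does_cond]
  by_cases hu : S.F e ∈ N'.edges
  · rw [if_neg (by simpa [Expr.eval, h23] using (h.tracked.used e he).2 hu), does_skip]
    exact ⟨by simp only [Expr.cost]; omega, N', ch, h, Or.inl hu, fun _ => le_rfl⟩
  · have hu0 : s.arr 5 e = 0 := by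
      by_contra hc; exact hu ((h.tracked.used e he).1 hc)
    rw [if_pos (by simpa [Expr.eval, h23] using hu0), does_cond]
    by_cases hc : N.lab (S.F e).1 = N.lab (S.F e).2
    · rw [if_neg (by simp [Expr.eval, Op.eval, h23, e0, e1, hl, hc, hone]), does_skip]
      exact ⟨by simp only [Expr.cost]; omega, N', ch, h, Or.inr (by rw [h.lab_eq]; exact hc),
        fun _ => le_rfl⟩
    · rw [if_pos (by simp [Expr.eval, Op.eval, h23, e0, e1, hl, hc])]
      have hh : N'.h < S.m := by
        rw [← N'.card_edges, ← S.card_edges]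
        refine Finset.card_lt_card ⟨h.tracked.sub, fun hs => hu (hs (S.mem_edges.2 ⟨e, he, rfl⟩))⟩
      have h3 : s.var 3 = N'.h := h.held.vars.2.2.1
      have hcnt := h.count _ (N.lab_lt v)
      have m1 : (N'.h + 1) % 2 ^ w = N'.h + 1 := Nat.mod_eq_of_lt (by omega)
      have m2 : (s.arr 6 (N.lab v) + 1) % 2 ^ w = s.arr 6 (N.lab v) + 1 :=
        Nat.mod_eq_of_lt (by omega)
      simp only [does_seq, does_store, does_assign]
      refine ⟨by simp only [Expr.cost]; omega, ?_⟩
      obtain ⟨N'', ch', h1, h2, h4⟩ := h.push (v := v) he hu hc hv hlt (s' := (((((s.setArr 5 e 1).setArr 9 N'.h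
        (S.F e).1).setArr 10 N'.h (S.F e).2).setVar 3 (N'.h + 1)).setArr 6 (N.lab v)
        (s.arr 6 (N.lab v) + 1))) (by simp) (by simp) (by simp) (by simp) (by simp)
        (fun z h1 h2 h3 h4 => by simp [h1, h2, h3, h4]) (fun z h1 => by simp [h1])
      refine ⟨N'', ch', ?_, Or.inl h2, h4⟩
      simpa [Expr.eval, Op.eval, h23, h3, h7, hone, e0, e1, m1, hl, m2] using h1

theorem does_pickSlot (h : Adding S N rem k q s N' rem' ch) (hm : 2 * S.m + 2 < 2 ^ w)
    (hq : q < 2 ^ w) (h7 : s.var 7 = v) (hr : rem' v = x :: rest)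
    (hlt : (charged N N' ch (N.lab v)).card < q) :
    Does w pickSlot s fun t s' => t ≤ 65 ∧ ∃ N'' ch',
      Adding S N rem k q s' N'' (Function.update rem' v rest) ch' ∧
      ∀ a, (charged N N' ch a).card ≤ (charged N N'' ch' a).card := by
  have hone : 1 % 2 ^ w = 1 := Nat.mod_eq_of_lt (by omega)
  have htwo : 2 % 2 ^ w = 2 := Nat.mod_eq_of_lt (by omega)
  obtain ⟨he, hx1, hx2, hend⟩ := slot_cases (h.mem_L hr)
  have hhead : s.arr 2 v = x := by
    have := h.tracked.chain v
    rw [hr] at this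
    exact this.1
  unfold pickSlot
  rw [does_seq, does_assign]
  have ev1 : Expr.eval w s (.load 2 (.var 7)) = x := by simp [Expr.eval, h7, hhead]
  rw [ev1, does_seq, does_assign]
  have ev2 : Expr.eval w (s.setVar 22 x) (.op .div (.op .sub (.var 22) (.lit 1)) (.lit 2)) =
      (x - 1) / 2 := by
    simp only [Expr.eval, Op.eval, var_setVar, if_true, hone, htwo]
    rw [show x + 2 ^ w - 1 = x - 1 + 2 ^ w by omega, Nat.add_mod_right,
      Nat.mod_eq_of_lt (show x - 1 < 2 ^ w by omega)]
  rw [ev2, does_seq]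
  have hA : Adding S N rem k q ((s.setVar 22 x).setVar 23 ((x - 1) / 2)) N' rem' ch := by
    refine ⟨h.lab_eq, h.nc_eq, h.subset, h.tracked.congr fun z _ _ => rfl,
      h.held.congr (fun z hz => ?_) fun z _ _ => rfl, by simp [h.var4], h.new, h.count, h.le,
      h.suffix⟩
    have z1 : z ≠ 22 := by omega
    have z2 : z ≠ 23 := by omega
    simp [z1, z2]
  refine (does_considerEdge hA hm hq he hend (by simp [h7]) (by simp) hlt).agree.mono ?_
  rintro t s₁ ⟨⟨ht, N'', ch', hA', hmem, hmono⟩, hag⟩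
  rw [does_store]
  refine ⟨by simp only [Expr.cost]; omega, N'', ch', ?_, hmono⟩
  have h71 : s₁.var 7 = v := (hag.1 7 (by simp [considerEdge, Cmd.KeepsVar])).trans (by simp [h7])
  have h221 : s₁.var 22 = x := (hag.1 22 (by simp [considerEdge, Cmd.KeepsVar])).trans (by simp)
  refine hA'.pop hr hmem ?_ (fun z hz => by simp [hz]) rfl
  simp [Expr.eval, h71, h221]

theorem sum_length_update (f : Fin n → List ℕ) (v : Fin n) (r : List ℕ) :
    ∑ u, (Function.update f v r u).length + (f v).length = ∑ u, (f u).length + r.length := by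
  have h1 : ∀ u, (Function.update f v r u).length =
      Function.update (fun u => (f u).length) v r.length u := fun u => by
    by_cases h : u = v
    · subst h; simp
    · simp [h]
  simp only [h1]
  have h2 := Finset.sum_update_of_mem (Finset.mem_univ v) (fun u => (f u).length) (f v).length
  rw [Function.update_eq_self v fun u => (f u).length] at h2
  rw [Finset.sum_update_of_mem (Finset.mem_univ v), h2]
  ring

/-- The number of remaining slots is the potential. A slot is never looked at twice in the whole
algorithm, so all batches together spend O(m) on slots. -/
theorem does_pickVertex (h : Adding S N rem k q s N' rem' ch) (hm : 2 * S.m + 2 < 2 ^ w)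
    (hq : q < 2 ^ w) (h7 : s.var 7 = v) :
    Does w pickVertex s fun t s' => ∃ N'' r ch',
      Adding S N rem k q s' N'' (Function.update rem' v r) ch' ∧
      (r = [] ∨ (charged N N'' ch' (N.lab v)).card = q) ∧
      (∀ a, (charged N N' ch a).card ≤ (charged N N'' ch' a).card) ∧
      t + 80 * ∑ u, (Function.update rem' v r u).length ≤ 80 * ∑ u, (rem' u).length + 15 := by
  have hone : 1 % 2 ^ w = 1 := Nat.mod_eq_of_lt (by omega)
  have hev : ∀ s₁ N₁ r ch₁, Adding S N rem k q s₁ N₁ (Function.update rem' v r) ch₁ →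
      s₁.var 7 = v → (Expr.eval w s₁ (.op .mul (.op .lt (.lit 0) (.load 2 (.var 7)))
        (.op .lt (.load 6 (.load 7 (.var 7))) (.var 4))) ≠ 0 ↔
        r ≠ [] ∧ (charged N N₁ ch₁ (N.lab v)).card < q) := by
    intro s₁ N₁ r ch₁ hA h71
    have hch := hA.tracked.chain v
    rw [Function.update_self] at hch
    have h0 : 0 < s₁.arr 2 v ↔ r ≠ [] := by
      cases r with
      | nil => simpa [Chain] using hch
      | cons x r => simpa using Nat.pos_of_ne_zero (hch.1 ▸ hch.2.1)
    have hl : s₁.arr 7 v = N.lab v := by rw [hA.held.lab, hA.lab_eq]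
    simp only [Expr.eval, Op.eval, h71, hl, hA.count _ (N.lab_lt v), hA.var4, h0, Nat.zero_mod,
      hone]
    by_cases c1 : r ≠ [] <;> by_cases c2 : (charged N N₁ ch₁ (N.lab v)).card < q <;>
      simp [c1, c2, hone]
  unfold pickVertex
  refine (does_loop (fun τ s₁ => ∃ N₁ r ch₁,
    Adding S N rem k q s₁ N₁ (Function.update rem' v r) ch₁ ∧
    (∀ a, (charged N N' ch a).card ≤ (charged N N₁ ch₁ a).card) ∧
    τ + 80 * ∑ u, (Function.update rem' v r u).length ≤ 80 * ∑ u, (rem' u).length)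
    (80 * ∑ u, (rem' u).length) ⟨N', rem' v, ch, by simpa using h, fun _ => le_rfl, by simp⟩ ?_
    ?_).mono ?_
  · rintro τ s₁ ⟨N₁, r, ch₁, -, -, h1⟩
    omega
  · rintro τ s₁ ⟨N₁, r, ch₁, hA, hmono, hτ⟩ hag he
    have h71 : s₁.var 7 = v :=
      (hag.1 7 (by simp [pickSlot, considerEdge, Cmd.KeepsVar])).trans h7
    obtain ⟨hr, hlt⟩ := (hev s₁ N₁ r ch₁ hA h71).1 he
    cases r with
    | nil => exact absurd rfl hr
    | cons x r =>
      refine (does_pickSlot hA hm hq h71 (x := x) (rest := r) (by simp) hlt).mono ?_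
      rintro t s₂ ⟨ht, N₂, ch₂, hA2, hmono2⟩
      rw [Function.update_idem] at hA2
      refine ⟨N₂, r, ch₂, hA2, fun a => (hmono a).trans (hmono2 a), ?_⟩
      have e1 := sum_length_update rem' v (x :: r)
      have e2 := sum_length_update rem' v r
      rw [List.length_cons] at e1
      simp only [Expr.cost]
      omega
  · rintro t s₁ ⟨τ, rfl, ⟨N₁, r, ch₁, hA, hmono, hτ⟩, he, hag⟩
    have h71 : s₁.var 7 = v :=
      (hag.1 7 (by simp [pickSlot, considerEdge, Cmd.KeepsVar])).trans h7
    refine ⟨N₁, r, ch₁, hA, ?_, hmono, by simp only [Expr.cost]; omega⟩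
    by_contra hc
    push Not at hc
    refine (hev s₁ N₁ r ch₁ hA h71).2 ⟨hc.1, ?_⟩ he
    exact lt_of_le_of_ne (hA.le _ (N.lab_lt v)) hc.2

/-- Charges never decrease and never exceed `q`, so a class that is full when one of its vertices is
left remains full. -/
theorem does_pick (h : S.Tracked N rem s) (hH : N.Held k s) (h4 : s.var 4 = q)
    (hm : n + 2 * S.m + 2 < 2 ^ w) (hq : q < 2 ^ w) :
    Does w pick s fun t s' => ∃ N' rem' ch, Adding S N rem k q s' N' rem' ch ∧
      (∀ v, rem' v ≠ [] → (charged N N' ch (N.lab v)).card = q) ∧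
      t + 80 * ∑ u, (rem' u).length ≤ 80 * ∑ u, (rem u).length + 40 * n + 20 := by
  have hncn := N.nc_le
  unfold pick
  rw [does_seq]
  refine (does_for (N := N.nc) (fun i τ s' => τ ≤ 12 * i ∧ ∀ v < i, s'.arr 6 v = 0) (12 * N.nc)
    (by norm_num) (by simp [Cmd.KeepsVar]) (by simp [Cmd.KeepsVar]) hH.vars.2.2.2 (by omega)
    (by simp) (fun i τ s' hi h => h.1.trans (by omega)) ?_).mono ?_
  · rintro i τ s' hi ⟨hτ, hI⟩ h6 - - -
    rw [does_store]
    refine ⟨by simp only [Expr.cost]; omega, fun v hv => ?_⟩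
    simp only [Expr.eval, arr_setVar, arr_setArr, if_true, h6, Nat.zero_mod]
    rcases Nat.lt_succ_iff_lt_or_eq.1 hv with hv | rfl
    · rw [Function.update_of_ne hv.ne]; exact hI v hv
    · simp
  rintro t₁ s₁ ⟨τ₁, rfl, ⟨hτ1, h61⟩, -, hv1, ha1⟩
  have hch0 : ∀ a, charged N N (fun _ => 0) a = ∅ := fun a => by simp [charged]
  have hA1 : Adding S N rem k q s₁ N rem fun _ => 0 :=
    ⟨rfl, rfl, Finset.Subset.refl _, h.congr fun z h1 h2 => ha1 z (by simp [Cmd.KeepsArr]; omega),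
      hH.congr (fun z hz => hv1 z (by omega) (by simp [Cmd.KeepsVar])) fun z h1 h2 =>
      ha1 z (by simp [Cmd.KeepsArr]; omega),
      (hv1 4 (by norm_num) (by simp [Cmd.KeepsVar])).trans h4, fun p hp hp' => absurd hp hp',
      fun a ha => by rw [h61 a ha, hch0]; rfl, fun a ha => by simp [hch0],
      fun v => List.suffix_rfl⟩
  have hset : ∀ s₂ N' rem' ch z, Adding S N rem k q s₂ N' rem' ch →
      Adding S N rem k q (s₂.setVar 7 z) N' rem' ch := fun s₂ N' rem' ch z hA =>
    ⟨hA.lab_eq, hA.nc_eq, hA.subset, hA.tracked.congr fun _ _ _ => rfl,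
      hA.held.congr (fun y hy => by
        have : y ≠ 7 := by omega
        simp [this]) fun _ _ _ => rfl,
      by simp [hA.var4], hA.new, hA.count, hA.le, hA.suffix⟩
  refine (does_for (N := n) (fun i τ s' => ∃ N' rem' ch, Adding S N rem k q s' N' rem' ch ∧
    (∀ v : Fin n, (v : ℕ) < i → rem' v = [] ∨ (charged N N' ch (N.lab v)).card = q) ∧
    τ + 80 * ∑ u, (rem' u).length ≤ 80 * ∑ u, (rem u).length + 23 * i)
    (80 * ∑ u, (rem u).length + 23 * n) (by norm_num)
    (by simp [pickVertex, pickSlot, considerEdge, Cmd.KeepsVar])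
    (by simp [pickVertex, pickSlot, considerEdge, Cmd.KeepsVar])
    hA1.held.vars.1 (by omega) ⟨N, rem, _, hset _ _ _ _ _ hA1, by simp, by omega⟩ ?_ ?_).mono ?_
  · rintro i τ s' hi ⟨N', rem', ch, -, -, h1⟩
    omega
  · rintro i τ s' hi ⟨N', rem', ch, hA, hd, hτ⟩ h7 - - -
    refine (does_pickVertex (v := ⟨i, hi⟩) hA (by omega) hq h7).mono ?_
    rintro t s₂ ⟨N'', r, ch', hA', hr, hmono, ht⟩
    refine ⟨N'', _, ch', hset _ _ _ _ _ hA', fun v hv => ?_, by omega⟩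
    by_cases hvi : v = ⟨i, hi⟩
    · subst hvi
      simpa using hr
    · rw [Function.update_of_ne hvi]
      have : (v : ℕ) < i := by
        refine lt_of_le_of_ne (by omega) fun hc => hvi (Fin.ext hc)
      exact (hd v this).imp id fun hq' =>
        le_antisymm (hA'.le _ (N.lab_lt v)) (hq'.symm.le.trans (hmono _))
  · rintro t s₂ ⟨τ, rfl, ⟨N', rem', ch, hA, hd, hτ⟩, -, -, -⟩
    exact ⟨N', rem', ch, hA, fun v hv => (hd v v.2).resolve_left hv, by omega⟩

end

end Source

end EdgeConn

/-! ### The sequence of batches -/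

namespace EdgeConn

open WordRAM

/-- Adds a batch of edges and updates the partition, unless there is nothing to add. -/
def batchStep (D : Decremental) : Cmd :=
  .seq (.assign 26 (.var 3)) <| .seq pick <|
  .cond (.op .eq (.var 26) (.var 3)) (.assign 25 (.lit 0)) <|
    .seq (solve D) <| .seq (.assign 4 (.op .add (.var 4) (.op .div (.var 4) (.lit 2)))) <|
    .assign 25 (.lit 1)

/-- A bound for the time of a batch, if there are at most `J` batches. -/
noncomputable def batchTime (tp tq : ℝ) (k n J : ℕ) : ℕ :=
  ⌊tp * (n + 3 * (k * n) * J)⌋₊ + (4 * ⌊tq⌋₊ + 360) * (9 * (k * n) * (2 * Nat.log 2 n + 4)) +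
    (⌊tq⌋₊ + 30) * n + 100 * (n + 3 * (k * n) * J) + 40 * n + 200

namespace Source

variable {n : ℕ} {S : Source n} {k w c : ℕ} {K : Set ℕ} {tp tq : ℕ → ℕ → ℝ} {D : Decremental}

/-- Keeps logarithms and word lengths under control independently of `k`. -/
theorem m_le (S : Source n) : S.m ≤ n * n := by
  rw [← S.card_edges]
  simpa using Finset.card_le_univ S.edges

/-- The situation between the batches. -/
structure Batched (S : Source n) (k w : ℕ) (N : Net n) (rem : Fin n → List ℕ) (q j : ℕ)
    (s : State) : Prop where
  tracked : S.Tracked N rem s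
  held : N.Held k s
  var4 : s.var 4 = q
  part : IsKPart k N.edges N.lab
  word : s.IsWord w
  active_le : q * (active N.lab rem).card ≤ 3 * (k * n)
  le_q : 2 * k ≤ q
  q_le : q ≤ 5 * (k * n)
  pow_le : 2 * k * 4 ^ j ≤ 3 ^ j * q
  h_le : N.h ≤ 3 * (k * n) * j

/-- The charge grows by a factor of at least 4/3 per batch, from `2 * k` to at most `5 * (k * n)`.
Three batches more than double it, as `2 * 27 < 64`. -/
theorem Batched.lt {N : Net n} {rem : Fin n → List ℕ} {q j : ℕ} {s : State}
    (h : S.Batched k w N rem q j s) (hk : 1 ≤ k) : j < 3 * (Nat.log 2 n + 3) := by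
  by_contra hc
  rw [not_lt] at hc
  obtain ⟨i, rfl⟩ := Nat.exists_eq_add_of_le hc
  have h1 : k * (2 * 4 ^ (3 * (Nat.log 2 n + 3) + i)) ≤
      k * (3 ^ (3 * (Nat.log 2 n + 3) + i) * (5 * n)) := by
    calc _ = 2 * k * 4 ^ (3 * (Nat.log 2 n + 3) + i) := by ring
      _ ≤ _ := h.pow_le
      _ ≤ 3 ^ (3 * (Nat.log 2 n + 3) + i) * (5 * (k * n)) := Nat.mul_le_mul_left _ h.q_le
      _ = _ := by ring
  have h2 := Nat.le_of_mul_le_mul_left h1 (by omega)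
  have hn : n < 2 ^ (Nat.log 2 n + 1) := Nat.lt_pow_succ_log_self (by norm_num) n
  set a := Nat.log 2 n + 3 with ha
  have h3 : 4 * n < 2 ^ a := by
    calc 4 * n < 4 * 2 ^ (Nat.log 2 n + 1) := by omega
      _ = 2 ^ a := by rw [ha]; ring
  have e4 : (4 : ℕ) ^ (3 * a + i) = 64 ^ a * 4 ^ i := by rw [pow_add, pow_mul]; norm_num
  have e3 : (3 : ℕ) ^ (3 * a + i) = 27 ^ a * 3 ^ i := by rw [pow_add, pow_mul]; norm_num
  rw [e4, e3] at h2
  have h54 : (27 : ℕ) ^ a * 2 ^ a = 54 ^ a := by rw [← mul_pow]; norm_num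
  have h5 : (54 : ℕ) ^ a ≤ 64 ^ a := Nat.pow_le_pow_left (by norm_num) a
  have h6 : (3 : ℕ) ^ i ≤ 4 ^ i := Nat.pow_le_pow_left (by norm_num) i
  have h7 : 27 ^ a * 3 ^ i * (4 * n) ≤ 64 ^ a * 4 ^ i := by
    calc 27 ^ a * 3 ^ i * (4 * n) ≤ 27 ^ a * 3 ^ i * 2 ^ a := Nat.mul_le_mul_left _ h3.le
      _ = 54 ^ a * 3 ^ i := by rw [← h54]; ring
      _ ≤ _ := Nat.mul_le_mul h5 h6
  have hpos : 0 < 64 ^ a * 4 ^ i := by positivity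
  have e5 : 4 * (27 ^ a * 3 ^ i * (5 * n)) = 5 * (27 ^ a * 3 ^ i * (4 * n)) := by ring
  omega

theorem does_batchStep {N : Net n} {rem : Fin n → List ℕ} {q j J : ℕ} {s : State}
    (hD : D.Supports K tp tq c) (hkK : k ∈ K) (hk : 1 ≤ k) (hn : 2 ≤ n) (htp : 0 ≤ tp k n)
    (hw : (n + k + 2) ^ c ≤ 2 ^ w) (hm : n + 2 * S.m + 2 < 2 ^ w) (hq : 5 * (k * n) < 2 ^ w)
    (hj : j + 1 ≤ J) (h : S.Batched k w N rem q j s) :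
    Does w (batchStep D) s fun t s' => ∃ N' rem', t + 80 * ∑ u, (rem' u).length + 2 ≤
        80 * ∑ u, (rem u).length + batchTime (tp k n) (tq k n) k n J ∧
      ((s'.var 25 = 1 ∧ ∃ q', S.Batched k w N' rem' q' (j + 1) s') ∨
        (s'.var 25 = 0 ∧ S.Batched k w N' rem' q j s' ∧ ∀ v, rem' v = [])) := by
  have hone : 1 % 2 ^ w = 1 := Nat.mod_eq_of_lt (by omega)
  have htwo : 2 % 2 ^ w = 2 := Nat.mod_eq_of_lt (by omega)
  have hq1 := h.q_le
  have hq2 := h.le_q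
  have hh3 := h.held.vars.2.2.1
  unfold batchStep
  rw [does_seq, does_assign, does_seq]
  have ht0 : S.Tracked N rem (s.setVar 26 (s.var 3)) := h.tracked.congr fun _ _ _ => rfl
  have hH0 : N.Held k (s.setVar 26 (s.var 3)) := h.held.congr (fun z hz => by
    have : z ≠ 26 := by omega
    simp [this]) fun _ _ _ => rfl
  refine (((does_pick ht0 hH0 (by simpa using h.var4) hm (by omega)).isWord
    (h.word.setVar _ (h.word.1 _))).agree).mono ?_
  rintro t₁ s₁ ⟨⟨⟨N', rem', ch, hA, hdone, ht1⟩, hw1⟩, hag⟩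
  have h26 : s₁.var 26 = N.h :=
    (hag.1 26 (by simp [pick, pickVertex, pickSlot, considerEdge, Cmd.for, Cmd.KeepsVar])).trans
      (by simp [hh3])
  have h31 := hA.held.vars.2.2.1
  have hact := h_le_add ht0 hA
  have hcls : ∀ u, KEC k N'.edges {v | N'.lab v = N'.lab u} := fun u => by
    rw [hA.lab_eq]; exact (h.part.kec u).mono hA.subset
  rw [does_cond]
  by_cases hh : N'.h = N.h
  · rw [if_neg (by simp [Expr.eval, Op.eval, h26, h31, hh, hone]), does_assign]
    have hedges : N'.edges = N.edges := by
      refine (Finset.eq_of_subset_of_card_le hA.subset ?_).symm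
      rw [N'.card_edges, N.card_edges, hh]
    -- A remaining slot would mean a full charge of `q > 0` new edges, but none was added.
    have hrem : ∀ v, rem' v = [] := by
      intro v
      by_contra hv
      have := hdone v hv
      simp [charged, hedges] at this
      omega
    refine ⟨N', rem', ?_, Or.inr ⟨by simp [Expr.eval], ⟨hA.tracked.congr fun _ _ _ => rfl,
      hA.held.congr (fun z hz => ?_) fun _ _ _ => rfl, by simp [hA.var4], ?_,
      hw1.setVar _ (Expr.eval_lt hw1 _), ?_, h.le_q, h.q_le, h.pow_le, hh ▸ h.h_le⟩, hrem⟩⟩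
    · simp only [Expr.cost, batchTime]
      omega
    · have : z ≠ 25 := by omega
      simp [this]
    · rw [hedges, hA.lab_eq]; exact h.part
    · simp [active, hrem]
  · rw [if_pos (by simp [Expr.eval, Op.eval, h26, h31, Ne.symm hh]), does_seq]
    have hsub := Finset.card_le_card hA.subset
    rw [N'.card_edges, N.card_edges] at hsub
    -- An edge was added, so some class was active and `q ≤ q * |A|`. Hence the next charge is at
    -- most `5 * (k * n)`.
    have hqA : q ≤ 3 * (k * n) := by
      have h1 : 1 ≤ (active N.lab rem).card := by
        by_contra hc
        rw [show (active N.lab rem).card = 0 by omega, mul_zero] at hact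
        omega
      calc q = q * 1 := (mul_one q).symm
        _ ≤ q * (active N.lab rem).card := Nat.mul_le_mul_left _ h1
        _ ≤ _ := h.active_le
    have hactle := h.active_le
    -- At most `k * n` old edges run between the classes, and at most `3 * (k * n)` edges are new.
    have hcross : N'.cross.card ≤ 4 * (k * n) := by
      have h1 : N'.cross ⊆ (N.edges.filter fun p => N.lab p.1 ≠ N.lab p.2) ∪ (N'.edges \ N.edges) := by
        intro p hp
        obtain ⟨hp1, hp2⟩ := Finset.mem_filter.1 hp
        rw [hA.lab_eq] at hp2
        by_cases hpN : p ∈ N.edges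
        · exact Finset.mem_union_left _ (Finset.mem_filter.2 ⟨hpN, hp2⟩)
        · exact Finset.mem_union_right _ (Finset.mem_sdiff.2 ⟨hp1, hpN⟩)
      have h2 := (Finset.card_le_card h1).trans (Finset.card_union_le _ _)
      have h3 := h.part.card_cross_le
      rw [Fintype.card_fin] at h3
      rw [Finset.card_sdiff_of_subset hA.subset, N'.card_edges, N.card_edges] at h2
      omega
    have hkn : n ≤ k * n := Nat.le_mul_of_pos_left _ hk
    have htot : N'.tot ≤ 9 * (k * n) := by
      have h1 := N'.tot_le
      have h2 := N'.nc_le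
      omega
    -- Here `tot` is bounded through `m ≤ n * n`, as `9 * (k * n)` would bring in the logarithm of
    -- `k`.
    have hlog : Nat.log 2 N'.tot ≤ 2 * Nat.log 2 n + 4 := by
      have h1 : N'.tot ≤ n + 2 * (n * n) := by
        have h1 := N'.tot_le
        have h2 := N'.nc_le
        have h3 := hA.tracked.h_le
        have h4 := S.m_le
        have h5 : N'.cross.card ≤ N'.h := by
          rw [← N'.card_edges]; exact Finset.card_filter_le _ _
        omega
      have h2 : n < 2 ^ (Nat.log 2 n + 1) := Nat.lt_pow_succ_log_self (by norm_num) n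
      have h3 : n * n ≤ 2 ^ (Nat.log 2 n + 1) * 2 ^ (Nat.log 2 n + 1) :=
        Nat.mul_le_mul h2.le h2.le
      have h4 : n ≤ n * n := Nat.le_mul_of_pos_left _ (by omega)
      have h5 : 2 ^ (2 * Nat.log 2 n + 4) = 4 * (2 ^ (Nat.log 2 n + 1) * 2 ^ (Nat.log 2 n + 1)) := by
        ring
      calc Nat.log 2 N'.tot ≤ Nat.log 2 (2 ^ (2 * Nat.log 2 n + 4)) :=
            Nat.log_mono_right (by omega)
        _ = _ := Nat.log_pow (by norm_num) _
    have hh' : N'.h ≤ 3 * (k * n) * (j + 1) := by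
      have := h.h_le
      rw [mul_add, mul_one]
      omega
    have hhJ : N'.h ≤ 3 * (k * n) * J := hh'.trans (Nat.mul_le_mul_left _ hj)
    have hhm := hA.tracked.h_le
    refine ((does_solve hD hkK hk hn hw (by omega) hw1 hcls hA.held).isWord hw1).mono ?_
    rintro t₂ s₂ ⟨⟨N'', hh2, hE2, hH2, hP2, ht2, hv2, ha2⟩, hw2⟩
    have hed : N''.edges = N'.edges := by rw [Net.edges, Net.edges, hh2, hE2]
    -- Old classes stay k-edge-connected in the larger graph, so they can only merge; edges found
    -- inside a class stay inside.
    have hcoarse : ∀ u v, N.lab u = N.lab v → N''.lab u = N''.lab v := fun u v huv =>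
      hP2.const _ (hcls v) u (by rw [hA.lab_eq]; exact huv) v rfl
    have hamort := two_mul_active_le ht0 hA hdone hcoarse hP2
    have h42 : s₂.var 4 = q := (hv2 4 (by norm_num)).trans hA.var4
    have hq3 : q / 2 ≤ q := Nat.div_le_self _ _
    have hmod : (q + q / 2) % 2 ^ w = q + q / 2 := Nat.mod_eq_of_lt (by omega)
    simp only [does_seq, does_assign]
    have hev : Expr.eval w s₂ (.op .add (.var 4) (.op .div (.var 4) (.lit 2))) = q + q / 2 := by
      simp only [Expr.eval, Op.eval, h42, htwo, hmod]
    rw [hev]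
    have hfr : ∀ z, z ≠ 4 → z ≠ 25 → ((s₂.setVar 4 (q + q / 2)).setVar 25 (Expr.eval w
        (s₂.setVar 4 (q + q / 2)) (.lit 1))).var z = s₂.var z := fun z h1 h2 => by simp [h1, h2]
    refine ⟨N'', rem', ?_, Or.inl ⟨by simp [Expr.eval, hone], q + q / 2, ?_⟩⟩
    · have h1 : ⌊tp k n * (n + N'.h)⌋₊ ≤ ⌊tp k n * (n + 3 * (k * n) * J)⌋₊ := by
        refine Nat.floor_mono (mul_le_mul_of_nonneg_left ?_ htp)
        have : (N'.h : ℝ) ≤ 3 * (k * n) * J := by exact_mod_cast hhJ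
        linarith
      have h2 : (4 * ⌊tq k n⌋₊ + 360) * (N'.tot * Nat.log 2 N'.tot) ≤
          (4 * ⌊tq k n⌋₊ + 360) * (9 * (k * n) * (2 * Nat.log 2 n + 4)) :=
        Nat.mul_le_mul_left _ (Nat.mul_le_mul htot hlog)
      simp only [Expr.cost, batchTime]
      omega
    · refine ⟨⟨?_, ?_, hA.tracked.suffix, ?_, ?_, ?_⟩, hH2.congr (fun z hz => hfr z (by omega)
        (by omega)) fun _ _ _ => rfl, by simp, hed ▸ hP2, ?_, ?_, by omega, by omega, ?_, by
        rw [hh2]; exact hh'⟩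
      · simp only [arr_setVar, ha2 0 (by norm_num), ha2 1 (by norm_num)]
        exact hA.tracked.edge
      · simp only [arr_setVar, ha2 2 (by norm_num), ha2 3 (by norm_num)]
        exact hA.tracked.chain
      · simp only [arr_setVar, ha2 5 (by norm_num), hed]
        exact hA.tracked.used
      · intro v x hx hxr
        rw [hed]
        refine (hA.tracked.popped v x hx hxr).imp id fun he => hcoarse _ _ ?_
        rwa [hA.lab_eq] at he
      · rw [hed]; exact hA.tracked.sub
      · refine (hw2.setVar _ ?_).setVar _ (Expr.eval_lt (hw2.setVar _ ?_) _) <;> omega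
      -- With the charge multiplied by at most 3/2, `hamort` gives at most `(3/4) * (3 k n + k n) =
      -- 3 k n`.
      · have h1 : 2 * ((q + q / 2) * (active N''.lab rem').card) ≤
            3 * (q * (active N''.lab rem').card) := by
          calc 2 * ((q + q / 2) * (active N''.lab rem').card)
              = (2 * (q + q / 2)) * (active N''.lab rem').card := by ring
            _ ≤ (3 * q) * (active N''.lab rem').card := Nat.mul_le_mul_right _ (by omega)
            _ = _ := by ring
        omega
      -- Despite rounding, `4 * q ≤ 3 * (q + q / 2)`, because `q ≥ 2`.
      · calc 2 * k * 4 ^ (j + 1) = 4 * (2 * k * 4 ^ j) := by ring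
          _ ≤ 4 * (3 ^ j * q) := Nat.mul_le_mul_left _ h.pow_le
          _ = 3 ^ j * (4 * q) := by ring
          _ ≤ 3 ^ j * (3 * (q + q / 2)) := Nat.mul_le_mul_left _ (by omega)
          _ = _ := by ring

/-- At the end every edge of the input is stored or inside a class, and `IsKPart.extend` passes from
the stored edges to the whole graph. -/
theorem does_batches {N : Net n} {rem : Fin n → List ℕ} {q : ℕ} {s : State}
    (hD : D.Supports K tp tq c) (hkK : k ∈ K) (hk : 1 ≤ k) (hn : 2 ≤ n) (htp : 0 ≤ tp k n)
    (hw : (n + k + 2) ^ c ≤ 2 ^ w) (hm : n + 2 * S.m + 2 < 2 ^ w) (hq : 5 * (k * n) < 2 ^ w)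
    (h25 : s.var 25 = 1) (h : S.Batched k w N rem q 0 s) :
    Does w (.loop (.var 25) (batchStep D)) s fun t s' => ∃ N' : Net n, N'.Held k s' ∧
      IsKPart k S.edges N'.lab ∧
      t ≤ 80 * ∑ u, (rem u).length + 3 * (Nat.log 2 n + 3) *
        batchTime (tp k n) (tq k n) k n (3 * (Nat.log 2 n + 3)) + 2 := by
  set J := 3 * (Nat.log 2 n + 3) with hJ
  set P := batchTime (tp k n) (tq k n) k n J with hP
  refine (does_loop (fun τ s => ∃ N' rem' q' j, S.Batched k w N' rem' q' j s ∧
    ((s.var 25 = 1 ∧ τ + 80 * ∑ u, (rem' u).length ≤ 80 * ∑ u, (rem u).length + j * P) ∨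
      (s.var 25 = 0 ∧ τ + 80 * ∑ u, (rem' u).length ≤ 80 * ∑ u, (rem u).length + (j + 1) * P ∧
        ∀ v, rem' v = []))) (80 * ∑ u, (rem u).length + J * P)
    ⟨N, rem, q, 0, h, Or.inl ⟨h25, by omega⟩⟩ ?_ ?_).mono ?_
  · rintro τ s' ⟨N', rem', q', j, hB, h1⟩
    have hj := hB.lt hk
    have h2 : j * P ≤ J * P := Nat.mul_le_mul_right _ hj.le
    have h3 : (j + 1) * P ≤ J * P := Nat.mul_le_mul_right _ hj
    rcases h1 with ⟨-, h1⟩ | ⟨-, h1, -⟩ <;> omega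
  · rintro τ s' ⟨N', rem', q', j, hB, h1⟩ - he
    have he : s'.var 25 ≠ 0 := he
    have hj := hB.lt hk
    rcases h1 with ⟨-, hτ⟩ | ⟨h1, -⟩
    swap
    · exact absurd h1 he
    refine (does_batchStep (J := J) hD hkK hk hn htp hw hm hq hj hB).mono ?_
    rintro t s₂ ⟨N₂, rem₂, ht, ⟨h1, q₂, hB2⟩ | ⟨h1, hB2, hr⟩⟩
    · refine ⟨N₂, rem₂, q₂, j + 1, hB2, Or.inl ⟨h1, ?_⟩⟩
      simp only [Expr.cost, add_mul, one_mul]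
      omega
    · refine ⟨N₂, rem₂, q', j, hB2, Or.inr ⟨h1, ?_, hr⟩⟩
      simp only [Expr.cost, add_mul, one_mul]
      omega
  · rintro t s' ⟨τ, rfl, ⟨N', rem', q', j, hB, h1⟩, he, -⟩
    have he : s'.var 25 = 0 := he
    have hj := hB.lt hk
    have h3 : (j + 1) * P ≤ J * P := Nat.mul_le_mul_right _ hj
    rcases h1 with ⟨h1, -⟩ | ⟨-, hτ, hr⟩
    · omega
    refine ⟨N', hB.held, hB.part.extend hB.tracked.sub fun p hp hpN => ?_, ?_⟩
    · by_contra hc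
      exact (hB.tracked.rem_ne_nil hp hpN hc).1 (hr _)
    · simp only [Expr.cost]
      omega

end Source

end EdgeConn

namespace EdgeConn

/-! ### The whole algorithm -/

open WordRAM

/-- Prepares the lists of incident edges and the partition into single vertices. -/
def prepare : Cmd :=
  .seq (.assign 25 (.lit 1)) <| .seq (.assign 3 (.lit 0)) <|
  .seq (.assign 4 (.op .mul (.lit 2) (.var 2))) <| .seq (.assign 5 (.var 0)) <|
  .seq (Cmd.for 7 0 (.seq (.store 2 (.var 7) (.lit 0)) <| .seq (.store 7 (.var 7) (.var 7)) <|
    .store 8 (.var 7) (.var 7))) <|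
  .seq (Cmd.for 6 1 (.store 5 (.var 6) (.lit 0))) <|
  buildAdj 2 3 4 1 (.load 0 (.var 6)) (.load 1 (.var 6))

/-- The algorithm for the maximal `k`-edge-connected subgraphs. -/
def maxKEC (D : Decremental) : Cmd :=
  .seq prepare <| .seq (.loop (.var 25) (batchStep D)) <|
  Cmd.for 7 0 (.store 0 (.var 7) (.load 7 (.var 7)))

/-- Single vertices and no edges. -/
def Net.discrete (n : ℕ) [NeZero n] : Net n where
  h := 0
  E := fun _ => (0, 0)
  lab := fun v => v
  nc := n
  rep := Fin.ofNat n
  lab_lt := fun u => u.2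
  lab_rep := fun a ha => Nat.mod_eq_of_lt ha
  inj := fun i hi => absurd hi (Nat.not_lt_zero i)
  simple := ⟨by simp, by simp⟩

theorem Net.edges_discrete (n : ℕ) [NeZero n] : (Net.discrete n).edges = ∅ := rfl

namespace Source

variable {n : ℕ} {S : Source n} {k w c : ℕ} {K : Set ℕ} {tp tq : ℕ → ℕ → ℝ} {D : Decremental}
  {s : State}

theorem does_prepare [NeZero n] (hk : 1 ≤ k) (hm : n + 2 * S.m + 2 < 2 ^ w)
    (hq : 5 * (k * n) < 2 ^ w) (hs : s.IsWord w) (h0 : s.var 0 = n) (h1 : s.var 1 = S.m)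
    (h2 : s.var 2 = k) (hed : ∀ i < S.m, s.arr 0 i = (S.F i).1 ∧ s.arr 1 i = (S.F i).2) :
    Does w prepare s fun t s' => t ≤ 100 * S.m + 30 * n + 40 ∧ s'.var 25 = 1 ∧
      S.Batched k w (Net.discrete n) (fun v => S.L v) (2 * k) 0 s' := by
  have hn : 0 < n := Nat.pos_of_ne_zero (NeZero.ne n)
  have hkn : k ≤ k * n := Nat.le_mul_of_pos_right _ hn
  have hone : 1 % 2 ^ w = 1 := Nat.mod_eq_of_lt (by omega)
  have htwo : 2 % 2 ^ w = 2 := Nat.mod_eq_of_lt (by omega)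
  have h2k : 2 * k % 2 ^ w = 2 * k := Nat.mod_eq_of_lt (by omega)
  refine ((?_ : Does w prepare s fun t s' => t ≤ 100 * S.m + 30 * n + 40 ∧ s'.var 25 = 1 ∧
    S.Tracked (Net.discrete n) (fun v => S.L v) s' ∧ (Net.discrete n).Held k s' ∧
    s'.var 4 = 2 * k).isWord hs).mono ?_
  swap
  · rintro t s' ⟨⟨ht, h25, hT, hH, h4⟩, hw⟩
    refine ⟨ht, h25, hT, hH, h4, ?_, hw, ?_, le_rfl, by omega, by omega, le_rfl⟩
    · rw [Net.edges_discrete]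
      exact isKPart_empty hk Fin.val_injective
    -- Initially there are `n` singletons, and the charge `2 * k` gives `2 * (k * n)`.
    · have hact : (active (Net.discrete n).lab fun v => S.L v).card ≤ n :=
        Finset.card_image_le.trans ((Finset.card_filter_le _ _).trans (by simp))
      calc _ ≤ 2 * k * n := Nat.mul_le_mul_left _ hact
        _ = 2 * (k * n) := by ring
        _ ≤ _ := by omega
  unfold prepare
  rw [does_seq, does_assign, does_seq, does_assign, does_seq, does_assign, does_seq, does_assign,
    does_seq]
  set s₁ := (((s.setVar 25 (Expr.eval w s (.lit 1))).setVar 3 (Expr.eval w _ (.lit 0))).setVar 4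
    (Expr.eval w _ (.op .mul (.lit 2) (.var 2)))).setVar 5 (Expr.eval w _ (.var 0)) with hs₁
  have hv : ∀ z, z ≠ 25 → z ≠ 3 → z ≠ 4 → z ≠ 5 → s₁.var z = s.var z := fun z e1 e2 e3 e4 => by
    simp [hs₁, e1, e2, e3, e4]
  have hv25 : s₁.var 25 = 1 := by simp [hs₁, Expr.eval, hone]
  have hv3 : s₁.var 3 = 0 := by simp [hs₁, Expr.eval]
  have hv4 : s₁.var 4 = 2 * k := by simp [hs₁, Expr.eval, Op.eval, htwo, h2, h2k]
  have hv5 : s₁.var 5 = n := by simp [hs₁, Expr.eval, h0]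
  have ha : s₁.arr = s.arr := rfl
  clear_value s₁
  refine (does_for (N := n) (fun i τ s' => τ ≤ 24 * i ∧ ∀ v < i,
    s'.arr 2 v = 0 ∧ s'.arr 7 v = v ∧ s'.arr 8 v = v) (24 * n) (by norm_num)
    (by simp [Cmd.KeepsVar]) (by simp [Cmd.KeepsVar])
    ((hv 0 (by norm_num) (by norm_num) (by norm_num) (by norm_num)).trans h0) (by omega) (by simp)
    (fun i τ s' hi h => h.1.trans (by omega)) ?_).mono ?_
  · rintro i τ s' hi ⟨hτ, hI⟩ h7 - - -
    simp only [does_seq, does_store]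
    refine ⟨by simp only [Expr.cost]; omega, fun v hv => ?_⟩
    simp only [Expr.eval, arr_setVar, arr_setArr, var_setArr, h7]
    simp only [Nat.reduceEqDiff, if_true, if_false, Nat.zero_mod]
    rcases Nat.lt_succ_iff_lt_or_eq.1 hv with hv | rfl
    · simp only [Function.update_of_ne hv.ne]; exact hI v hv
    · simp
  rintro t₂ s₂ ⟨τ₂, rfl, ⟨hτ2, hI2⟩, -, hv2, ha2⟩
  rw [does_seq]
  refine (does_for (N := S.m) (fun i τ s' => τ ≤ 12 * i ∧ ∀ e < i, s'.arr 5 e = 0) (12 * S.m)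
    (by norm_num) (by simp [Cmd.KeepsVar]) (by simp [Cmd.KeepsVar]) ?_ (by omega)
    (by simp) (fun i τ s' hi h => h.1.trans (by omega)) ?_).mono ?_
  · rw [hv2 1 (by norm_num) (by simp [Cmd.KeepsVar]), hv 1 (by norm_num) (by norm_num) (by norm_num)
      (by norm_num), h1]
  · rintro i τ s' hi ⟨hτ, hI⟩ h6 - - -
    rw [does_store]
    refine ⟨by simp only [Expr.cost]; omega, fun v hv => ?_⟩
    simp only [Expr.eval, arr_setVar, arr_setArr, if_true, h6, Nat.zero_mod]
    rcases Nat.lt_succ_iff_lt_or_eq.1 hv with hv | rfl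
    · rw [Function.update_of_ne hv.ne]; exact hI v hv
    · simp
  rintro t₃ s₃ ⟨τ₃, rfl, ⟨hτ3, hI3⟩, -, hv3', ha3⟩
  have hv3'' : ∀ z, z ≠ 6 → z ≠ 7 → s₃.var z = s₁.var z := fun z e1 e2 => by
    rw [hv3' z e1 (by simp [Cmd.KeepsVar]), hv2 z e2 (by simp [Cmd.KeepsVar])]
  have ha3' : ∀ z, z ≠ 5 → s₃.arr z = s₂.arr z := fun z e1 => ha3 z (by simpa [Cmd.KeepsArr] using e1)
  have ha3'' : ∀ z, z ≠ 2 → z ≠ 5 → z ≠ 7 → z ≠ 8 → s₃.arr z = s.arr z := fun z e1 e2 e3 e4 => by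
    rw [ha3' z e2, ha2 z (by simp [Cmd.KeepsArr, e1, e3, e4]), ha]
  have hed3 : ∀ i < S.m, s₃.arr 0 i = (S.F i).1 ∧ s₃.arr 1 i = (S.F i).2 := by
    rw [ha3'' 0 (by norm_num) (by norm_num) (by norm_num) (by norm_num),
      ha3'' 1 (by norm_num) (by norm_num) (by norm_num) (by norm_num)]
    exact hed
  refine (does_buildAdj (N := n) (a := fun i => (S.F i).1) (b := fun i => (S.F i).2) (M := S.m)
    (by norm_num) (by norm_num) ?_ (by omega) (by simp [Expr.cost]) (by simp [Expr.cost]) ?_ ?_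
    ?_).mono ?_
  · rw [hv3'' 1 (by norm_num) (by norm_num), hv 1 (by norm_num) (by norm_num) (by norm_num)
      (by norm_num), h1]
  · intro s' i hi h6 hz
    simp only [Expr.eval, h6, hz 0 (by norm_num) (by norm_num) (by norm_num), (hed3 i hi).1]
  · intro s' i hi h6 hz
    simp only [Expr.eval, h6, hz 1 (by norm_num) (by norm_num) (by norm_num), (hed3 i hi).2]
  · intro v hv
    rw [ha3' 2 (by norm_num)]
    exact (hI2 v hv).1
  rintro t₄ s₄ ⟨ht4, hadj, hv4', ha4⟩
  have hvv : ∀ z, z ≠ 6 → z ≠ 7 → z < 22 ∨ z = 25 → s₄.var z = s₁.var z := fun z e1 e2 e3 => by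
    rw [hv4' z e1 (by omega) (by omega) (by omega), hv3'' z e1 e2]
  refine ⟨by simp only [Expr.cost]; omega, ?_, ⟨?_, fun v => (hadj v v.2).1, fun v => List.suffix_rfl,
    fun e he => ?_, fun v x hx hxr => absurd hx hxr, ?_⟩, ⟨⟨?_, ?_, ?_, ?_⟩, fun u => ?_,
    fun a ha' => ?_, fun i hi => absurd hi (Nat.not_lt_zero i)⟩, ?_⟩
  · rw [hvv 25 (by norm_num) (by norm_num) (by norm_num), hv25]
  · rw [ha4 0 (by norm_num) (by norm_num) (by norm_num),
      ha4 1 (by norm_num) (by norm_num) (by norm_num)]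
    exact hed3
  · rw [ha4 5 (by norm_num) (by norm_num) (by norm_num), hI3 e he, Net.edges_discrete]
    simp
  · rw [Net.edges_discrete]; exact Finset.empty_subset _
  · rw [hvv 0 (by norm_num) (by norm_num) (by norm_num), hv 0 (by norm_num) (by norm_num)
      (by norm_num) (by norm_num), h0]
  · rw [hvv 2 (by norm_num) (by norm_num) (by norm_num), hv 2 (by norm_num) (by norm_num)
      (by norm_num) (by norm_num), h2]
  · rw [hvv 3 (by norm_num) (by norm_num) (by norm_num), hv3]; rfl
  · rw [hvv 5 (by norm_num) (by norm_num) (by norm_num), hv5]; rfl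
  · rw [ha4 7 (by norm_num) (by norm_num) (by norm_num), ha3' 7 (by norm_num), (hI2 u u.2).2.1]
    rfl
  · rw [ha4 8 (by norm_num) (by norm_num) (by norm_num), ha3' 8 (by norm_num), (hI2 a ha').2.2]
    exact (Nat.mod_eq_of_lt ha').symm
  · rw [hvv 4 (by norm_num) (by norm_num) (by norm_num), hv4]

theorem does_maxKEC (hD : D.Supports K tp tq c) (hkK : k ∈ K) (hk : 1 ≤ k) (hn : 2 ≤ n)
    (htp : 0 ≤ tp k n) (hw : (n + k + 2) ^ c ≤ 2 ^ w) (hm : n + 2 * S.m + 2 < 2 ^ w)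
    (hq : 5 * (k * n) < 2 ^ w) (hs : s.IsWord w) (h0 : s.var 0 = n) (h1 : s.var 1 = S.m)
    (h2 : s.var 2 = k) (hed : ∀ i < S.m, s.arr 0 i = (S.F i).1 ∧ s.arr 1 i = (S.F i).2) :
    Does w (maxKEC D) s fun t s' => (∃ lab : Fin n → ℕ, IsKPart k S.edges lab ∧
      ∀ u : Fin n, s'.arr 0 u = lab u) ∧
      t ≤ 260 * S.m + 50 * n + 50 + 3 * (Nat.log 2 n + 3) *
        batchTime (tp k n) (tq k n) k n (3 * (Nat.log 2 n + 3)) := by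
  have : NeZero n := ⟨by omega⟩
  unfold maxKEC
  rw [does_seq]
  refine (does_prepare hk hm hq hs h0 h1 h2 hed).mono ?_
  rintro t₁ s₁ ⟨ht1, h25, hB⟩
  rw [does_seq]
  refine (does_batches hD hkK hk hn htp hw hm hq h25 hB).mono ?_
  rintro t₂ s₂ ⟨N', hH, hP, ht2⟩
  refine (does_for (N := n) (fun i τ s' => τ ≤ 13 * i ∧
    ∀ u : Fin n, (u : ℕ) < i → s'.arr 0 u = N'.lab u) (13 * n) (by norm_num)
    (by simp [Cmd.KeepsVar]) (by simp [Cmd.KeepsVar]) hH.vars.1 (by omega) (by simp)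
    (fun i τ s' hi h => h.1.trans (by omega)) ?_).mono ?_
  · rintro i τ s' hi ⟨hτ, hI⟩ h7 - - hfa
    have ha7 : s'.arr 7 i = N'.lab ⟨i, hi⟩ := by
      rw [hfa 7 (by simp [Cmd.KeepsArr])]; exact hH.lab ⟨i, hi⟩
    rw [does_store]
    refine ⟨by simp only [Expr.cost]; omega, fun u hu => ?_⟩
    simp only [Expr.eval, arr_setVar, arr_setArr, if_true, h7, ha7]
    rw [Function.update_apply]
    split
    · next h => rw [show u = ⟨i, hi⟩ from Fin.ext h]
    · exact hI u (by omega)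
  · rintro t₃ s₃ ⟨τ, rfl, ⟨hτ, hI⟩, -, -, -⟩
    refine ⟨⟨N'.lab, hP, fun u => hI u u.2⟩, ?_⟩
    have hL : ∑ u : Fin n, (S.L u).length ≤ 2 * S.m := by
      rw [← Finset.sum_range fun v => (S.L v).length]
      refine (Net.sum_length_adjList_le _ _ _ _).trans (Nat.mul_le_mul_left _ ?_)
      exact (Finset.card_filter_le _ _).trans (by simp)
    omega

end Source

/-! ### The input -/

section

variable {n : ℕ} {G : SimpleGraph (Fin n)} {es : List (Fin n × Fin n)}

theorem IsEdgeList.simple (h : IsEdgeList G es) : Simple es.toFinset := by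
  refine ⟨fun p hp hne => ?_, fun p hp q hq hpq => ?_⟩
  · have := (h.2 s(p.1, p.2)).1 (List.mem_map_of_mem (List.mem_toFinset.1 hp))
    rw [SimpleGraph.mem_edgeSet, hne] at this
    exact G.loopless.irrefl _ this
  · simp only [List.coe_toFinset, Set.mem_ofPred_eq] at hp hq
    exact List.inj_on_of_nodup_map h.1 hp hq hpq

theorem IsEdgeList.graphOf_eq (h : IsEdgeList G es) : graphOf es.toFinset = G := by
  ext u v
  rw [adj_graphOf h.simple, ← SimpleGraph.mem_edgeSet, ← h.2, List.mem_map]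
  simp

theorem image_getD (es : List (Fin n × Fin n)) (d : Fin n × Fin n) :
    (Finset.range es.length).image (fun i => es.getD i d) = es.toFinset := by
  ext p
  simp only [Finset.mem_image, Finset.mem_range, List.mem_toFinset, List.mem_iff_getElem]
  refine exists_congr fun i => ⟨fun ⟨hi, h⟩ => ⟨hi, ?_⟩, fun ⟨hi, h⟩ => ⟨hi, ?_⟩⟩
  · rwa [List.getD_eq_getElem _ _ hi] at h
  · rwa [List.getD_eq_getElem _ _ hi]

/-- The input graph. -/
def IsEdgeList.source [NeZero n] (h : IsEdgeList G es) : Source n where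
  m := es.length
  F := fun i => es.getD i (0, 0)
  inj := by
    intro i hi j hj hij
    rw [List.getD_eq_getElem _ _ hi, List.getD_eq_getElem _ _ hj] at hij
    exact (List.Nodup.getElem_inj_iff h.1.of_map).1 hij
  simple := by rw [image_getD]; exact h.simple

theorem IsEdgeList.edges_source [NeZero n] (h : IsEdgeList G es) :
    h.source.edges = es.toFinset := image_getD es _

end

/-! ### Final estimates -/

theorem _root_.WordRAM.Exec.one_le {w : ℕ} {c : Cmd} {s s' : State} {t : ℕ}
    (h : Exec w c s t s') : 1 ≤ t := by
  induction h <;> omega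

/-- The bounds are arbitrary real functions, but running the algorithm on the empty graph shows that
they are not too small, since every execution takes a step. The bound on `tq` absorbs all terms
without `tp`. -/
theorem Decremental.Supports.nonneg_and_one_le {D : Decremental} {K : Set ℕ} {tp tq : ℕ → ℕ → ℝ}
    {c k n : ℕ} (h : D.Supports K tp tq c) (hk : k ∈ K) (hn : 2 ≤ n) :
    0 ≤ tp k n ∧ 1 ≤ tq k n := by
  have hle : n + k + 2 ≤ (n + k + 2) ^ (c + 1) := Nat.le_self_pow (by omega) _
  have hpow : (n + k + 2) ^ (c + 1) < 2 ^ ((n + k + 2) ^ (c + 1)) := Nat.lt_two_pow_self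
  have hc : (n + k + 2) ^ c ≤ (n + k + 2) ^ (c + 1) := Nat.pow_le_pow_right (by omega) (by omega)
  obtain ⟨t, s', h1, h2, h3⟩ := h k hk n hn ⊥ [] ⟨by simp, by simp⟩ ((n + k + 2) ^ (c + 1))
    (hc.trans hpow.le)
    ⟨fun x => if x = 0 then n else if x = 2 then k else 0, fun _ _ => 0⟩
    ⟨fun x => by dsimp only; split_ifs <;> omega, fun _ _ => by dsimp only; omega⟩
    ⟨rfl, rfl, rfl, by simp⟩
  constructor
  · have ht : (0 : ℝ) ≤ t := Nat.cast_nonneg t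
    have hn' : (0 : ℝ) < n + (([] : List (Fin n × Fin n)).length : ℝ) := by
      have : (2 : ℝ) ≤ n := by exact_mod_cast hn
      simp
      linarith
    exact nonneg_of_mul_nonneg_left (ht.trans h2) hn'
  · obtain ⟨t', s'', h4, h5, -⟩ := h3 [.query ⟨0, by omega⟩ ⟨0, by omega⟩]
    have : (1 : ℝ) ≤ t' := by exact_mod_cast h4.one_le
    linarith

/-- One logarithm comes from the number of batches. The other comes from the number of stored edges
in the term with `tp` and from the potential in the term with `tq`. -/
theorem batchTime_le {tp tq : ℝ} {k n : ℕ} (htp : 0 ≤ tp) (htq : 1 ≤ tq) (hk : 1 ≤ k)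
    (hn : 2 ≤ n) :
    ((3 * (Nat.log 2 n + 3) * batchTime tp tq k n (3 * (Nat.log 2 n + 3)) : ℕ) : ℝ) ≤
      300000 * ((tp + tq) * (k * n * (Nat.log 2 n : ℝ) ^ 2)) := by
  have hL : 1 ≤ Nat.log 2 n := Nat.log_pos (by norm_num) hn
  set l : ℝ := (Nat.log 2 n : ℝ) with hl
  have hl1 : (1 : ℝ) ≤ l := by rw [hl]; exact_mod_cast hL
  have hk' : (1 : ℝ) ≤ k := by exact_mod_cast hk
  have hn' : (2 : ℝ) ≤ n := by exact_mod_cast hn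
  set x : ℝ := k * n with hx
  have hnx : (n : ℝ) ≤ x := by rw [hx]; nlinarith
  set y : ℝ := x * l with hy
  have hxy : x ≤ y := by rw [hy]; nlinarith
  have hx0 : 0 ≤ x := by linarith
  have hy1 : 1 ≤ y := by linarith
  have hF1 : (⌊tp * (n + 3 * (k * n) * (3 * (Nat.log 2 n + 3) : ℕ))⌋₊ : ℝ) ≤ tp * (37 * y) := by
    refine (Nat.floor_le (by positivity)).trans (mul_le_mul_of_nonneg_left ?_ htp)
    push_cast
    rw [← hl, ← hx]
    nlinarith
  have hF2 : (⌊tq⌋₊ : ℝ) ≤ tq := Nat.floor_le (by linarith)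
  have hty : y ≤ tq * y := by nlinarith
  have hP : (batchTime tp tq k n (3 * (Nat.log 2 n + 3)) : ℝ) ≤ 25000 * ((tp + tq) * y) := by
    unfold batchTime
    push_cast at hF1 ⊢
    rw [← hl, ← hx] at hF1 ⊢
    have h1 : (4 * (⌊tq⌋₊ : ℝ) + 360) * (9 * x * (2 * l + 4)) ≤ (364 * tq) * (54 * y) := by
      refine mul_le_mul (by linarith) ?_ (by positivity) (by linarith)
      rw [hy]; nlinarith
    have h2 : ((⌊tq⌋₊ : ℝ) + 30) * n ≤ (31 * tq) * y :=
      mul_le_mul (by linarith) (by linarith) (by linarith) (by linarith)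
    have h3 : (n : ℝ) + 3 * x * (3 * (l + 3)) ≤ 37 * y := by rw [hy]; nlinarith
    have h4 : 0 ≤ tp * y := by positivity
    nlinarith
  have hJ : ((3 * (Nat.log 2 n + 3) : ℕ) : ℝ) ≤ 12 * l := by
    push_cast; rw [← hl]; linarith
  rw [Nat.cast_mul]
  calc _ ≤ (12 * l) * (25000 * ((tp + tq) * y)) :=
        mul_le_mul hJ hP (Nat.cast_nonneg _) (by linarith)
    _ = _ := by rw [hy]; ring

end EdgeConn

theorem mainTheorem3 :
    ∃ C : ℝ, ∀ (K : Set ℕ) (tp tq : ℕ → ℕ → ℝ) (c : ℕ) (D : EdgeConn.Decremental),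
      (∀ k ∈ K, 1 ≤ k) →
      (∀ k ∈ K, Monotone (tp k)) → (∀ k ∈ K, Monotone (tq k)) →
      D.Supports K tp tq c →
      ∃ (P : WordRAM.Cmd) (c' : ℕ),
        EdgeConn.ComputesMaxKEC P K
          (fun k n m => C * (m + (tp k n + tq k n) * (k * n * Real.log n ^ 2))) c' := by
  -- The constant exceeds `4 * 300000`, where `4` converts squared binary into natural logarithms.
  -- The exponent `c + 3` makes words large enough both for the given algorithm and for the numbers
  -- `n + 2 m + 2` and `5 k n`.
  refine ⟨1300000, fun K tp tq c D hK _ _ hD => ⟨EdgeConn.maxKEC D, c + 3, ?_⟩⟩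
  intro k hkK n hn G es hes w hw s hs hin
  obtain ⟨h0, h1, h2, h3⟩ := hin
  have hk := hK k hkK
  obtain ⟨htp, htq⟩ := hD.nonneg_and_one_le hkK hn
  have : NeZero n := ⟨by omega⟩
  have hm2 : es.length ≤ n * n := hes.source.m_le
  set x := n + k + 2 with hx
  have hx5 : 5 ≤ x := by omega
  have hwc : x ^ c ≤ 2 ^ w := (Nat.pow_le_pow_right (by omega) (by omega)).trans hw
  have hw3 : x ^ 3 ≤ 2 ^ w := (Nat.pow_le_pow_right (by omega) (by omega)).trans hw
  have hx3 : 5 * (x * x) ≤ x ^ 3 := by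
    rw [pow_succ, pow_two, mul_comm]; exact Nat.mul_le_mul_left _ hx5
  have hnn : n * n + 4 * n + 4 ≤ x * x := by
    calc n * n + 4 * n + 4 = (n + 2) * (n + 2) := by ring
      _ ≤ _ := Nat.mul_le_mul (by omega) (by omega)
  have hkn : k * n < x * x := by
    calc k * n ≤ x * n := Nat.mul_le_mul_right _ (by omega)
      _ < x * x := Nat.mul_lt_mul_of_pos_left (by omega) (by omega)
  obtain ⟨t, s', ht, ⟨lab, hP, hlab⟩, hT⟩ := EdgeConn.Source.does_maxKEC (S := hes.source) hD hkK hk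
    hn htp hwc (show n + 2 * es.length + 2 < 2 ^ w by omega) (by omega) hs h0 h1 h2 fun i hi => by
      have : hes.source.F i = es[i] := List.getD_eq_getElem _ _ hi
      rw [this]
      exact h3 i hi
  refine ⟨t, s', ht, ?_, fun T => ?_⟩
  · have hb := EdgeConn.batchTime_le htp htq hk hn
    have hT' : (t : ℝ) ≤ 260 * es.length + 50 * n + 50 +
        ((3 * (Nat.log 2 n + 3) * EdgeConn.batchTime (tp k n) (tq k n) k n
          (3 * (Nat.log 2 n + 3)) : ℕ) : ℝ) := by exact_mod_cast hT
    have hl1 : (1 : ℝ) ≤ Nat.log 2 n := by exact_mod_cast Nat.log_pos (by norm_num) hn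
    have hk' : (1 : ℝ) ≤ k := by exact_mod_cast hk
    have hn' : (2 : ℝ) ≤ n := by exact_mod_cast hn
    have hlog : (Nat.log 2 n : ℝ) ≤ 2 * Real.log n := by
      have h4 : ((2 ^ Nat.log 2 n : ℕ) : ℝ) ≤ n := by
        exact_mod_cast Nat.pow_log_le_self 2 (by omega)
      have h5 := Real.log_le_log (by positivity) h4
      rw [Nat.cast_pow, Real.log_pow] at h5
      have h6 := Real.log_two_gt_d9
      push_cast at h5
      nlinarith
    have hsq : (Nat.log 2 n : ℝ) ^ 2 ≤ 4 * Real.log n ^ 2 := by nlinarith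
    have hsq1 : (1 : ℝ) ≤ 4 * Real.log n ^ 2 := by nlinarith
    have hkn' : (n : ℝ) ≤ k * n := by nlinarith
    have hmain : (tp k n + tq k n) * (k * n * (Nat.log 2 n : ℝ) ^ 2) ≤
        4 * ((tp k n + tq k n) * (k * n * Real.log n ^ 2)) := by
      have := mul_le_mul_of_nonneg_left hsq (show 0 ≤ (tp k n + tq k n) * (k * n) by positivity)
      linarith
    have hn1 : (n : ℝ) ≤ 4 * ((tp k n + tq k n) * (k * n * Real.log n ^ 2)) := by
      have h4 : (n : ℝ) * 1 ≤ ((tp k n + tq k n) * (k * n)) * (4 * Real.log n ^ 2) := by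
        refine mul_le_mul ?_ hsq1 (by norm_num) (by positivity)
        nlinarith
      linarith
    have hm0 : (0 : ℝ) ≤ es.length := Nat.cast_nonneg _
    dsimp only
    linarith
  · have hS := hes.edges_source
    rw [hS] at hP
    have := hP.isMaxKECSubgraph_iff hes.simple T
    rw [hes.graphOf_eq] at this
    rw [this]
    simp only [hlab]
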